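/- **Setting.** Let $u\in(0,1)^N$, $v\in(0,1)^M$ have a unique largest entry $u_{i_0}=\max_i u_i$ and $v_{j_0}=\max_j v_j$; $(i_0,j_0)$ is the best pair. Sampling the pair $(i,j)$ at time $t$ yields $X_{i,j,t}$, where the $X_{i,j,t}$ are independent and $X_{i,j,t}-u_iv_j$ is centred and sub-Gaussian with variance proxy $1/4$ (for instance, $X_{i,j,t}\in[0,1]$ with mean $u_iv_j$). Put $\Delta^U_i=\max_k u_k-u_i$, $\Delta^V_j=\max_k v_k-v_j$ and $$A(u,v)=\sum_{i:\Delta^U_i>0}\frac1{(\max_k v_k\cdot\Delta^U_i)^2}+\sum_{j:\Delta^V_j>0}\frac1{(\max_k u_k\cdot\Delta^V_j)^2}.$$ **Algorithm (Pair-Elim, pure exploration, precision $\delta$).** The algorithm keeps a set of active rows and a set of active columns, and works in rounds; in each round all active rows are sampled against one randomly chosen active column (row samples), then all active columns against one randomly chosen active row (column samples). The chosen active item is the image of a uniform item under the domination map, which sends an active item to itself and an eliminated one to an active item by which it was, directly or through a chain, dominated. An item's reward is tracked against each single opponent and against all opponents together; when the number of samples of a tracked parameter equals $k_l=\lceil 4^{l+1}\log\beta_l\rceil$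 for some $l\ge1$, its confidence interval is set to (empirical mean) $\pm\sqrt{\log(\beta_l)/k_l}$. At the start of each round, active items are examined in increasing order of index, and an item is eliminated if one of its upper confidence bounds is below the corresponding lower bound of an item that is still active (it is then said to be dominated by the item of largest index with this property). Rows use $\beta_l=\pi l\sqrt{(N+1)(M+1)/(3\delta)}$, and all row samples of the run. Columns use $\beta_l=2^{2^w}$ during window $w=0,1,\dots$; window $w$ ends after the first round at which more than $2^{2^w}$ samples have been taken in it, and then all columns are active again and the column statistics restart from zero. Once a single row is active, columns restart a last time, with the same $\beta_l$ as rows and no more windows, and the pair is returned, and the algorithm stops, at the end of a round in which a single column is active. Let $\tau_\delta$ be the total number of samples taken before it stops ($\infty$ if it never stops). **Theorem.** There is a universal constant $c_{\mathfrak u}>0$, and for all $N,M\ge1$ and $u,v$ as above a constant $c_{\mathfrak p}>0$ depending only on $(N,M,u,v)$, such that for every $\delta\in(0,1)$ and all reward distributions as above: 1. Pair-Elim stops and outputs $(i_0,j_0)$ with probability at least $1-\delta$. 2. With $B_\delta=c_{\mathfrak u}A(u,v)\log(1/\delta)+c_{\mathfrak p}\max\{1,\log\log(1/\delta)\}$,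 $$\mathbb E\big[\tau_\delta\,\mathbf 1\{\text{the output is }(i_0,j_0)\}\big]\le B_\delta,$$ and if the entries of $u$ are pairwise distinct and those of $v$ are pairwise distinct, then $\mathbb E[\tau_\delta]\le B_\delta$. This is tight up to a multiplicative constant. Let $\sigma^2\ge0$, $\delta\in(0,1)$, and suppose that a (possibly randomised) sequential algorithm is $\delta$-PAC for independent Gaussian rewards $X_{i,j,t}\sim\mathcal N(u_iv_j,\sigma^2)$, that is, for all $u\in(0,1)^N$, $v\in(0,1)^M$ with a unique best pair it outputs this pair with probability at least $1-\delta$. Then, for all such $u,v$, its number of samples $\tau_\delta$ satisfies $$\mathbb E[\tau_\delta]\ge\sigma^2A(u,v)\big(\log(1/\delta)-1\big).$$ -/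

import Mathlib

open MeasureTheory ProbabilityTheory
open scoped ENNReal NNReal

namespace PairSelection

/-! ### Sequential sampling of pairs -/

/-- At each step an algorithm either samples a pair (`Sum.inl`), or stops and answers with a pair
(`Sum.inr`). -/
abbrev Action (N M : ℕ) : Type := (Fin N × Fin M) ⊕ (Fin N × Fin M)

/-- A reward table: the entry `(i, j, t)` is the reward observed if the pair `(i, j)` is the one
sampled at time `t` (that is, after `t` earlier samples). -/
abbrev RewardTable (N M : ℕ) : Type := Fin N × Fin M × ℕ → ℝ

/-- A (possibly randomised) sequential algorithm. The internal randomness is a seed drawn once,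
independently of the rewards; the action is a function of the seed and of the list of rewards
observed so far (most recent one first; the pairs sampled so far are determined by the seed and
this list). -/
structure Algorithm (N M : ℕ) where
  Seed : Type
  [seedSpace : MeasurableSpace Seed]
  seedLaw : Measure Seed
  [seedProb : IsProbabilityMeasure seedLaw]
  action : Seed → List ℝ → Action N M

attribute [instance] Algorithm.seedSpace Algorithm.seedProb

namespace Algorithm

variable {N M : ℕ}

/-- All decision rules are measurable. -/
def IsMeasurable (A : Algorithm N M) : Prop :=
  ∀ n : ℕ, Measurable fun p : A.Seed × (Fin n → ℝ) => A.action p.1 (List.ofFn p.2)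

/-- The rewards observed before time `t` (the list no longer changes once the algorithm stops). -/
def history (A : Algorithm N M) (x : RewardTable N M) (s : A.Seed) : ℕ → List ℝ
  | 0 => []
  | t + 1 =>
    match A.action s (A.history x s t) with
    | Sum.inl p => x (p.1, p.2, t) :: A.history x s t
    | Sum.inr _ => A.history x s t

/-- The algorithm stops at some time and answers `p`. -/
def Outputs (A : Algorithm N M) (x : RewardTable N M) (s : A.Seed) (p : Fin N × Fin M) : Prop :=
  ∃ t : ℕ, A.action s (A.history x s t) = Sum.inr p

/-- The number of samples taken before the algorithm stops, `⊤` if it never stops. -/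
noncomputable def stoppingTime (A : Algorithm N M) (x : RewardTable N M) (s : A.Seed) : ℕ∞ :=
  ⨅ (t : ℕ) (_ : ∃ p, A.action s (A.history x s t) = Sum.inr p), (t : ℕ∞)

/-- The joint law of the reward table and of the seed. -/
noncomputable def runLaw (A : Algorithm N M) (P : Measure (RewardTable N M)) :
    Measure (RewardTable N M × A.Seed) :=
  P.prod A.seedLaw

/-- The event that the algorithm stops and answers `p`. -/
def outputEvent (A : Algorithm N M) (p : Fin N × Fin M) : Set (RewardTable N M × A.Seed) :=
  {q | A.Outputs q.1 q.2 p}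

end Algorithm

/-! ### Instances -/

/-- The gap `max x - x i`. -/
noncomputable def gap {n : ℕ} (x : Fin n → ℝ) (i : Fin n) : ℝ := (⨆ k, x k) - x i

/-- The complexity `A(u, v)`; `⨆ j, v j` and `⨆ i, u i` are the maxima of `v` and `u`. -/
noncomputable def complexity {N M : ℕ} (u : Fin N → ℝ) (v : Fin M → ℝ) : ℝ :=
  (∑ i with 0 < gap u i, 1 / ((⨆ j, v j) * gap u i) ^ 2) +
    ∑ j with 0 < gap v j, 1 / ((⨆ i, u i) * gap v j) ^ 2

/-- The parameters lie in `(0, 1)`, `i₀` is the unique best row and `j₀` the unique best column. -/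
structure IsInstance {N M : ℕ} (u : Fin N → ℝ) (v : Fin M → ℝ) (i₀ : Fin N) (j₀ : Fin M) :
    Prop where
  row_mem : ∀ i, u i ∈ Set.Ioo (0 : ℝ) 1
  col_mem : ∀ j, v j ∈ Set.Ioo (0 : ℝ) 1
  row_best : ∀ i, i ≠ i₀ → u i < u i₀
  col_best : ∀ j, j ≠ j₀ → v j < v j₀

/-- The reward of pair `(i, j)` at time `t` is `u i * v j` plus a noise that is centred and
sub-Gaussian with variance proxy `1/4` (the constant that Hoeffding's lemma gives for rewards in
`[0, 1]`). The noise need not be identically distributed. -/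
def IsSubgaussianModel {N M : ℕ} (u : Fin N → ℝ) (v : Fin M → ℝ)
    (F : Fin N × Fin M × ℕ → Measure ℝ) : Prop :=
  ∀ i j t, HasSubgaussianMGF (fun y => y - u i * v j) (1 / 4 : ℝ≥0) (F (i, j, t))

/-- Independent Gaussian rewards with means `u i * v j` and variance `σ2`. -/
noncomputable def gaussianTable {N M : ℕ} (u : Fin N → ℝ) (v : Fin M → ℝ) (σ2 : ℝ≥0) :
    Measure (RewardTable N M) :=
  Measure.infinitePi fun q : Fin N × Fin M × ℕ => gaussianReal (u q.1 * v q.2.1) σ2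

/-- An algorithm is `δ`-PAC, for Gaussian rewards of variance `σ2`, if on every instance it outputs
the best pair with probability at least `1 - δ`. -/
def Algorithm.IsPAC {N M : ℕ} (A : Algorithm N M) (σ2 : ℝ≥0) (δ : ℝ) : Prop :=
  ∀ (u : Fin N → ℝ) (v : Fin M → ℝ) (i₀ : Fin N) (j₀ : Fin M), IsInstance u v i₀ j₀ →
    ENNReal.ofReal (1 - δ) ≤ A.runLaw (gaussianTable u v σ2) (A.outputEvent (i₀, j₀))

/-! ### Elimination on one side (rows or columns) -/

/-- The data kept for the `n` items of one side, which are sampled against the `m` items of the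
other side: number and sum of the samples of each pair, current confidence bounds, and the
domination map. The bounds at `(some k, i)` are those of item `i` against item `k`, the bounds at
`(none, i)` are those of item `i` against all items together. -/
structure Elim (n m : ℕ) where
  count : Fin n → Fin m → ℕ
  total : Fin n → Fin m → ℝ
  lo : Option (Fin m) → Fin n → EReal
  hi : Option (Fin m) → Fin n → EReal
  rep : Fin n → Fin n

namespace Elim

variable {n m : ℕ}

/-- No samples, no information, every item active. -/
noncomputable def fresh (n m : ℕ) : Elim n m where
  count := fun _ _ => 0
  total := fun _ _ => 0
  lo := fun _ _ => ⊥
  hi := fun _ _ => ⊤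
  rep := id

/-- The active items: the image of the domination map. -/
def active (e : Elim n m) : Finset (Fin n) := Finset.univ.image e.rep

/-- Add the sample `x` of item `i` against item `k`. -/
def record (e : Elim n m) (i : Fin n) (k : Fin m) (x : ℝ) : Elim n m :=
  { e with
    count := fun a b => if a = i ∧ b = k then e.count a b + 1 else e.count a b
    total := fun a b => if a = i ∧ b = k then e.total a b + x else e.total a b }

/-- Number of samples of a tracked parameter. -/
def num (e : Elim n m) : Option (Fin m) → Fin n → ℕ
  | some k, i => e.count i k
  | none, i => ∑ k, e.count i k

/-- Empirical mean of a tracked parameter. -/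
noncomputable def mean (e : Elim n m) : Option (Fin m) → Fin n → ℝ
  | some k, i => e.total i k / e.count i k
  | none, i => (∑ k, e.total i k) / ((∑ k, e.count i k : ℕ) : ℝ)

/-- The sample sizes `k_l` at which confidence bounds are updated. -/
noncomputable def level (β : ℕ → ℝ) (l : ℕ) : ℕ := ⌈(4 : ℝ) ^ (l + 1) * Real.log (β l)⌉₊

/-- The half-width of the confidence interval of level `l`. -/
noncomputable def radius (β : ℕ → ℝ) (l : ℕ) : ℝ := √(Real.log (β l) / level β l)

open Classical in
/-- Update of the confidence bounds: those of the tracked parameters whose number of samples is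
`k_l` for some `l > 0` are recomputed, the others are left unchanged. -/
noncomputable def refresh (e : Elim n m) (β : ℕ → ℝ) : Elim n m :=
  { e with
    lo := fun k i =>
      if h : ∃ l, 0 < l ∧ e.num k i = level β l then
        ((e.mean k i - radius β (Nat.find h) : ℝ) : EReal)
      else e.lo k i
    hi := fun k i =>
      if h : ∃ l, 0 < l ∧ e.num k i = level β l then
        ((e.mean k i + radius β (Nat.find h) : ℝ) : EReal)
      else e.hi k i }

/-- Item `i` is provably dominated by item `j`. -/
def Dominated (e : Elim n m) (i j : Fin n) : Prop := ∃ k, e.hi k i < e.lo k j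

open Classical in
/-- If the item `d` is still active for the map `r` and is dominated by an active item, it is
eliminated: what was mapped to `d` is now mapped to the last active item that dominates `d`. -/
noncomputable def dropItem (e : Elim n m) (r : Fin n → Fin n) (d : Fin n) : Fin n → Fin n :=
  let D : Finset (Fin n) := (Finset.univ.image r).filter fun j => e.Dominated d j
  if h : d ∈ Finset.univ.image r ∧ D.Nonempty then
    fun i => if r i = d then D.max' h.2 else r i
  else r

/-- Update of the confidence bounds, followed by the elimination of the dominated items. -/
noncomputable def update (e : Elim n m) (β : ℕ → ℝ) : Elim n m :=
  let e' := e.refresh β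
  { e' with rep := (List.finRange n).foldl e'.dropItem e'.rep }

end Elim

/-! ### Pair-Elim in pure exploration mode -/

/-- The state of Pair-Elim between two samples. -/
structure State (N M : ℕ) where
  /-- row statistics, from all row-exploration samples of the run -/
  rows : Elim N M
  /-- column statistics, from the column-exploration samples of the current window -/
  cols : Elim M N
  /-- `true` until the best row is detected -/
  rowPhase : Bool
  /-- index `w` of the window -/
  window : ℕ
  /-- number of samples taken in the window -/
  spent : ℕ
  /-- number of rounds begun -/
  round : ℕ
  /-- row-exploration samples still to be taken in the round -/
  todoRows : List (Fin N × Fin M)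
  /-- column-exploration samples still to be taken in the round -/
  todoCols : List (Fin N × Fin M)
  /-- the returned pair -/
  result : Option (Fin N × Fin M)

namespace State

variable {N M : ℕ}

/-- `β_l = π √((N+1)(M+1)h/3) l` with `h = 1/δ`: intervals of overall confidence `1 - δ`. -/
noncomputable def sureBeta (N M : ℕ) (δ : ℝ) (l : ℕ) : ℝ :=
  Real.pi * √(((N : ℝ) + 1) * ((M : ℝ) + 1) * (1 / δ) / 3) * l

/-- `β_l = 2^(2^w)`: intervals that hold over window `w`. -/
noncomputable def windowBeta (w : ℕ) (_l : ℕ) : ℝ := 2 ^ (2 ^ w)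

/-- The `β` used for columns: the one of the window until the best row is detected, the one of
confidence `1 - δ` afterwards. -/
noncomputable def colBeta (δ : ℝ) (st : State N M) : ℕ → ℝ :=
  if st.rowPhase then windowBeta st.window else sureBeta N M δ

/-- Start of a round: update confidence bounds, domination maps and active sets, pick a uniform
column and a uniform row, and plan to sample all active rows against the image of the picked column,
then all active columns against the image of the picked row. The picks of the successive rounds
are the entries of `ξ`. -/
noncomputable def beginRound (δ : ℝ) (ξ : ℕ → Fin N × Fin M) (st : State N M) : State N M :=
  let cols := st.cols.update (st.colBeta δ)
  let rows := st.rows.update (sureBeta N M δ)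
  let i := rows.rep (ξ st.round).1
  let j := cols.rep (ξ st.round).2
  { st with
    rows := rows
    cols := cols
    round := st.round + 1
    todoRows := ((List.finRange N).filter fun a => a ∈ rows.active).map fun a => (a, j)
    todoCols := ((List.finRange M).filter fun b => b ∈ cols.active).map fun b => (i, b) }

/-- End of a round. If the best row has just been detected, the search for the best column with
confidence `1 - δ` starts from scratch; before that, a new window starts when the current one is
over. In the second phase the pair is returned as soon as a single column is active (the domination
maps are then constant). -/
noncomputable def endRound [NeZero N] [NeZero M] (st : State N M) : State N M :=
  if st.rowPhase then
    if st.rows.active.card = 1 then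
      { st with rowPhase := false, cols := Elim.fresh M N }
    else if 2 ^ (2 ^ st.window) < st.spent then
      { st with window := st.window + 1, spent := 0, cols := Elim.fresh M N }
    else st
  else if st.cols.active.card = 1 then
    { st with result := some (st.rows.rep 0, st.cols.rep 0) }
  else st

/-- Record one reward, for the next planned sample. -/
def receive (x : ℝ) (st : State N M) : State N M :=
  match st.todoRows, st.todoCols with
  | p :: L, _ =>
    { st with rows := st.rows.record p.1 p.2 x, spent := st.spent + 1, todoRows := L }
  | [], p :: L =>
    { st with cols := st.cols.record p.2 p.1 x, spent := st.spent + 1, todoCols := L }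
  | [], [] => st

/-- Process one reward; at the end of a round, return or begin the next one. -/
noncomputable def observe [NeZero N] [NeZero M] (δ : ℝ) (ξ : ℕ → Fin N × Fin M) (x : ℝ)
    (st : State N M) : State N M :=
  let st' := st.receive x
  if st'.todoRows = [] ∧ st'.todoCols = [] then
    let st'' := st'.endRound
    if st''.result = none then st''.beginRound δ ξ else st''
  else st'

/-- The state before the first round. -/
noncomputable def init (N M : ℕ) : State N M where
  rows := Elim.fresh N M
  cols := Elim.fresh M N
  rowPhase := true
  window := 0
  spent := 0
  round := 0
  todoRows := []
  todoCols := []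
  result := none

/-- The state after the rewards of a list (most recent one first). -/
noncomputable def after [NeZero N] [NeZero M] (δ : ℝ) (ξ : ℕ → Fin N × Fin M) :
    List ℝ → State N M
  | [] => (init N M).beginRound δ ξ
  | x :: L => (after δ ξ L).observe δ ξ x

/-- Sample the next planned pair, or answer (a plan is never empty before the answer). -/
def next [NeZero N] [NeZero M] (st : State N M) : Action N M :=
  match st.result with
  | some p => Sum.inr p
  | none =>
    match st.todoRows ++ st.todoCols with
    | p :: _ => Sum.inl p
    | [] => Sum.inr (0, 0)

end State

/-- Pair-Elim in pure exploration mode with precision `δ`. The seed is the sequence of independent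
uniform picks of a row and a column. -/
noncomputable def pairElim (N M : ℕ) [NeZero N] [NeZero M] (δ : ℝ) : Algorithm N M where
  Seed := ℕ → Fin N × Fin M
  seedLaw := Measure.infinitePi fun _ : ℕ => (PMF.uniformOfFintype (Fin N × Fin M)).toMeasure
  action := fun ξ L => (State.after δ ξ L).next

end PairSelection

/-!
The theorem has two independent halves.

**Upper bound.** A side (rows or columns) is followed through its statistics and planned samples
only (`SidePath`). In a round all active items are sampled against the same opponent, so the sample
counts of two active items agree at the end of every round, and since `u i * v j` is monotone in
each factor, the best item has the largest expected empirical mean for every tracked parameter,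
whatever the opponents were. The noise of a tracked parameter is controlled by an exponential
supermartingale, which gives a sub-Gaussian tail at the random time when the parameter reaches `k`
samples (`NoisePath.measure_exists_dev_ge`). Hence a one-sided confidence bound of level `l` fails
with probability at most `β_l ^ (-2)`, and for `State.sureBeta` these probabilities add up to at
most `δ` (`State.tsum_sureBeta_le`). So the event `State.bestSurvives` has probability at least
`1 - δ`, and a run that stops on this event returns the best pair.

The length of a run is counted in rounds. A round is *unsettled* if rows are still being compared
and `j₀` is not the only active column. A settled round of the first phase samples all rows against
`j₀`, and a round of the second phase samples all columns against the single remaining row; such a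
round is charged to a pair of active items with different means, up to at most one final round per
phase. Two items whose means differ by `g` are separated at the first level of radius below `g / 4`,
whose sample size is at most `32 / g ^ 2 * log (1 / δ)` plus a constant; if the deviations at this
level are too large, the next levels get their chance, and the expected additional number of
rounds is bounded uniformly in `δ` (`State.exists_level`, `NoisySide.lintegral_sepBound_le`).
Unsettled rounds are rare: in a window `w` without failure of the column intervals, there are
`O(2 ^ w)` of them, the logarithm of the length of the window, and a failure has probability of
order `2 ^ w * (2 ^ 2 ^ w) ^ (-2)`, which compensates the length `2 ^ 2 ^ w` of the window. The
number of unsettled rounds is therefore logarithmic in the length of the run, up to a variable of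
bounded expectation, and it is absorbed by the other rounds at the cost of a factor `2`
(`State.exists_unsettled_bound`).

On `State.bestSurvives` every charged pair contains the best item, which gives the complexity
`A(u, v)` (`State.exists_setLIntegral_bestSurvives_le`); as the expected length is finite, the run
stops almost surely on this event. If the entries of `u` and of `v` are pairwise distinct, the same
count with arbitrary pairs bounds the length by `O(log (1 / δ))` on the complement, which has
probability at most `δ`, so that the complement contributes a bounded amount
(`State.exists_setLIntegral_compl_le`). No term of order `log (log (1 / δ))` is needed.

**Lower bound.** Raising `u i` to slightly more than `u i₀` changes the best pair. The observations
under the two instances are related by their likelihood ratio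
(`Algorithm.lintegral_change_of_means`), so a `δ`-PAC algorithm has to collect enough information on
the difference of the means (`Algorithm.information_bound`), and this information is at most
`(v j₀ * gap u i) ^ 2 / (2 * σ2)` for each sample of the row `i`. Thus the row `i` is sampled at
least `2 * σ2 / (v j₀ * gap u i) ^ 2 * (log (1 / δ) - 1)` times in expectation, and similarly for
columns; every sample belongs to one row and to one column, which costs the factor `2`.
-/

namespace PairSelection

/-! ### Functionals of the observed rewards -/

instance instDiscreteAction (N M : ℕ) : DiscreteMeasurableSpace (Action N M) where
  forall_measurableSet _ :=
    measurableSet_sum_iff.2 ⟨MeasurableSet.of_discrete, MeasurableSet.of_discrete⟩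

/-- A function that depends on a countable-valued measurable quantity is measurable as soon as it
is so for each fixed value of this quantity. -/
theorem measurable_of_countable_cases {α β ι : Type*} [MeasurableSpace α] [MeasurableSpace β]
    [MeasurableSpace ι] [Countable ι] [DiscreteMeasurableSpace ι] {c : α → ι} (hc : Measurable c)
    {f : ι → α → β} (hf : ∀ i, Measurable (f i)) : Measurable fun a => f (c a) a :=
  (measurable_from_prod_countable_right (f := fun z : ι × α => f z.1 z.2) hf).comp
    (hc.prodMk measurable_id)

/-- A functional of a parameter and of a list of rewards is measurable when it is so on the lists
of each fixed length. -/
def ListMeasurable {α β : Type*} [MeasurableSpace α] [MeasurableSpace β]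
    (f : α → List ℝ → β) : Prop :=
  ∀ n : ℕ, Measurable fun p : α × (Fin n → ℝ) => f p.1 (List.ofFn p.2)

namespace ListMeasurable

variable {α β γ ι : Type*} [MeasurableSpace α] [MeasurableSpace β] [MeasurableSpace γ]

theorem comp {g : β → γ} (hg : Measurable g) {f : α → List ℝ → β} (hf : ListMeasurable f) :
    ListMeasurable fun a L => g (f a L) := fun n => hg.comp (hf n)

theorem of_length (g : ℕ → α → β) (hg : ∀ n, Measurable (g n)) :
    ListMeasurable fun a L => g L.length a := fun n => by
  simpa [Function.comp_def] using (hg n).comp measurable_fst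

theorem param {f : α → List ℝ → β} (hf : ListMeasurable f) {g : γ → α} (hg : Measurable g) :
    ListMeasurable fun c L => f (g c) L := fun n =>
  (hf n).comp (hg.prodMap measurable_id)

theorem nil {f : α → List ℝ → β} (hf : ListMeasurable f) : Measurable fun a => f a [] := by
  have := (hf 0).comp (measurable_id.prodMk (measurable_const (a := fun i : Fin 0 => (0 : ℝ))))
  simpa [Function.comp_def] using this

theorem cons {f : α → List ℝ → β} (hf : ListMeasurable f) :
    ListMeasurable fun (q : α × ℝ) L => f q.1 (q.2 :: L) := fun n => by
  have h : Measurable fun p : (α × ℝ) × (Fin n → ℝ) =>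
      (p.1.1, (Fin.cons p.1.2 p.2 : Fin (n + 1) → ℝ)) := by
    refine (measurable_fst.comp measurable_fst).prodMk (measurable_pi_iff.2 fun i => ?_)
    refine Fin.cases ?_ (fun j => ?_) i
    · simpa [Function.comp_def] using (measurable_snd (α := α)).comp measurable_fst
    · simpa [Function.comp_def] using (measurable_pi_apply j).comp measurable_snd
  have := (hf (n + 1)).comp h
  simpa [Function.comp_def, List.ofFn_cons] using this

theorem of_cons {f : α → List ℝ → β} (h0 : Measurable fun a => f a [])
    (h1 : ∀ n : ℕ, Measurable (fun p : α × (Fin n → ℝ) => f p.1 (List.ofFn p.2)) →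
      Measurable fun p : (α × ℝ) × (Fin n → ℝ) => f p.1.1 (p.1.2 :: List.ofFn p.2)) :
    ListMeasurable f := fun n => by
  induction n with
  | zero => simpa [Function.comp_def] using h0.comp measurable_fst
  | succ n ih =>
    have h : Measurable fun p : α × (Fin (n + 1) → ℝ) => ((p.1, p.2 0), fun i : Fin n =>
        p.2 i.succ) := by fun_prop
    have := (h1 n ih).comp h
    simpa [Function.comp_def, List.ofFn_succ] using this

theorem cases [MeasurableSpace ι] [Countable ι] [DiscreteMeasurableSpace ι] {c : α → List ℝ → ι}
    (hc : ListMeasurable c) {f : ι → α → List ℝ → β} (hf : ∀ i, ListMeasurable (f i)) :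
    ListMeasurable fun a L => f (c a L) a L := fun n =>
  measurable_of_countable_cases (hc n) fun i => hf i n

end ListMeasurable

/-! ### Resampling one reward -/

theorem measurable_update_pair {ι : Type*} [DecidableEq ι] (q : ι) :
    Measurable fun z : (ι → ℝ) × ℝ => Function.update z.1 q z.2 :=
  measurable_pi_iff.2 fun i => by
    by_cases h : i = q
    · subst h; simpa using measurable_snd
    · simpa [Function.update_of_ne h, Function.comp_def] using
          (measurable_pi_apply i).comp measurable_fst

theorem map_update_infinitePi {ι : Type*} [DecidableEq ι] (F : ι → Measure ℝ)
    [∀ q, IsProbabilityMeasure (F q)] (q : ι) :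
    ((Measure.infinitePi F).prod (F q)).map (fun z => Function.update z.1 q z.2) =
      Measure.infinitePi F := by
  have hm := measurable_update_pair (ι := ι) q
  refine Measure.eq_infinitePi F fun s t ht => ?_
  rw [Measure.map_apply hm (MeasurableSet.pi s.countable_toSet fun i _ => ht i)]
  by_cases hq : q ∈ s
  · have : (fun z : (ι → ℝ) × ℝ => Function.update z.1 q z.2) ⁻¹' (s : Set ι).pi t =
        ((s.erase q : Finset ι) : Set ι).pi t ×ˢ t q := by
      ext ⟨x, y⟩
      simp only [Set.mem_preimage, Set.mem_pi, Finset.mem_coe, Set.mem_prod, Finset.mem_erase]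
      constructor
      · intro h
        refine ⟨fun i hi => by simpa [hi.1] using h i hi.2, by simpa using h q hq⟩
      · rintro ⟨h1, h2⟩ i hi
        by_cases h : i = q
        · subst h; simpa using h2
        · simpa [h] using h1 i ⟨h, hi⟩
    rw [this, Measure.prod_prod, Measure.infinitePi_pi F fun i _ => ht i,
      Finset.prod_erase_mul _ _ hq]
  · have : (fun z : (ι → ℝ) × ℝ => Function.update z.1 q z.2) ⁻¹' (s : Set ι).pi t =
        (s : Set ι).pi t ×ˢ Set.univ := by
      ext ⟨x, y⟩
      simp only [Set.mem_preimage, Set.mem_pi, Finset.mem_coe, Set.mem_prod, Set.mem_univ,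
        and_true]
      refine forall₂_congr fun i hi => ?_
      have h : i ≠ q := fun h => hq (h ▸ hi)
      simp [h]
    rw [this, Measure.prod_prod, Measure.infinitePi_pi F fun i _ => ht i]
    simp

namespace Algorithm

variable {N M : ℕ} (A : Algorithm N M)

theorem history_update (x : RewardTable N M) (s : A.Seed) (q : Fin N × Fin M × ℕ) (y : ℝ) :
    ∀ t ≤ q.2.2, A.history (Function.update x q y) s t = A.history x s t
  | 0, _ => rfl
  | t + 1, ht => by
    have ih := history_update x s q y t (by omega)
    simp only [history, ih]
    split
    · rename_i p _
      have : (p.1, p.2, t) ≠ q := fun h => by subst h; simp at ht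
      simp [Function.update_of_ne this]
    · rfl

theorem history_succ_of_inr {x : RewardTable N M} {s : A.Seed} {t : ℕ} {p : Fin N × Fin M}
    (h : A.action s (A.history x s t) = Sum.inr p) : A.history x s (t + 1) = A.history x s t := by
  simp [history, h]

theorem history_succ_of_sample {x : RewardTable N M} {s : A.Seed} {t : ℕ} {p : Fin N × Fin M}
    (h : A.action s (A.history x s t) = Sum.inl p) :
    A.history x s (t + 1) = x (p.1, p.2, t) :: A.history x s t := by
  simp [history, h]

theorem history_of_inr {x : RewardTable N M} {s : A.Seed} {t : ℕ} {p : Fin N × Fin M}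
    (h : A.action s (A.history x s t) = Sum.inr p) {t' : ℕ} (ht : t ≤ t') :
    A.history x s t' = A.history x s t := by
  induction t', ht using Nat.le_induction with
  | base => rfl
  | succ k _ ih => rw [A.history_succ_of_inr (p := p) (by rw [ih, h]), ih]

theorem length_history_of_sample {x : RewardTable N M} {s : A.Seed} {t : ℕ} {p : Fin N × Fin M}
    (h : A.action s (A.history x s t) = Sum.inl p) : (A.history x s t).length = t := by
  induction t generalizing p with
  | zero => rfl
  | succ t ih =>
    cases h' : A.action s (A.history x s t) with
    | inl p' => rw [A.history_succ_of_sample h', List.length_cons, ih h']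
    | inr p' => rw [A.history_succ_of_inr h', h'] at h; simp at h

theorem history_suffix (x : RewardTable N M) (s : A.Seed) {t t' : ℕ} (h : t ≤ t') :
    A.history x s t <:+ A.history x s t' := by
  induction t', h using Nat.le_induction with
  | base => exact List.suffix_refl _
  | succ k _ ih =>
    refine ih.trans ?_
    cases h' : A.action s (A.history x s k) with
    | inl p' => rw [A.history_succ_of_sample h']; exact List.suffix_cons _ _
    | inr p' => rw [A.history_succ_of_inr h']

theorem exists_history_eq_of_suffix (x : RewardTable N M) (s : A.Seed) (t : ℕ) (L : List ℝ)
    (h : L <:+ A.history x s t) : ∃ t' ≤ t, A.history x s t' = L := by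
  induction t with
  | zero => exact ⟨0, le_rfl, (List.suffix_nil.1 h).symm⟩
  | succ t ih =>
    have step : L <:+ A.history x s t → ∃ t' ≤ t + 1, A.history x s t' = L := fun h => by
      obtain ⟨t', h1, h2⟩ := ih h
      exact ⟨t', h1.trans (Nat.le_succ t), h2⟩
    cases h' : A.action s (A.history x s t) with
    | inl p' =>
      rw [A.history_succ_of_sample h'] at h
      rcases List.suffix_cons_iff.1 h with h | h
      · exact ⟨t + 1, le_rfl, by rw [h, A.history_succ_of_sample h']⟩
      · exact step h
    | inr p' => rw [A.history_succ_of_inr h'] at h; exact step h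

/-- The number of samples taken before time `t` is the minimum of `t` and the stopping time. -/
theorem length_history (x : RewardTable N M) (s : A.Seed) (t : ℕ) :
    ((A.history x s t).length : ℕ∞) = min (t : ℕ∞) (A.stoppingTime x s) := by
  by_cases h : ∃ t' < t, ∃ p, A.action s (A.history x s t') = Sum.inr p
  · classical
    have hf := Nat.find_spec h
    set k := Nat.find h with hk
    obtain ⟨hkt, p, hp⟩ := hf
    have hlen : (A.history x s k).length = k := by
      rcases Nat.eq_zero_or_pos k with h0 | h0
      · rw [h0]; rfl
      · obtain ⟨j, hj⟩ : ∃ j, k = j + 1 := ⟨k - 1, by omega⟩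
        have hnot := Nat.find_min h (m := j) (by omega)
        push Not at hnot
        have hnot := hnot (by omega)
        cases h' : A.action s (A.history x s j) with
        | inl p' =>
          rw [hj, A.history_succ_of_sample h', List.length_cons, A.length_history_of_sample h']
        | inr p' => exact absurd h' (hnot p')
    have hst : A.stoppingTime x s = k := by
      refine le_antisymm (iInf₂_le k ⟨p, hp⟩) (le_iInf₂ fun m hm => ?_)
      by_contra hlt
      have hlt : m < k := by simpa using hlt
      exact Nat.find_min h hlt ⟨by omega, hm⟩
    rw [A.history_of_inr hp hkt.le, hlen, hst, min_eq_right]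
    exact_mod_cast hkt.le
  · push Not at h
    have hlen : (A.history x s t).length = t := by
      rcases Nat.eq_zero_or_pos t with h0 | h0
      · rw [h0]; rfl
      · obtain ⟨j, hj⟩ : ∃ j, t = j + 1 := ⟨t - 1, by omega⟩
        cases h' : A.action s (A.history x s j) with
        | inl p' =>
          rw [hj, A.history_succ_of_sample h', List.length_cons, A.length_history_of_sample h']
        | inr p' => exact absurd h' (h j (by omega) p')
    rw [hlen, min_eq_left]
    refine le_iInf₂ fun m hm => ?_
    by_contra hlt
    have hlt : m < t := by simpa using hlt
    obtain ⟨p, hp⟩ := hm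
    exact h m hlt p hp

theorem iSup_length_history (x : RewardTable N M) (s : A.Seed) :
    (⨆ t, ((A.history x s t).length : ℝ≥0∞)) = (A.stoppingTime x s : ℝ≥0∞) := by
  have h : ∀ t, ((A.history x s t).length : ℝ≥0∞) =
      min (t : ℝ≥0∞) (A.stoppingTime x s : ℝ≥0∞) := fun t => by
    have := congrArg (fun z : ℕ∞ => (z : ℝ≥0∞)) (A.length_history x s t)
    simpa [ENat.toENNReal_min] using this
  simp only [h]
  refine le_antisymm (iSup_le fun t => min_le_right _ _) ?_
  rw [← iSup_inf_eq]
  simp [ENNReal.iSup_natCast]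

theorem measurable_comp_history {A : Algorithm N M} (hA : A.IsMeasurable) {β : Type*}
    [MeasurableSpace β] (t : ℕ) {f : RewardTable N M × A.Seed → List ℝ → β}
    (hf : ListMeasurable f) :
    Measurable fun q : RewardTable N M × A.Seed => f q (A.history q.1 q.2 t) := by
  induction t generalizing f with
  | zero => exact hf.nil
  | succ t ih =>
    let g : Action N M → RewardTable N M × A.Seed → List ℝ → β := fun a q L =>
      Sum.elim (fun p => f q (q.1 (p.1, p.2, t) :: L)) (fun _ => f q L) a
    have hg : ∀ a, ListMeasurable (g a) := by
      rintro (p | p)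
      · refine hf.cons.param (g := fun q => (q, q.1 (p.1, p.2, t))) ?_
        exact measurable_id.prodMk ((measurable_pi_apply _).comp measurable_fst)
      · exact hf
    have hact : ListMeasurable fun (q : RewardTable N M × A.Seed) L => A.action q.2 L :=
      ListMeasurable.param (f := A.action) hA measurable_snd
    convert ih (hact.cases hg) using 1
    funext q
    cases h' : A.action q.2 (A.history q.1 q.2 t) with
    | inl p' => rw [A.history_succ_of_sample h']; simp [g]
    | inr p' => rw [A.history_succ_of_inr h']; simp [g]

theorem measurable_seed_history {A : Algorithm N M} (hA : A.IsMeasurable) {β : Type*}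
    [MeasurableSpace β] (t : ℕ) {f : A.Seed → List ℝ → β} (hf : ListMeasurable f) :
    Measurable fun q : RewardTable N M × A.Seed => f q.2 (A.history q.1 q.2 t) :=
  measurable_comp_history hA t (f := fun q L => f q.2 L) (hf.param measurable_snd)

/-- The conditional expectation of a path functional after one more step, given the seed and the
rewards observed so far. -/
noncomputable def stepMean (F : Fin N × Fin M × ℕ → Measure ℝ) (f : A.Seed → List ℝ → ℝ≥0∞)
    (s : A.Seed) (L : List ℝ) : ℝ≥0∞ :=
  match A.action s L with
  | Sum.inl p => ∫⁻ y, f s (y :: L) ∂F (p.1, p.2, L.length)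
  | Sum.inr _ => f s L

theorem listMeasurable_stepMean {A : Algorithm N M} (hA : A.IsMeasurable)
    (F : Fin N × Fin M × ℕ → Measure ℝ) [∀ q, IsProbabilityMeasure (F q)]
    {f : A.Seed → List ℝ → ℝ≥0∞} (hf : ListMeasurable f) : ListMeasurable (A.stepMean F f) := by
  let g : Action N M → A.Seed → List ℝ → ℝ≥0∞ := fun a s L =>
    Sum.elim (fun p => ∫⁻ y, f s (y :: L) ∂F (p.1, p.2, L.length)) (fun _ => f s L) a
  have hg : ∀ a, ListMeasurable (g a) := by
    rintro (p | p)
    · intro n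
      have h : Measurable fun z : (A.Seed × (Fin n → ℝ)) × ℝ =>
          f z.1.1 (z.2 :: List.ofFn z.1.2) :=
        (hf.cons n).comp (g := fun w : (A.Seed × ℝ) × (Fin n → ℝ) =>
          f w.1.1 (w.1.2 :: List.ofFn w.2))
          (f := fun z : (A.Seed × (Fin n → ℝ)) × ℝ => ((z.1.1, z.2), z.1.2)) (by fun_prop)
      have := h.lintegral_prod_right' (ν := F (p.1, p.2, n))
      simpa [g] using this
    · exact hf
  have : A.stepMean F f = fun s L => g (A.action s L) s L := by
    funext s L
    simp only [stepMean, g]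
    cases A.action s L <;> rfl
  rw [this]
  exact ListMeasurable.cases (c := A.action) hA hg

/-- The reward of `p` at time `t` can be integrated first, since the history up to time `t` does
not depend on it. -/
theorem lintegral_sample {A : Algorithm N M} (F : Fin N × Fin M × ℕ → Measure ℝ)
    [∀ q, IsProbabilityMeasure (F q)] (s : A.Seed) (t : ℕ) (p : Fin N × Fin M)
    {g : List ℝ → ℝ → ℝ≥0∞}
    (hg : Measurable fun x : RewardTable N M => g (A.history x s t) (x (p.1, p.2, t))) :
    ∫⁻ x, g (A.history x s t) (x (p.1, p.2, t)) ∂Measure.infinitePi F =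
      ∫⁻ x, ∫⁻ y, g (A.history x s t) y ∂F (p.1, p.2, t) ∂Measure.infinitePi F := by
  classical
  have hu := measurable_update_pair (ι := Fin N × Fin M × ℕ) (p.1, p.2, t)
  conv_lhs => rw [← map_update_infinitePi F (p.1, p.2, t)]
  rw [lintegral_map hg hu, lintegral_prod _ (Measurable.aemeasurable (by exact hg.comp hu))]
  refine lintegral_congr fun x => lintegral_congr fun y => ?_
  dsimp only
  rw [A.history_update x s (p.1, p.2, t) y t le_rfl, Function.update_self]

theorem lintegral_history_succ {A : Algorithm N M} (hA : A.IsMeasurable)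
    (F : Fin N × Fin M × ℕ → Measure ℝ) [∀ q, IsProbabilityMeasure (F q)]
    {f : A.Seed → List ℝ → ℝ≥0∞} (hf : ListMeasurable f) (t : ℕ) :
    ∫⁻ q, f q.2 (A.history q.1 q.2 (t + 1)) ∂A.runLaw (Measure.infinitePi F) =
      ∫⁻ q, A.stepMean F f q.2 (A.history q.1 q.2 t) ∂A.runLaw (Measure.infinitePi F) := by
  classical
  unfold runLaw
  rw [lintegral_prod_symm _ (measurable_seed_history hA _ hf).aemeasurable,
    lintegral_prod_symm _
      (measurable_seed_history hA _ (listMeasurable_stepMean hA F hf)).aemeasurable]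
  refine lintegral_congr fun s => ?_
  dsimp only
  -- Both integrands are split according to the pair sampled at time `t`.
  have mact : Measurable fun x : RewardTable N M => A.action s (A.history x s t) :=
    (measurable_seed_history hA t (f := A.action) hA).comp measurable_prodMk_right
  have mf0 : Measurable fun x : RewardTable N M => f s (A.history x s t) :=
    (measurable_seed_history hA t hf).comp measurable_prodMk_right
  have mf1 : ∀ p : Fin N × Fin M, Measurable fun x : RewardTable N M =>
      f s (x (p.1, p.2, t) :: A.history x s t) := fun p =>
    (measurable_comp_history hA t (f := fun q L => f q.2 (q.1 (p.1, p.2, t) :: L))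
      (hf.cons.param (g := fun q : RewardTable N M × A.Seed => (q.2, q.1 (p.1, p.2, t)))
        (by fun_prop))).comp measurable_prodMk_right
  have mf2 : ∀ p : Fin N × Fin M, Measurable fun x : RewardTable N M =>
      ∫⁻ y, f s (y :: A.history x s t) ∂F (p.1, p.2, t) := fun p => by
    have h : Measurable fun z : RewardTable N M × ℝ => f s (z.2 :: A.history z.1 s t) := by
      have h1 := measurable_update_pair (ι := Fin N × Fin M × ℕ) (p.1, p.2, t)
      have := (mf1 p).comp h1
      convert this using 1
      funext z
      simp only [Function.comp_apply, Function.update_self]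
      rw [A.history_update _ s (p.1, p.2, t) _ t le_rfl]
    exact h.lintegral_prod_right'
  let ind : Action N M → RewardTable N M → ℝ≥0∞ := fun a x =>
    if A.action s (A.history x s t) = a then 1 else 0
  have mind : ∀ a, Measurable (ind a) := fun a =>
    Measurable.ite (mact (measurableSet_singleton a)) measurable_const measurable_const
  have e1 : ∀ x : RewardTable N M, f s (A.history x s (t + 1)) =
      (∑ p, ind (Sum.inl p) x * f s (x (p.1, p.2, t) :: A.history x s t)) +
        ∑ p, ind (Sum.inr p) x * f s (A.history x s t) := fun x => by
    cases h : A.action s (A.history x s t) with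
    | inl p => rw [A.history_succ_of_sample h]; simp [ind, h]
    | inr p => rw [A.history_succ_of_inr h]; simp [ind, h]
  have e2 : ∀ x : RewardTable N M, A.stepMean F f s (A.history x s t) =
      (∑ p : Fin N × Fin M, ind (Sum.inl p) x *
        ∫⁻ y, f s (y :: A.history x s t) ∂F (p.1, p.2, t)) +
        ∑ p, ind (Sum.inr p) x * f s (A.history x s t) := fun x => by
    cases h : A.action s (A.history x s t) with
    | inl p => simp [ind, h, stepMean, A.length_history_of_sample h]
    | inr p => simp [ind, h, stepMean]
  simp only [e1, e2]
  have m1 : ∀ p : Fin N × Fin M, Measurable fun x =>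
      ind (Sum.inl p) x * f s (x (p.1, p.2, t) :: A.history x s t) := fun p =>
    (mind _).mul (mf1 p)
  have m2 : ∀ p : Fin N × Fin M, Measurable fun x =>
      ind (Sum.inl p) x * ∫⁻ y, f s (y :: A.history x s t) ∂F (p.1, p.2, t) := fun p =>
    (mind _).mul (mf2 p)
  rw [lintegral_add_left (Finset.measurable_fun_sum _ fun p _ => m1 p),
    lintegral_add_left (Finset.measurable_fun_sum _ fun p _ => m2 p),
    lintegral_finsetSum _ fun p _ => m1 p, lintegral_finsetSum _ fun p _ => m2 p]
  congr 1
  refine Finset.sum_congr rfl fun p _ => ?_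
  rw [lintegral_sample F s t p (g := fun L y =>
    (if A.action s L = Sum.inl p then 1 else 0) * f s (y :: L)) ((mind _).mul (mf1 p))]
  refine lintegral_congr fun x => ?_
  dsimp only [ind]
  split_ifs <;> simp

end Algorithm

/-! ### Likelihood ratios of sequential Gaussian experiments -/

/-- The law of independent Gaussian rewards with means `m` and variance `σ2`. -/
noncomputable def gaussianRewards {N M : ℕ} (m : Fin N × Fin M → ℝ) (σ2 : ℝ≥0) :
    Measure (RewardTable N M) :=
  Measure.infinitePi fun q : Fin N × Fin M × ℕ => gaussianReal (m (q.1, q.2.1)) σ2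

instance {N M : ℕ} (m : Fin N × Fin M → ℝ) (σ2 : ℝ≥0) :
    IsProbabilityMeasure (gaussianRewards m σ2) := by
  unfold gaussianRewards; infer_instance

theorem lintegral_gaussianReal_tilt (m m' : ℝ) {σ2 : ℝ≥0} (hσ : σ2 ≠ 0) {g : ℝ → ℝ≥0∞}
    (hg : Measurable g) :
    ∫⁻ y, ENNReal.ofReal (Real.exp ((m' - m) / σ2 * (y - m) - (m' - m) ^ 2 / (2 * σ2))) * g y
      ∂gaussianReal m σ2 = ∫⁻ y, g y ∂gaussianReal m' σ2 := by
  have hσ' : (σ2 : ℝ) ≠ 0 := by exact_mod_cast hσ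
  have hm : Measurable fun y =>
      ENNReal.ofReal (Real.exp ((m' - m) / σ2 * (y - m) - (m' - m) ^ 2 / (2 * σ2))) * g y := by
    fun_prop
  rw [gaussianReal_of_var_ne_zero _ hσ, gaussianReal_of_var_ne_zero _ hσ,
    lintegral_withDensity_eq_lintegral_mul _ (measurable_gaussianPDF _ _) hm,
    lintegral_withDensity_eq_lintegral_mul _ (measurable_gaussianPDF _ _) hg]
  refine lintegral_congr fun y => ?_
  simp only [Pi.mul_apply]
  rw [← mul_assoc, gaussianPDF, gaussianPDF,
    ← ENNReal.ofReal_mul (gaussianPDFReal_nonneg _ _ _), gaussianPDFReal, gaussianPDFReal, mul_assoc,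
    ← Real.exp_add]
  congr 5
  field_simp
  ring

namespace Algorithm

variable {N M : ℕ} (A : Algorithm N M)

/-- The number of samples of the pair `p` along a list of rewards. -/
noncomputable def pairCount (p : Fin N × Fin M) (s : A.Seed) : List ℝ → ℕ
  | [] => 0
  | _ :: L => pairCount p s L + if A.action s L = Sum.inl p then 1 else 0

/-- The sum of the centred rewards, weighted according to the pairs sampled. -/
noncomputable def noiseSum (m c : Fin N × Fin M → ℝ) (s : A.Seed) : List ℝ → ℝ
  | [] => 0
  | y :: L => noiseSum m c s L +
      Sum.elim (fun p => c p * (y - m p)) (fun _ => 0) (A.action s L)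

/-- The log-likelihood ratio of the observed rewards, for means `m'` against means `m`. -/
noncomputable def logLik (m m' : Fin N × Fin M → ℝ) (σ2 : ℝ≥0) (s : A.Seed) (L : List ℝ) : ℝ :=
  A.noiseSum m (fun p => (m' p - m p) / σ2) s L -
    ∑ p, A.pairCount p s L * ((m' p - m p) ^ 2 / (2 * σ2))

variable {A}

theorem logLik_cons {m m' : Fin N × Fin M → ℝ} {σ2 : ℝ≥0} {s : A.Seed} {L : List ℝ}
    {p : Fin N × Fin M} (h : A.action s L = Sum.inl p) (y : ℝ) :
    A.logLik m m' σ2 s (y :: L) = A.logLik m m' σ2 s L +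
      ((m' p - m p) / σ2 * (y - m p) - (m' p - m p) ^ 2 / (2 * σ2)) := by
  simp only [logLik, noiseSum, pairCount, h, Sum.elim_inl, Nat.cast_add, add_mul,
    Finset.sum_add_distrib]
  have : ∑ x, (((if (Sum.inl p : Action N M) = Sum.inl x then 1 else 0 : ℕ) : ℝ)) *
      ((m' x - m x) ^ 2 / (2 * (σ2 : ℝ))) = (m' p - m p) ^ 2 / (2 * σ2) := by
    rw [Finset.sum_eq_single p] <;> simp +contextual [eq_comm]
  rw [this]
  ring

theorem listMeasurable_pairCount (hA : A.IsMeasurable) (p : Fin N × Fin M) :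
    ListMeasurable (A.pairCount p) := by
  refine ListMeasurable.of_cons measurable_const fun n ih => ?_
  have hact : Measurable fun z : (A.Seed × ℝ) × (Fin n → ℝ) =>
      A.action z.1.1 (List.ofFn z.2) := (hA n).comp
        (f := fun z : (A.Seed × ℝ) × (Fin n → ℝ) => (z.1.1, z.2)) (by fun_prop)
  have h1 : Measurable fun z : (A.Seed × ℝ) × (Fin n → ℝ) => A.pairCount p z.1.1 (List.ofFn z.2) :=
    ih.comp (f := fun z : (A.Seed × ℝ) × (Fin n → ℝ) => (z.1.1, z.2)) (by fun_prop)
  exact h1.add (Measurable.ite (hact (measurableSet_singleton _)) measurable_const measurable_const)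

theorem listMeasurable_noiseSum (hA : A.IsMeasurable) (m c : Fin N × Fin M → ℝ) :
    ListMeasurable (A.noiseSum m c) := by
  refine ListMeasurable.of_cons measurable_const fun n ih => ?_
  have hact : Measurable fun z : (A.Seed × ℝ) × (Fin n → ℝ) =>
      A.action z.1.1 (List.ofFn z.2) := (hA n).comp
        (f := fun z : (A.Seed × ℝ) × (Fin n → ℝ) => (z.1.1, z.2)) (by fun_prop)
  have h1 : Measurable fun z : (A.Seed × ℝ) × (Fin n → ℝ) => A.noiseSum m c z.1.1 (List.ofFn z.2) :=
    ih.comp (f := fun z : (A.Seed × ℝ) × (Fin n → ℝ) => (z.1.1, z.2)) (by fun_prop)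
  refine h1.add (measurable_of_countable_cases hact
    (f := fun a (z : (A.Seed × ℝ) × (Fin n → ℝ)) =>
      Sum.elim (fun p => c p * (z.1.2 - m p)) (fun _ => (0 : ℝ)) a) ?_)
  rintro (p | p)
  · simp only [Sum.elim_inl]; fun_prop
  · exact measurable_const

theorem listMeasurable_logLik (hA : A.IsMeasurable) (m m' : Fin N × Fin M → ℝ) (σ2 : ℝ≥0) :
    ListMeasurable (A.logLik m m' σ2) := fun n => by
  refine (listMeasurable_noiseSum hA m _ n).sub (Finset.measurable_fun_sum _ fun p _ => ?_)
  exact ((measurable_from_top (f := fun k : ℕ => (k : ℝ))).comp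
    (listMeasurable_pairCount hA p n)).mul_const _

/-- Change of measure: the law of the observations under the means `m'` has density the likelihood
ratio with respect to their law under the means `m`. -/
theorem lintegral_change_of_means (hA : A.IsMeasurable) (m m' : Fin N × Fin M → ℝ) {σ2 : ℝ≥0}
    (hσ : σ2 ≠ 0) (t : ℕ) {f : A.Seed → List ℝ → ℝ≥0∞} (hf : ListMeasurable f) :
    ∫⁻ q, ENNReal.ofReal (Real.exp (A.logLik m m' σ2 q.2 (A.history q.1 q.2 t))) *
        f q.2 (A.history q.1 q.2 t) ∂A.runLaw (gaussianRewards m σ2) =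
      ∫⁻ q, f q.2 (A.history q.1 q.2 t) ∂A.runLaw (gaussianRewards m' σ2) := by
  have key : ∀ (m m' : Fin N × Fin M → ℝ) {f : A.Seed → List ℝ → ℝ≥0∞}, ListMeasurable f →
      ListMeasurable fun s L => ENNReal.ofReal (Real.exp (A.logLik m m' σ2 s L)) * f s L :=
    fun m m' f hf n => Measurable.mul (ENNReal.measurable_ofReal.comp
      (Real.measurable_exp.comp (listMeasurable_logLik hA m m' σ2 n))) (hf n)
  induction t generalizing f with
  | zero =>
    simp only [history, logLik, noiseSum, pairCount]
    simp only [Nat.cast_zero, zero_mul, Finset.sum_const_zero, sub_zero, Real.exp_zero,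
      ENNReal.ofReal_one, one_mul, runLaw]
    have h0 : Measurable fun q : RewardTable N M × A.Seed => f q.2 [] :=
      hf.nil.comp measurable_snd
    rw [lintegral_prod_symm _ h0.aemeasurable, lintegral_prod_symm _ h0.aemeasurable]
    simp
  | succ t ih =>
    unfold gaussianRewards at ih ⊢
    rw [lintegral_history_succ hA _ (key m m' hf), lintegral_history_succ hA _ hf,
      ← ih (listMeasurable_stepMean hA _ hf)]
    refine lintegral_congr fun q => ?_
    generalize A.history q.1 q.2 t = L
    cases h : A.action q.2 L with
    | inr p => simp only [stepMean, h]
    | inl p =>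
      have hfm : Measurable fun y : ℝ => f q.2 (y :: L) := by
        have := (hf.cons L.length).comp (f := fun y : ℝ => ((q.2, y), L.get)) (by fun_prop)
        simpa [Function.comp_def] using this
      simp only [stepMean, h, logLik_cons h]
      have hm : Measurable fun y => ENNReal.ofReal (Real.exp ((m' p - m p) / σ2 * (y - m p) -
          (m' p - m p) ^ 2 / (2 * σ2))) * f q.2 (y :: L) := Measurable.mul (by fun_prop) hfm
      rw [← lintegral_gaussianReal_tilt (m p) (m' p) hσ hfm, ← lintegral_const_mul _ hm]
      refine lintegral_congr fun y => ?_
      rw [Real.exp_add, ENNReal.ofReal_mul (Real.exp_nonneg _), mul_assoc]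

/-! ### The expected log-likelihood ratio -/

theorem pairCount_history_succ (p : Fin N × Fin M) (x : RewardTable N M) (s : A.Seed) (t : ℕ) :
    A.pairCount p s (A.history x s (t + 1)) = A.pairCount p s (A.history x s t) +
      if A.action s (A.history x s t) = Sum.inl p then 1 else 0 := by
  cases h : A.action s (A.history x s t) with
  | inl p' => rw [A.history_succ_of_sample h, pairCount, h]
  | inr p' => rw [A.history_succ_of_inr h]; simp

theorem sum_pairCount_history (x : RewardTable N M) (s : A.Seed) (t : ℕ) :
    ∑ p, A.pairCount p s (A.history x s t) = (A.history x s t).length := by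
  induction t with
  | zero => simp [history, pairCount]
  | succ t ih =>
    simp only [pairCount_history_succ, Finset.sum_add_distrib, ih]
    cases h : A.action s (A.history x s t) with
    | inl p' => rw [A.history_succ_of_sample h]; simp
    | inr p' => rw [A.history_succ_of_inr h]; simp

theorem length_history_le (x : RewardTable N M) (s : A.Seed) (t : ℕ) :
    (A.history x s t).length ≤ t := by
  have := A.length_history x s t
  have h : ((A.history x s t).length : ℕ∞) ≤ t := this ▸ min_le_left _ _
  exact_mod_cast h

theorem integrable_pairCount (hA : A.IsMeasurable) (P : Measure (RewardTable N M))
    [IsProbabilityMeasure P] (p : Fin N × Fin M) (t : ℕ) :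
    Integrable (fun q => (A.pairCount p q.2 (A.history q.1 q.2 t) : ℝ)) (A.runLaw P) := by
  have : IsProbabilityMeasure (A.runLaw P) := by unfold runLaw; infer_instance
  have hm : Measurable fun q : RewardTable N M × A.Seed =>
      (A.pairCount p q.2 (A.history q.1 q.2 t) : ℝ) :=
    (measurable_from_top (f := fun k : ℕ => (k : ℝ))).comp
      (measurable_seed_history hA t (listMeasurable_pairCount hA p))
  refine Integrable.of_bound hm.aestronglyMeasurable (t : ℝ) (ae_of_all _ fun q => ?_)
  rw [Real.norm_natCast]
  have h1 := Finset.single_le_sum (f := fun p => A.pairCount p q.2 (A.history q.1 q.2 t))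
    (fun _ _ => Nat.zero_le _) (Finset.mem_univ p)
  have h2 := A.length_history_le q.1 q.2 t
  rw [sum_pairCount_history] at h1
  exact_mod_cast h1.trans h2

theorem integrable_sampled_noise (hA : A.IsMeasurable) (m : Fin N × Fin M → ℝ) (σ2 : ℝ≥0)
    (p : Fin N × Fin M) (t : ℕ) :
    Integrable (fun q : RewardTable N M × A.Seed =>
      (if A.action q.2 (A.history q.1 q.2 t) = Sum.inl p then (1 : ℝ) else 0) *
        (q.1 (p.1, p.2, t) - m p)) (A.runLaw (gaussianRewards m σ2)) := by
  have h1 : Integrable (fun x : RewardTable N M => x (p.1, p.2, t) - m p)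
      (gaussianRewards m σ2) := by
    have hid : Integrable (fun y : ℝ => y - m p) (gaussianReal (m p) σ2) :=
      ((memLp_id_gaussianReal 1).integrable (by simp)).sub (integrable_const _)
    exact (measurePreserving_eval_infinitePi
      (fun q : Fin N × Fin M × ℕ => gaussianReal (m (q.1, q.2.1)) σ2)
      (p.1, p.2, t)).integrable_comp_of_integrable (g := fun y : ℝ => y - m p) hid
  have h2 := h1.comp_fst A.seedLaw
  refine h2.bdd_mul (c := 1) ?_ (ae_of_all _ fun q => ?_)
  · exact (Measurable.ite (measurable_seed_history hA t (f := A.action) hA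
      (measurableSet_singleton _)) measurable_const measurable_const).aestronglyMeasurable
  · split_ifs <;> simp

theorem integral_sampled_noise (hA : A.IsMeasurable) (m : Fin N × Fin M → ℝ) (σ2 : ℝ≥0)
    (p : Fin N × Fin M) (t : ℕ) :
    ∫ q, (if A.action q.2 (A.history q.1 q.2 t) = Sum.inl p then (1 : ℝ) else 0) *
        (q.1 (p.1, p.2, t) - m p) ∂(A.runLaw (gaussianRewards m σ2)) = 0 := by
  classical
  have hint := integrable_sampled_noise hA m σ2 p t
  unfold runLaw at hint ⊢
  rw [integral_prod_symm _ hint]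
  refine integral_eq_zero_of_ae ?_
  filter_upwards [hint.prod_left_ae] with s hs
  have hu := measurable_update_pair (ι := Fin N × Fin M × ℕ) (p.1, p.2, t)
  have hmp : MeasurePreserving
      (fun z : RewardTable N M × ℝ => Function.update z.1 (p.1, p.2, t) z.2)
      ((gaussianRewards m σ2).prod (gaussianReal (m p) σ2)) (gaussianRewards m σ2) :=
    ⟨hu, map_update_infinitePi
      (fun q : Fin N × Fin M × ℕ => gaussianReal (m (q.1, q.2.1)) σ2) (p.1, p.2, t)⟩
  have h2 := hmp.integrable_comp_of_integrable hs
  have h3 := integral_map (μ := (gaussianRewards m σ2).prod (gaussianReal (m p) σ2))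
    hu.aemeasurable (by rw [hmp.map_eq]; exact hs.aestronglyMeasurable)
  rw [hmp.map_eq] at h3
  simp only [Pi.zero_apply]
  refine h3.trans ((integral_prod _ h2).trans (integral_eq_zero_of_ae (ae_of_all _ fun x => ?_)))
  simp only [Function.comp_apply, Function.update_self, A.history_update x s (p.1, p.2, t) _ t le_rfl, Pi.zero_apply]
  have hid : Integrable (fun y : ℝ => y) (gaussianReal (m p) σ2) :=
    (memLp_id_gaussianReal 1).integrable (by simp)
  rw [integral_const_mul, integral_sub hid (integrable_const _), integral_id_gaussianReal]
  simp

theorem noiseSum_history_succ (m c : Fin N × Fin M → ℝ) (x : RewardTable N M) (s : A.Seed)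
    (t : ℕ) : A.noiseSum m c s (A.history x s (t + 1)) = A.noiseSum m c s (A.history x s t) +
      ∑ p, c p * ((if A.action s (A.history x s t) = Sum.inl p then (1 : ℝ) else 0) *
        (x (p.1, p.2, t) - m p)) := by
  cases h : A.action s (A.history x s t) with
  | inl p' => rw [A.history_succ_of_sample h, noiseSum, h]; simp
  | inr p' => rw [A.history_succ_of_inr h]; simp

theorem noiseSum_martingale (hA : A.IsMeasurable) (m c : Fin N × Fin M → ℝ) (σ2 : ℝ≥0) (t : ℕ) :
    Integrable (fun q => A.noiseSum m c q.2 (A.history q.1 q.2 t))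
        (A.runLaw (gaussianRewards m σ2)) ∧
      ∫ q, A.noiseSum m c q.2 (A.history q.1 q.2 t) ∂(A.runLaw (gaussianRewards m σ2)) = 0 := by
  induction t with
  | zero => simp [history, noiseSum]
  | succ t ih =>
    simp only [noiseSum_history_succ]
    have h1 : ∀ p, Integrable (fun q : RewardTable N M × A.Seed => c p *
        ((if A.action q.2 (A.history q.1 q.2 t) = Sum.inl p then (1 : ℝ) else 0) *
        (q.1 (p.1, p.2, t) - m p))) (A.runLaw (gaussianRewards m σ2)) := fun p =>
      (integrable_sampled_noise hA m σ2 p t).const_mul _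
    have h2 := integrable_finsetSum Finset.univ fun p _ => h1 p
    refine ⟨ih.1.add h2, ?_⟩
    rw [integral_add ih.1 h2, ih.2, integral_finsetSum _ fun p _ => h1 p, zero_add]
    refine Finset.sum_eq_zero fun p _ => ?_
    rw [integral_const_mul, integral_sampled_noise hA, mul_zero]

/-- If an answer `b` has probability at most `δ` under the means `m'`, then its probability under
the means `m` is bounded by the information gathered on the difference between `m` and `m'`. -/
theorem information_bound (hA : A.IsMeasurable) (m m' : Fin N × Fin M → ℝ) {σ2 : ℝ≥0}
    (hσ : σ2 ≠ 0) (b : Fin N × Fin M) {δ : ℝ} (h0 : 0 < δ) (h2 : δ ≤ 1 / 2) (t : ℕ)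
    (hb : (A.runLaw (gaussianRewards m' σ2)).real
      {q | A.action q.2 (A.history q.1 q.2 t) = Sum.inr b} ≤ δ) :
    Real.log ((1 - δ) / δ) * (2 * (A.runLaw (gaussianRewards m σ2)).real
        {q | A.action q.2 (A.history q.1 q.2 t) = Sum.inr b} - 1) ≤
      ∑ p, (∫ q, (A.pairCount p q.2 (A.history q.1 q.2 t) : ℝ)
        ∂(A.runLaw (gaussianRewards m σ2))) * ((m' p - m p) ^ 2 / (2 * σ2)) := by
  set κ := Real.log ((1 - δ) / δ) with hκ
  have hexp : Real.exp κ = (1 - δ) / δ := Real.exp_log (div_pos (by linarith) h0)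
  have hexp' : Real.exp (-κ) = δ / (1 - δ) := by rw [Real.exp_neg, hexp, inv_div]
  set B : Set (RewardTable N M × A.Seed) :=
    {q | A.action q.2 (A.history q.1 q.2 t) = Sum.inr b} with hB
  have hBm : MeasurableSet B :=
    measurable_seed_history hA t (f := A.action) hA (measurableSet_singleton _)
  have hp : ∀ m, IsProbabilityMeasure (A.runLaw (gaussianRewards m σ2)) := fun m => by
    unfold runLaw; infer_instance
  -- `κ` on the answer `b`, `-κ` otherwise
  let c : A.Seed → List ℝ → ℝ := fun s L => if A.action s L = Sum.inr b then κ else -κ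
  have hc : ListMeasurable c := fun n =>
    Measurable.ite ((hA n) (measurableSet_singleton _)) measurable_const measurable_const
  have hcB : ∀ q : RewardTable N M × A.Seed, c q.2 (A.history q.1 q.2 t) =
      B.indicator (fun _ => 2 * κ) q - κ := fun q => by
    by_cases h : A.action q.2 (A.history q.1 q.2 t) = Sum.inr b
    · have : q ∈ B := h
      simp [c, h, this]; ring
    · have : q ∉ B := h
      simp [c, h, this]
  have hcI : ∀ m, Integrable (fun q => c q.2 (A.history q.1 q.2 t))
      (A.runLaw (gaussianRewards m σ2)) := fun m => by
    simp only [hcB]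
    exact ((integrable_const _).indicator hBm).sub (integrable_const _)
  have hcE : ∀ m, ∫ q, c q.2 (A.history q.1 q.2 t) ∂(A.runLaw (gaussianRewards m σ2)) =
      κ * (2 * (A.runLaw (gaussianRewards m σ2)).real B - 1) := fun m => by
    simp only [hcB]
    rw [integral_sub ((integrable_const _).indicator hBm) (integrable_const _),
      integral_indicator_const _ hBm]
    simp; ring
  -- the likelihood ratio has expectation one even with the factor `exp c`
  have hmain : ∫⁻ q, ENNReal.ofReal (Real.exp (A.logLik m m' σ2 q.2 (A.history q.1 q.2 t) +
      c q.2 (A.history q.1 q.2 t))) ∂(A.runLaw (gaussianRewards m σ2)) ≤ 1 := by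
    have e1 := lintegral_change_of_means hA m m' hσ t
      (f := fun s L => ENNReal.ofReal (Real.exp (c s L)))
      ((hc.comp Real.measurable_exp).comp ENNReal.measurable_ofReal)
    simp only [Real.exp_add, ENNReal.ofReal_mul (Real.exp_nonneg _)]
    rw [e1]
    have e2 : ∀ q : RewardTable N M × A.Seed,
        ENNReal.ofReal (Real.exp (c q.2 (A.history q.1 q.2 t))) =
        B.indicator (fun _ => ENNReal.ofReal ((1 - δ) / δ)) q +
          Bᶜ.indicator (fun _ => ENNReal.ofReal (δ / (1 - δ))) q := fun q => by
      by_cases h : A.action q.2 (A.history q.1 q.2 t) = Sum.inr b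
      · have : q ∈ B := h
        simp [c, h, this, hexp]
      · have : q ∉ B := h
        simp [c, h, this, hexp']
    simp only [e2]
    rw [lintegral_add_left (measurable_const.indicator hBm), lintegral_indicator_const hBm,
      lintegral_indicator_const hBm.compl, ← ofReal_measureReal, ← ofReal_measureReal,
      ← ENNReal.ofReal_mul (div_nonneg (by linarith) h0.le),
      ← ENNReal.ofReal_mul (div_nonneg h0.le (by linarith)),
      ← ENNReal.ofReal_add (mul_nonneg (div_nonneg (by linarith) h0.le) measureReal_nonneg)
        (mul_nonneg (div_nonneg h0.le (by linarith)) measureReal_nonneg),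
      probReal_compl_eq_one_sub hBm]
    refine ENNReal.ofReal_le_one.2 ?_
    set x := (A.runLaw (gaussianRewards m' σ2)).real B
    have h3 : (1 - δ) / δ - δ / (1 - δ) = (1 - 2 * δ) / (δ * (1 - δ)) := by
      field_simp [show (1 - δ) ≠ 0 by linarith]
      ring
    have h4 : (1 - δ) / δ * x + δ / (1 - δ) * (1 - x) =
        δ / (1 - δ) + ((1 - δ) / δ - δ / (1 - δ)) * x := by ring
    have h5 : 0 ≤ (1 - 2 * δ) / (δ * (1 - δ)) :=
      div_nonneg (by linarith) (mul_nonneg h0.le (by linarith))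
    have h6 : δ / (1 - δ) + (1 - 2 * δ) / (δ * (1 - δ)) * δ = 1 := by
      field_simp [show (1 - δ) ≠ 0 by linarith]
      ring
    rw [h4, h3]
    have := mul_le_mul_of_nonneg_left hb h5
    linarith
  have hN := noiseSum_martingale hA m (fun p => (m' p - m p) / σ2) σ2 t
  have hcnt : ∀ p, Integrable (fun q => A.pairCount p q.2 (A.history q.1 q.2 t) *
      ((m' p - m p) ^ 2 / (2 * (σ2 : ℝ)))) (A.runLaw (gaussianRewards m σ2)) := fun p =>
    (integrable_pairCount hA _ p t).mul_const _
  have hcntS := integrable_finsetSum Finset.univ fun p _ => hcnt p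
  have hlogI : Integrable (fun q => A.logLik m m' σ2 q.2 (A.history q.1 q.2 t))
      (A.runLaw (gaussianRewards m σ2)) := hN.1.sub hcntS
  have hlogE : ∫ q, A.logLik m m' σ2 q.2 (A.history q.1 q.2 t)
      ∂(A.runLaw (gaussianRewards m σ2)) = -∑ p, (∫ q, (A.pairCount p q.2 (A.history q.1 q.2 t) : ℝ)
        ∂(A.runLaw (gaussianRewards m σ2))) * ((m' p - m p) ^ 2 / (2 * σ2)) := by
    unfold logLik
    rw [integral_sub hN.1 hcntS, hN.2, integral_finsetSum _ fun p _ => hcnt p, zero_sub]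
    simp only [integral_mul_const]
  have hI := hlogI.add (hcI m)
  have hEm : Measurable fun q : RewardTable N M × A.Seed =>
      Real.exp (A.logLik m m' σ2 q.2 (A.history q.1 q.2 t) + c q.2 (A.history q.1 q.2 t)) :=
    Real.measurable_exp.comp ((measurable_seed_history hA t (listMeasurable_logLik hA m m' σ2)).add
      (measurable_seed_history hA t hc))
  have hEI : Integrable (fun q : RewardTable N M × A.Seed =>
      Real.exp (A.logLik m m' σ2 q.2 (A.history q.1 q.2 t) + c q.2 (A.history q.1 q.2 t)))
      (A.runLaw (gaussianRewards m σ2)) := by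
    refine ⟨hEm.aestronglyMeasurable, ?_⟩
    rw [hasFiniteIntegral_iff_ofReal (ae_of_all _ fun q => Real.exp_nonneg _)]
    exact hmain.trans_lt ENNReal.one_lt_top
  have hle : ∫ q, (A.logLik m m' σ2 q.2 (A.history q.1 q.2 t) + c q.2 (A.history q.1 q.2 t) + 1)
      ∂(A.runLaw (gaussianRewards m σ2)) ≤ 1 := by
    refine (integral_mono (hI.add (integrable_const 1)) hEI
      fun q => Real.add_one_le_exp _).trans ?_
    rw [integral_eq_lintegral_of_nonneg_ae (ae_of_all _ fun q => Real.exp_nonneg _)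
      hEm.aestronglyMeasurable]
    exact ENNReal.toReal_le_of_le_ofReal zero_le_one (by simpa using hmain)
  have hsum := integral_add hI (integrable_const (1 : ℝ)) (μ := A.runLaw (gaussianRewards m σ2))
  have hsum' := integral_add hlogI (hcI m)
  simp only [Pi.add_apply] at hsum
  rw [hsum, hsum', hlogE, hcE] at hle
  simp at hle
  linarith

end Algorithm

/-! ### The lower bound -/

theorem iSup_eq_of_best {n : ℕ} {x : Fin n → ℝ} {i₀ : Fin n} (h : ∀ i, i ≠ i₀ → x i < x i₀) :
    (⨆ i, x i) = x i₀ := by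
  have : Nonempty (Fin n) := ⟨i₀⟩
  refine le_antisymm (ciSup_le fun i => ?_) (le_ciSup (Set.finite_range x).bddAbove i₀)
  by_cases hi : i = i₀
  · rw [hi]
  · exact (h i hi).le

theorem gap_eq_of_best {n : ℕ} {x : Fin n → ℝ} {i₀ : Fin n} (h : ∀ i, i ≠ i₀ → x i < x i₀)
    (i : Fin n) : gap x i = x i₀ - x i := by rw [gap, iSup_eq_of_best h]

theorem gap_pos_iff_of_best {n : ℕ} {x : Fin n → ℝ} {i₀ : Fin n}
    (h : ∀ i, i ≠ i₀ → x i < x i₀) (i : Fin n) : 0 < gap x i ↔ i ≠ i₀ := by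
  rw [gap_eq_of_best h, sub_pos]
  exact ⟨fun hi he => by simp [he] at hi, h i⟩

theorem complexity_eq {N M : ℕ} {u : Fin N → ℝ} {v : Fin M → ℝ} {i₀ : Fin N} {j₀ : Fin M}
    (h : IsInstance u v i₀ j₀) : complexity u v =
      (∑ i with i ≠ i₀, 1 / (v j₀ * (u i₀ - u i)) ^ 2) +
        ∑ j with j ≠ j₀, 1 / (u i₀ * (v j₀ - v j)) ^ 2 := by
  have h1 : ∀ i, 0 < u i₀ - u i ↔ i ≠ i₀ := fun i => by
    rw [← gap_eq_of_best h.row_best, gap_pos_iff_of_best h.row_best]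
  have h2 : ∀ j, 0 < v j₀ - v j ↔ j ≠ j₀ := fun j => by
    rw [← gap_eq_of_best h.col_best, gap_pos_iff_of_best h.col_best]
  simp only [complexity, iSup_eq_of_best h.row_best, iSup_eq_of_best h.col_best,
    gap_eq_of_best h.row_best, gap_eq_of_best h.col_best]
  congr 1
  · exact Finset.sum_congr (Finset.filter_congr fun i _ => h1 i) fun _ _ => rfl
  · exact Finset.sum_congr (Finset.filter_congr fun j _ => h2 j) fun _ _ => rfl

theorem complexity_nonneg {N M : ℕ} (u : Fin N → ℝ) (v : Fin M → ℝ) : 0 ≤ complexity u v := by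
  unfold complexity; positivity

namespace Algorithm

variable {N M : ℕ} {A : Algorithm N M}

theorem measurableSet_outputEvent (hA : A.IsMeasurable) (p : Fin N × Fin M) :
    MeasurableSet (A.outputEvent p) := by
  have : A.outputEvent p = ⋃ t, {q | A.action q.2 (A.history q.1 q.2 t) = Sum.inr p} := by
    ext q; simp [outputEvent, Outputs]
  rw [this]
  exact MeasurableSet.iUnion fun t =>
    measurable_seed_history hA t (f := A.action) hA (measurableSet_singleton _)

theorem outputs_unique {x : RewardTable N M} {s : A.Seed} {p p' : Fin N × Fin M}
    (h : A.Outputs x s p) (h' : A.Outputs x s p') : p = p' := by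
  obtain ⟨t, ht⟩ := h
  obtain ⟨t', ht'⟩ := h'
  have h1 := A.history_of_inr ht (le_max_left t t')
  have h2 := A.history_of_inr ht' (le_max_right t t')
  rw [← h1] at ht
  rw [← h2, ht] at ht'
  exact Sum.inr_injective ht'

/-- The information needed to exclude the instance `(u', v')`, whose best pair is another one. -/
theorem IsPAC.information_bound {σ2 : ℝ≥0} {δ : ℝ} (hPAC : A.IsPAC σ2 δ) (hA : A.IsMeasurable)
    (hσ : σ2 ≠ 0) (h0 : 0 < δ) (h2 : δ ≤ 1 / 2) {u u' : Fin N → ℝ} {v v' : Fin M → ℝ}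
    {i₀ i₁ : Fin N} {j₀ j₁ : Fin M} (h' : IsInstance u' v' i₁ j₁) (hne : (i₀, j₀) ≠ (i₁, j₁))
    (t : ℕ) :
    Real.log ((1 - δ) / δ) * (2 * (A.runLaw (gaussianTable u v σ2)).real
        {q | A.action q.2 (A.history q.1 q.2 t) = Sum.inr (i₀, j₀)} - 1) ≤
      ∑ p, (∫ q, (A.pairCount p q.2 (A.history q.1 q.2 t) : ℝ)
        ∂(A.runLaw (gaussianTable u v σ2))) *
          ((u' p.1 * v' p.2 - u p.1 * v p.2) ^ 2 / (2 * σ2)) := by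
  refine A.information_bound hA (fun p => u p.1 * v p.2) (fun p => u' p.1 * v' p.2) hσ (i₀, j₀)
    h0 h2 t ?_
  have hp : IsProbabilityMeasure (A.runLaw (gaussianTable u' v' σ2)) := by
    unfold runLaw gaussianTable; infer_instance
  change (A.runLaw (gaussianTable u' v' σ2)).real _ ≤ δ
  have hsub : {q : RewardTable N M × A.Seed |
      A.action q.2 (A.history q.1 q.2 t) = Sum.inr (i₀, j₀)} ⊆ (A.outputEvent (i₁, j₁))ᶜ :=
    fun q hq hq' => hne (outputs_unique ⟨t, hq⟩ hq')
  refine (measureReal_mono hsub).trans ?_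
  rw [probReal_compl_eq_one_sub (measurableSet_outputEvent hA _)]
  have := hPAC u' v' i₁ j₁ h'
  rw [← ofReal_measureReal, ENNReal.ofReal_le_ofReal_iff measureReal_nonneg] at this
  linarith

/-- The row `i` has to be sampled often, since raising `u i` slightly above `u i₀` would change the
best pair. -/
theorem integral_rowCount_ge {σ2 : ℝ≥0} {δ : ℝ} (hPAC : A.IsPAC σ2 δ) (hA : A.IsMeasurable)
    (hσ : σ2 ≠ 0) (h0 : 0 < δ) (h2 : δ ≤ 1 / 2) {u : Fin N → ℝ} {v : Fin M → ℝ}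
    {i₀ : Fin N} {j₀ : Fin M} (h : IsInstance u v i₀ j₀) (t : ℕ) {i : Fin N} (hi : i ≠ i₀) :
    Real.log ((1 - δ) / δ) * (2 * (A.runLaw (gaussianTable u v σ2)).real
        {q | A.action q.2 (A.history q.1 q.2 t) = Sum.inr (i₀, j₀)} - 1) ≤
      (v j₀ * (u i₀ - u i)) ^ 2 / (2 * σ2) * ∑ j, ∫ q, (A.pairCount (i, j) q.2
        (A.history q.1 q.2 t) : ℝ) ∂(A.runLaw (gaussianTable u v σ2)) := by
  set X := Real.log ((1 - δ) / δ) * (2 * (A.runLaw (gaussianTable u v σ2)).real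
        {q | A.action q.2 (A.history q.1 q.2 t) = Sum.inr (i₀, j₀)} - 1) with hX
  set Y := ∑ j, ∫ q, (A.pairCount (i, j) q.2 (A.history q.1 q.2 t) : ℝ)
    ∂(A.runLaw (gaussianTable u v σ2)) with hY
  have hσ' : (0 : ℝ) < σ2 := by exact_mod_cast pos_iff_ne_zero.2 hσ
  -- Item `i` is raised slightly above the best one.
  have key : ∀ ε ∈ Set.Ioo 0 (1 - u i₀), X ≤ (v j₀ * (u i₀ + ε - u i)) ^ 2 / (2 * σ2) * Y := by
    intro ε hε
    have hui : u i < u i₀ := h.row_best i hi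
    have hI : IsInstance (Function.update u i (u i₀ + ε)) v i j₀ := by
      refine ⟨fun k => ?_, h.col_mem, fun k hk => ?_, h.col_best⟩
      · by_cases hk : k = i
        · subst hk
          rw [Function.update_self]
          exact ⟨by have := (h.row_mem i₀).1; linarith [hε.1], by linarith [hε.2]⟩
        · rw [Function.update_of_ne hk]; exact h.row_mem k
      · rw [Function.update_of_ne hk, Function.update_self]
        by_cases hk0 : k = i₀
        · rw [hk0]; linarith [hε.1]
        · linarith [h.row_best k hk0, hε.1]
    refine (hPAC.information_bound hA hσ h0 h2 (u := u) (v := v) hI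
      (fun hc => hi (congrArg Prod.fst hc).symm) t).trans ?_
    rw [Fintype.sum_prod_type, Finset.sum_eq_single i, hY, Finset.mul_sum]
    · refine Finset.sum_le_sum fun j _ => ?_
      rw [mul_comm]
      refine mul_le_mul_of_nonneg_right ?_ (integral_nonneg fun q => Nat.cast_nonneg _)
      rw [Function.update_self]
      refine div_le_div_of_nonneg_right ?_ (by positivity)
      have hvj : v j ≤ v j₀ := by
        by_cases hj : j = j₀
        · rw [hj]
        · exact (h.col_best j hj).le
      have hvj0 := (h.col_mem j).1
      have : (u i₀ + ε) * v j - u i * v j = v j * (u i₀ + ε - u i) := by ring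
      rw [this]
      have hpos : 0 ≤ u i₀ + ε - u i := by linarith [hε.1]
      exact pow_le_pow_left₀ (mul_nonneg hvj0.le hpos)
        (mul_le_mul_of_nonneg_right hvj hpos) 2
    · intro k _ hk
      refine Finset.sum_eq_zero fun j _ => ?_
      simp [Function.update_of_ne hk]
    · simp
  have hcont : ContinuousAt (fun ε : ℝ => (v j₀ * (u i₀ + ε - u i)) ^ 2 / (2 * σ2) * Y) 0 := by
    fun_prop
  have hlim := hcont.tendsto.mono_left (nhdsWithin_le_nhds (s := Set.Ioi (0 : ℝ)))
  simp only [add_zero] at hlim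
  refine ge_of_tendsto hlim ?_
  filter_upwards [Ioo_mem_nhdsGT (show (0 : ℝ) < 1 - u i₀ by linarith [(h.row_mem i₀).2])]
    with ε hε using key ε hε

/-- The column `j` has to be sampled often, since raising `v j` slightly above `v j₀` would change
the best pair. -/
theorem integral_colCount_ge {σ2 : ℝ≥0} {δ : ℝ} (hPAC : A.IsPAC σ2 δ) (hA : A.IsMeasurable)
    (hσ : σ2 ≠ 0) (h0 : 0 < δ) (h2 : δ ≤ 1 / 2) {u : Fin N → ℝ} {v : Fin M → ℝ}
    {i₀ : Fin N} {j₀ : Fin M} (h : IsInstance u v i₀ j₀) (t : ℕ) {j : Fin M} (hj : j ≠ j₀) :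
    Real.log ((1 - δ) / δ) * (2 * (A.runLaw (gaussianTable u v σ2)).real
        {q | A.action q.2 (A.history q.1 q.2 t) = Sum.inr (i₀, j₀)} - 1) ≤
      (u i₀ * (v j₀ - v j)) ^ 2 / (2 * σ2) * ∑ i, ∫ q, (A.pairCount (i, j) q.2
        (A.history q.1 q.2 t) : ℝ) ∂(A.runLaw (gaussianTable u v σ2)) := by
  set X := Real.log ((1 - δ) / δ) * (2 * (A.runLaw (gaussianTable u v σ2)).real
        {q | A.action q.2 (A.history q.1 q.2 t) = Sum.inr (i₀, j₀)} - 1) with hX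
  set Y := ∑ i, ∫ q, (A.pairCount (i, j) q.2 (A.history q.1 q.2 t) : ℝ)
    ∂(A.runLaw (gaussianTable u v σ2)) with hY
  have hσ' : (0 : ℝ) < σ2 := by exact_mod_cast pos_iff_ne_zero.2 hσ
  have key : ∀ ε ∈ Set.Ioo 0 (1 - v j₀), X ≤ (u i₀ * (v j₀ + ε - v j)) ^ 2 / (2 * σ2) * Y := by
    intro ε hε
    have hvj : v j < v j₀ := h.col_best j hj
    have hI : IsInstance u (Function.update v j (v j₀ + ε)) i₀ j := by
      refine ⟨h.row_mem, fun k => ?_, h.row_best, fun k hk => ?_⟩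
      · by_cases hk : k = j
        · subst hk
          rw [Function.update_self]
          exact ⟨by have := (h.col_mem j₀).1; linarith [hε.1], by linarith [hε.2]⟩
        · rw [Function.update_of_ne hk]; exact h.col_mem k
      · rw [Function.update_of_ne hk, Function.update_self]
        by_cases hk0 : k = j₀
        · rw [hk0]; linarith [hε.1]
        · linarith [h.col_best k hk0, hε.1]
    refine (hPAC.information_bound hA hσ h0 h2 (u := u) (v := v) hI
      (fun hc => hj (congrArg Prod.snd hc).symm) t).trans ?_
    rw [Fintype.sum_prod_type_right, Finset.sum_eq_single j, hY, Finset.mul_sum]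
    · refine Finset.sum_le_sum fun i _ => ?_
      rw [mul_comm]
      refine mul_le_mul_of_nonneg_right ?_ (integral_nonneg fun q => Nat.cast_nonneg _)
      rw [Function.update_self]
      refine div_le_div_of_nonneg_right ?_ (by positivity)
      have hui : u i ≤ u i₀ := by
        by_cases hi : i = i₀
        · rw [hi]
        · exact (h.row_best i hi).le
      have hui0 := (h.row_mem i).1
      have : u i * (v j₀ + ε) - u i * v j = u i * (v j₀ + ε - v j) := by ring
      rw [this]
      have hpos : 0 ≤ v j₀ + ε - v j := by linarith [hε.1]
      exact pow_le_pow_left₀ (mul_nonneg hui0.le hpos)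
        (mul_le_mul_of_nonneg_right hui hpos) 2
    · intro k _ hk
      refine Finset.sum_eq_zero fun i _ => ?_
      simp [Function.update_of_ne hk]
    · simp
  have hcont : ContinuousAt (fun ε : ℝ => (u i₀ * (v j₀ + ε - v j)) ^ 2 / (2 * σ2) * Y) 0 := by
    fun_prop
  have hlim := hcont.tendsto.mono_left (nhdsWithin_le_nhds (s := Set.Ioi (0 : ℝ)))
  simp only [add_zero] at hlim
  refine ge_of_tendsto hlim ?_
  filter_upwards [Ioo_mem_nhdsGT (show (0 : ℝ) < 1 - v j₀ by linarith [(h.col_mem j₀).2])]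
    with ε hε using key ε hε

end Algorithm

theorem log_inv_sub_one_le {δ : ℝ} (h0 : 0 < δ) (h1 : δ ≤ 1 / 2) :
    Real.log (1 / δ) - 1 ≤ (1 - 2 * δ) * Real.log ((1 - δ) / δ) := by
  rw [one_div, Real.log_inv, Real.log_div (by linarith) h0.ne']
  -- `-2 δ log δ ≤ 2 / e`
  have e1 : -(δ * Real.log δ) ≤ Real.exp (-1) := by
    have h := Real.add_one_le_exp (-Real.log δ - 1)
    have h2 : Real.exp (-Real.log δ - 1) = Real.exp (-1) / δ := by
      rw [sub_eq_add_neg, Real.exp_add, Real.exp_neg, Real.exp_log h0]; field_simp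
    rw [h2, le_div_iff₀ h0] at h
    linarith
  have e2 : Real.exp (-1) ≤ 0.37 := by
    rw [Real.exp_neg, inv_le_comm₀ (Real.exp_pos _) (by norm_num)]
    exact le_trans (by norm_num) Real.exp_one_gt_d9.le
  -- `-(1 - 2 δ) log (1 - δ) ≤ (1 - 2 δ) δ / (1 - δ)`
  have e3 : -Real.log (1 - δ) ≤ δ / (1 - δ) := by
    have := Real.log_le_sub_one_of_pos (x := (1 - δ)⁻¹) (inv_pos.2 (by linarith))
    rw [Real.log_inv] at this
    refine this.trans (le_of_eq ?_)
    field_simp [show (1 - δ) ≠ 0 by linarith]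
    ring
  have e4 : (1 - 2 * δ) * (δ / (1 - δ)) ≤ 0.2 := by
    rw [← mul_div_assoc, div_le_iff₀ (by linarith)]
    nlinarith [sq_nonneg (δ - 0.3)]
  have e5 := mul_le_mul_of_nonneg_left e3 (show 0 ≤ 1 - 2 * δ by linarith)
  nlinarith

namespace Algorithm

variable {N M : ℕ} {A : Algorithm N M}

theorem lintegral_pairCount_sum (hA : A.IsMeasurable) (P : Measure (RewardTable N M))
    [IsProbabilityMeasure P] (t : ℕ) :
    ENNReal.ofReal (∑ p, ∫ q, (A.pairCount p q.2 (A.history q.1 q.2 t) : ℝ) ∂A.runLaw P) ≤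
      ∫⁻ q, (A.stoppingTime q.1 q.2 : ℝ≥0∞) ∂A.runLaw P := by
  rw [← integral_finsetSum _ fun p _ => integrable_pairCount hA P p t,
    ofReal_integral_eq_lintegral_ofReal
      (integrable_finsetSum _ fun p _ => integrable_pairCount hA P p t)
      (ae_of_all _ fun q => by positivity)]
  refine lintegral_mono fun q => ?_
  rw [← A.iSup_length_history]
  refine le_trans (le_of_eq ?_) (le_iSup _ t)
  rw [← sum_pairCount_history, ← Nat.cast_sum, ENNReal.ofReal_natCast]

/-- The lower bound on the expected number of samples of a `δ`-PAC algorithm. -/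
theorem IsPAC.le_lintegral_stoppingTime {σ2 : ℝ≥0} {δ : ℝ} (hPAC : A.IsPAC σ2 δ)
    (hA : A.IsMeasurable) (h0 : 0 < δ) {u : Fin N → ℝ} {v : Fin M → ℝ}
    {i₀ : Fin N} {j₀ : Fin M} (h : IsInstance u v i₀ j₀) :
    ENNReal.ofReal (σ2 * complexity u v * (Real.log (1 / δ) - 1)) ≤
      ∫⁻ q, (A.stoppingTime q.1 q.2 : ℝ≥0∞) ∂A.runLaw (gaussianTable u v σ2) := by
  have hpP : IsProbabilityMeasure (gaussianTable u v σ2) := by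
    unfold gaussianTable; infer_instance
  have hp : IsProbabilityMeasure (A.runLaw (gaussianTable u v σ2)) := by
    unfold runLaw; infer_instance
  have hc := complexity_nonneg u v
  -- The bound is trivial unless `σ2 ≠ 0` and `δ < 1 / e`.
  by_cases hlog : Real.log (1 / δ) ≤ 1
  · rw [ENNReal.ofReal_of_nonpos]
    · exact zero_le
    · exact mul_nonpos_of_nonneg_of_nonpos (by positivity) (by linarith)
  by_cases hσ : σ2 = 0
  · simp [hσ]
  have hσ' : (0 : ℝ) < σ2 := by exact_mod_cast pos_iff_ne_zero.2 hσ
  have h2 : δ ≤ 1 / 2 := by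
    by_contra hδ
    refine hlog ?_
    have : 1 / δ ≤ 2 := by rw [div_le_iff₀ h0]; linarith
    exact (Real.log_le_log (by positivity) this).trans (by linarith [Real.log_two_lt_d9])
  set Q := A.runLaw (gaussianTable u v σ2) with hQ
  let B : ℕ → Set (RewardTable N M × A.Seed) :=
    fun t => {q | A.action q.2 (A.history q.1 q.2 t) = Sum.inr (i₀, j₀)}
  set κ := Real.log ((1 - δ) / δ) with hκ
  have hκ0 : 0 ≤ κ := Real.log_nonneg (by rw [le_div_iff₀ h0]; linarith)
  have key : ∀ t, ENNReal.ofReal (σ2 * complexity u v * (κ * (2 * Q.real (B t) - 1))) ≤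
      ∫⁻ q, (A.stoppingTime q.1 q.2 : ℝ≥0∞) ∂Q := by
    intro t
    refine le_trans (ENNReal.ofReal_le_ofReal ?_) (lintegral_pairCount_sum hA _ t)
    set X := κ * (2 * Q.real (B t) - 1)
    set n : Fin N × Fin M → ℝ :=
      fun p => ∫ q, (A.pairCount p q.2 (A.history q.1 q.2 t) : ℝ) ∂Q
    have hn : ∀ p, 0 ≤ n p := fun p => integral_nonneg fun q => Nat.cast_nonneg _
    have hrow : ∑ i with i ≠ i₀, 2 * σ2 * (1 / (v j₀ * (u i₀ - u i)) ^ 2) * X ≤ ∑ p, n p := by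
      rw [Fintype.sum_prod_type]
      refine le_trans (Finset.sum_le_sum fun i hi => ?_) (Finset.sum_le_sum_of_subset_of_nonneg
        (Finset.subset_univ _) fun i _ _ => Finset.sum_nonneg fun j _ => hn (i, j))
      have hi := (Finset.mem_filter.1 hi).2
      have hb := integral_rowCount_ge hPAC hA hσ h0 h2 h t hi
      have hd : 0 < (v j₀ * (u i₀ - u i)) ^ 2 :=
        pow_pos (mul_pos (h.col_mem j₀).1 (sub_pos.2 (h.row_best i hi))) 2
      rw [div_mul_eq_mul_div, le_div_iff₀ (by positivity)] at hb
      rw [mul_one_div, div_mul_eq_mul_div, div_le_iff₀ hd]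
      linarith
    have hcol : ∑ j with j ≠ j₀, 2 * σ2 * (1 / (u i₀ * (v j₀ - v j)) ^ 2) * X ≤ ∑ p, n p := by
      rw [Fintype.sum_prod_type_right]
      refine le_trans (Finset.sum_le_sum fun j hj => ?_) (Finset.sum_le_sum_of_subset_of_nonneg
        (Finset.subset_univ _) fun j _ _ => Finset.sum_nonneg fun i _ => hn (i, j))
      have hj := (Finset.mem_filter.1 hj).2
      have hb := integral_colCount_ge hPAC hA hσ h0 h2 h t hj
      have hd : 0 < (u i₀ * (v j₀ - v j)) ^ 2 :=
        pow_pos (mul_pos (h.row_mem i₀).1 (sub_pos.2 (h.col_best j hj))) 2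
      rw [div_mul_eq_mul_div, le_div_iff₀ (by positivity)] at hb
      rw [mul_one_div, div_mul_eq_mul_div, div_le_iff₀ hd]
      linarith
    rw [← Finset.sum_mul, ← Finset.mul_sum] at hrow hcol
    rw [complexity_eq h]
    linarith
  -- As the time tends to infinity, `B t` increases to the event that the best pair is output.
  have hmono : Monotone B := fun t t' htt q hq => by
    change A.action _ _ = _
    rw [A.history_of_inr hq htt]; exact hq
  have hlim := tendsto_measure_iUnion_atTop (μ := Q) hmono
  have hU : (⋃ t, B t) = A.outputEvent (i₀, j₀) := by
    ext q; simp [B, outputEvent, Outputs]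
  rw [hU] at hlim
  have hlim' := (ENNReal.tendsto_toReal (measure_ne_top Q _)).comp hlim
  have hlim2 : Filter.Tendsto
      (fun t => ENNReal.ofReal (σ2 * complexity u v * (κ * (2 * Q.real (B t) - 1))))
      Filter.atTop (nhds (ENNReal.ofReal (σ2 * complexity u v *
        (κ * (2 * Q.real (A.outputEvent (i₀, j₀)) - 1))))) := by
    refine ENNReal.tendsto_ofReal (Filter.Tendsto.const_mul _ (Filter.Tendsto.const_mul _
      (Filter.Tendsto.sub_const (Filter.Tendsto.const_mul _ hlim') _)))
  refine le_trans (ENNReal.ofReal_le_ofReal ?_) (le_of_tendsto' hlim2 key)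
  have hout := hPAC u v i₀ j₀ h
  rw [← ofReal_measureReal, ENNReal.ofReal_le_ofReal_iff measureReal_nonneg] at hout
  refine mul_le_mul_of_nonneg_left ?_ (by positivity)
  refine (log_inv_sub_one_le h0 h2).trans ?_
  rw [mul_comm]
  exact mul_le_mul_of_nonneg_left (by linarith) hκ0

end Algorithm

namespace Elim

variable {n m : ℕ}

/-! ### Elimination of dominated items -/

theorem image_dropItem_subset (e : Elim n m) (r : Fin n → Fin n) (d : Fin n) :
    Finset.univ.image (e.dropItem r d) ⊆ Finset.univ.image r := by
  classical
  intro b hb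
  obtain ⟨i, -, rfl⟩ := Finset.mem_image.1 hb
  unfold dropItem
  split
  · rename_i h
    dsimp only
    split
    · exact (Finset.mem_filter.1 (Finset.max'_mem _ h.2)).1
    · exact Finset.mem_image_of_mem _ (Finset.mem_univ _)
  · exact Finset.mem_image_of_mem _ (Finset.mem_univ _)

theorem mem_image_dropItem {e : Elim n m} {r : Fin n → Fin n} {b : Fin n}
    (hb : b ∈ Finset.univ.image r) (h : ∀ a ∈ Finset.univ.image r, ¬ e.Dominated b a) (d : Fin n) :
    b ∈ Finset.univ.image (e.dropItem r d) := by
  classical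
  obtain ⟨i, -, rfl⟩ := Finset.mem_image.1 hb
  refine Finset.mem_image.2 ⟨i, Finset.mem_univ _, ?_⟩
  unfold dropItem
  split
  · rename_i h1
    dsimp only
    split
    · rename_i h2
      obtain ⟨a, ha⟩ := h1.2
      rw [Finset.mem_filter, ← h2] at ha
      exact absurd ha.2 (h a ha.1)
    · rfl
  · rfl

theorem notMem_image_dropItem {e : Elim n m} {r : Fin n → Fin n} {d a : Fin n}
    (hd : ¬ e.Dominated d d) (ha : a ∈ Finset.univ.image r) (h : e.Dominated d a) :
    d ∉ Finset.univ.image (e.dropItem r d) := by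
  classical
  intro hmem
  obtain ⟨i, -, hi⟩ := Finset.mem_image.1 hmem
  have hdr := image_dropItem_subset e r d hmem
  unfold dropItem at hi
  split at hi
  · rename_i h1
    dsimp only at hi
    split at hi
    · have := Finset.max'_mem _ h1.2
      rw [hi, Finset.mem_filter] at this
      exact hd this.2
    · rename_i h2
      exact h2 hi
  · rename_i h1
    exact h1 ⟨hdr, a, Finset.mem_filter.2 ⟨ha, h⟩⟩

theorem image_foldl_dropItem_subset (e : Elim n m) (l : List (Fin n)) (r : Fin n → Fin n) :
    Finset.univ.image (l.foldl e.dropItem r) ⊆ Finset.univ.image r := by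
  induction l generalizing r with
  | nil => exact subset_rfl
  | cons d l ih => exact (ih _).trans (image_dropItem_subset e r d)

theorem mem_image_foldl_dropItem {e : Elim n m} {b : Fin n} (l : List (Fin n))
    {r : Fin n → Fin n} (hb : b ∈ Finset.univ.image r)
    (h : ∀ a ∈ Finset.univ.image r, ¬ e.Dominated b a) :
    b ∈ Finset.univ.image (l.foldl e.dropItem r) := by
  induction l generalizing r with
  | nil => exact hb
  | cons d l ih =>
    exact ih (mem_image_dropItem hb h d) fun a ha => h a (image_dropItem_subset e r d ha)

theorem not_dominated_of_mem_image_foldl {e : Elim n m} {a b : Fin n} (ha : ¬ e.Dominated a a)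
    (l : List (Fin n)) {r : Fin n → Fin n} (hl : a ∈ l)
    (h1 : a ∈ Finset.univ.image (l.foldl e.dropItem r))
    (h2 : b ∈ Finset.univ.image (l.foldl e.dropItem r)) : ¬ e.Dominated a b := by
  induction l generalizing r with
  | nil => simp at hl
  | cons d l ih =>
    rcases List.mem_cons.1 hl with rfl | hl
    · intro hd
      exact notMem_image_dropItem ha
        (image_dropItem_subset e r a (image_foldl_dropItem_subset e l _ h2)) hd
        (image_foldl_dropItem_subset e l _ h1)
    · exact ih hl h1 h2

/-- All lower confidence bounds are below the corresponding upper bounds. -/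
def Consistent (e : Elim n m) : Prop := ∀ κ i, e.lo κ i ≤ e.hi κ i

theorem radius_nonneg (β : ℕ → ℝ) (l : ℕ) : 0 ≤ radius β l := Real.sqrt_nonneg _

theorem consistent_fresh : (fresh n m).Consistent := fun _ _ => bot_le

theorem Consistent.refresh {e : Elim n m} (h : e.Consistent) (β : ℕ → ℝ) :
    (e.refresh β).Consistent := fun κ i => by
  by_cases hl : ∃ l, 0 < l ∧ e.num κ i = level β l
  · simp only [Elim.refresh, dif_pos hl]
    have := radius_nonneg β (Nat.find hl)
    exact_mod_cast (by linarith : e.mean κ i - radius β (Nat.find hl) ≤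
      e.mean κ i + radius β (Nat.find hl))
  · simp only [Elim.refresh, dif_neg hl]
    exact h κ i

theorem Consistent.update {e : Elim n m} (h : e.Consistent) (β : ℕ → ℝ) :
    (e.update β).Consistent := h.refresh β

theorem active_update_subset (e : Elim n m) (β : ℕ → ℝ) : (e.update β).active ⊆ e.active :=
  image_foldl_dropItem_subset (e.refresh β) _ _

theorem mem_active_update {e : Elim n m} {β : ℕ → ℝ} {b : Fin n} (hb : b ∈ e.active)
    (h : ∀ κ, ∀ a ∈ e.active, (e.refresh β).lo κ a ≤ (e.refresh β).hi κ b) :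
    b ∈ (e.update β).active :=
  mem_image_foldl_dropItem (e := e.refresh β) _ hb fun a ha ⟨κ, hκ⟩ => (h κ a ha).not_gt hκ

theorem lo_le_hi_of_mem_active_update {e : Elim n m} {β : ℕ → ℝ} (he : e.Consistent) {a b : Fin n}
    (ha : a ∈ (e.update β).active) (hb : b ∈ (e.update β).active) (κ : Option (Fin m)) :
    (e.refresh β).lo κ b ≤ (e.refresh β).hi κ a := by
  by_contra hlt
  exact not_dominated_of_mem_image_foldl (e := e.refresh β)
    (fun ⟨κ', h⟩ => (he.refresh β κ' a).not_gt h) _ (List.mem_finRange a) ha hb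
    ⟨κ, not_le.1 hlt⟩

theorem active_nonempty [NeZero n] (e : Elim n m) : e.active.Nonempty :=
  ⟨e.rep 0, Finset.mem_image_of_mem _ (Finset.mem_univ _)⟩

theorem rep_mem_active (e : Elim n m) (i : Fin n) : e.rep i ∈ e.active :=
  Finset.mem_image_of_mem _ (Finset.mem_univ _)

@[simp] theorem active_fresh : (fresh n m).active = Finset.univ := by
  simp [active, fresh]

/-! ### Deviations of the empirical means -/

/-- Sum of the samples of a tracked parameter. -/
def sum (e : Elim n m) : Option (Fin m) → Fin n → ℝ
  | some k, i => e.total i k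
  | none, i => ∑ k, e.total i k

/-- Sum of the means of the samples of a tracked parameter, when a sample of item `i` against item
`k` has mean `μ i k`. -/
def meanSum (e : Elim n m) (μ : Fin n → Fin m → ℝ) : Option (Fin m) → Fin n → ℝ
  | some k, i => e.count i k * μ i k
  | none, i => ∑ k, e.count i k * μ i k

/-- Sum of the noises of the samples of a tracked parameter. -/
def dev (e : Elim n m) (μ : Fin n → Fin m → ℝ) (κ : Option (Fin m)) (i : Fin n) : ℝ :=
  e.sum κ i - e.meanSum μ κ i

theorem mean_eq (e : Elim n m) (κ : Option (Fin m)) (i : Fin n) :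
    e.mean κ i = (e.meanSum μ κ i + e.dev μ κ i) / e.num κ i := by
  cases κ <;> simp [mean, dev, sum, num]

theorem num_congr {e : Elim n m} {a b : Fin n} (h : ∀ k, e.count a k = e.count b k)
    (κ : Option (Fin m)) : e.num κ a = e.num κ b := by
  cases κ <;> simp [num, h]

theorem meanSum_mono {e : Elim n m} {μ : Fin n → Fin m → ℝ} {a b : Fin n}
    (h : ∀ k, e.count a k = e.count b k) (hμ : ∀ k, μ a k ≤ μ b k) (κ : Option (Fin m)) :
    e.meanSum μ κ a ≤ e.meanSum μ κ b := by
  cases κ with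
  | none =>
    refine Finset.sum_le_sum fun k _ => ?_
    rw [h]; exact mul_le_mul_of_nonneg_left (hμ k) (Nat.cast_nonneg _)
  | some k =>
    simp only [meanSum]
    rw [h]; exact mul_le_mul_of_nonneg_left (hμ k) (Nat.cast_nonneg _)

theorem meanSum_gap {e : Elim n m} {μ : Fin n → Fin m → ℝ} {a b : Fin n} {g : ℝ}
    (h : ∀ k, e.count a k = e.count b k) {κ : Option (Fin m)}
    (hμ : ∀ k, κ = none ∨ κ = some k → μ a k + g ≤ μ b k) :
    e.meanSum μ κ a + e.num κ a * g ≤ e.meanSum μ κ b := by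
  cases κ with
  | none =>
    simp only [meanSum, num, Nat.cast_sum, Finset.sum_mul, ← Finset.sum_add_distrib, ← mul_add]
    refine Finset.sum_le_sum fun k _ => ?_
    rw [h]; exact mul_le_mul_of_nonneg_left (hμ k (Or.inl rfl)) (Nat.cast_nonneg _)
  | some k =>
    simp only [meanSum, num, ← mul_add]
    rw [h]; exact mul_le_mul_of_nonneg_left (hμ k (Or.inr rfl)) (Nat.cast_nonneg _)

/-- No active item has a lower confidence bound above the corresponding upper bound of `b`. -/
def Sound (e : Elim n m) (b : Fin n) : Prop :=
  b ∈ e.active ∧ ∀ κ, ∀ a ∈ e.active, e.lo κ a ≤ e.hi κ b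

theorem sound_fresh (b : Fin n) : (fresh n m).Sound b := ⟨by simp, fun _ _ _ => bot_le⟩

/-- The best item survives as long as its upper confidence bounds and the lower confidence bounds
of the others hold at the update times. -/
theorem Sound.update {e : Elim n m} {b : Fin n} (hs : e.Sound b) {β : ℕ → ℝ}
    {μ : Fin n → Fin m → ℝ} (hc : ∀ a ∈ e.active, ∀ k, e.count a k = e.count b k)
    (hμ : ∀ a k, μ a k ≤ μ b k)
    (hup : ∀ κ a l, a ≠ b → 0 < l → e.num κ a = level β l →
      e.dev μ κ a ≤ e.num κ a * radius β l)
    (hdown : ∀ κ l, 0 < l → e.num κ b = level β l →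
      -(e.num κ b * radius β l) ≤ e.dev μ κ b) : (e.update β).Sound b := by
  have key : ∀ κ, ∀ a ∈ e.active, (e.refresh β).lo κ a ≤ (e.refresh β).hi κ b := by
    intro κ a ha
    have hnum := num_congr (hc a ha) κ
    by_cases hl : ∃ l, 0 < l ∧ e.num κ b = level β l
    · have hl' : ∃ l, 0 < l ∧ e.num κ a = level β l := by rwa [hnum]
      simp only [Elim.refresh, dif_pos hl, dif_pos hl']
      have hfind : Nat.find hl' = Nat.find hl := by congr 1; simp only [hnum]
      rw [hfind]
      have hr := radius_nonneg β (Nat.find hl)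
      have hspec := Nat.find_spec hl
      norm_cast
      by_cases hab : a = b
      · subst hab; linarith
      have h1 := hup κ a _ hab hspec.1 (hnum.trans hspec.2)
      have h2 := hdown κ _ hspec.1 hspec.2
      rw [mean_eq (μ := μ), mean_eq (μ := μ), hnum]
      rw [hnum] at h1
      rcases Nat.eq_zero_or_pos (e.num κ b) with h0 | h0
      · rw [show (e.num κ b : ℝ) = 0 by exact_mod_cast h0, div_zero, div_zero]; linarith
      · have h0' : (0 : ℝ) < e.num κ b := by exact_mod_cast h0
        rw [add_div, add_div]
        have h3 := div_le_div_of_nonneg_right (meanSum_mono (hc a ha) (hμ a) κ) h0'.le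
        have h4 : e.dev μ κ a / e.num κ b ≤ radius β (Nat.find hl) := by
          rw [div_le_iff₀ h0']; linarith
        have h5 : -radius β (Nat.find hl) ≤ e.dev μ κ b / e.num κ b := by
          rw [le_div_iff₀ h0']; linarith
        linarith
    · have hl' : ¬ ∃ l, 0 < l ∧ e.num κ a = level β l := by rwa [hnum]
      simp only [Elim.refresh, dif_neg hl, dif_neg hl']
      exact hs.2 κ a ha
  exact ⟨mem_active_update hs.1 key, fun κ a ha => key κ a (active_update_subset e β ha)⟩

/-- Two items whose means differ by `g` are separated at a sample size whose radius is below `g/4`,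
unless one of the deviations is large. -/
theorem not_both_mem_active_update {e : Elim n m} {β : ℕ → ℝ} (he : e.Consistent)
    {μ : Fin n → Fin m → ℝ} {a b : Fin n} (hc : ∀ k, e.count a k = e.count b k)
    {κ : Option (Fin m)} {l : ℕ} (hl : 0 < l) (hnum : e.num κ a = level β l) (hpos : 0 < level β l)
    (hinj : ∀ l', 0 < l' → level β l' = level β l → l' = l) {g : ℝ} (hr : radius β l < g / 4)
    (hμ : ∀ k, κ = none ∨ κ = some k → μ a k + g ≤ μ b k)
    (hda : e.dev μ κ a < level β l * (g / 4)) (hdb : -(level β l * (g / 4)) < e.dev μ κ b) :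
    ¬ (a ∈ (e.update β).active ∧ b ∈ (e.update β).active) := by
  rintro ⟨ha, hb⟩
  have h := lo_le_hi_of_mem_active_update he ha hb κ
  have hnum' : e.num κ b = level β l := (num_congr hc κ).symm.trans hnum
  have hla : ∃ l, 0 < l ∧ e.num κ a = level β l := ⟨l, hl, hnum⟩
  have hlb : ∃ l, 0 < l ∧ e.num κ b = level β l := ⟨l, hl, hnum'⟩
  simp only [Elim.refresh, dif_pos hla, dif_pos hlb] at h
  have hfa : Nat.find hla = l :=
    hinj _ (Nat.find_spec hla).1 ((Nat.find_spec hla).2.symm.trans hnum)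
  have hfb : Nat.find hlb = l :=
    hinj _ (Nat.find_spec hlb).1 ((Nat.find_spec hlb).2.symm.trans hnum')
  rw [hfa, hfb] at h
  norm_cast at h
  rw [mean_eq (μ := μ), mean_eq (μ := μ), hnum, hnum', add_div, add_div] at h
  have h0 : (0 : ℝ) < level β l := by exact_mod_cast hpos
  have hgap := meanSum_gap hc hμ
  rw [hnum] at hgap
  have h1 : e.dev μ κ a / level β l < g / 4 := by rw [div_lt_iff₀ h0]; linarith
  have h2 : -(g / 4) < e.dev μ κ b / level β l := by rw [lt_div_iff₀ h0]; linarith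
  have h3 : e.meanSum μ κ a / level β l + g ≤ e.meanSum μ κ b / level β l := by
    rw [div_add' _ _ _ h0.ne', div_le_div_iff_of_pos_right h0]; linarith
  linarith

@[simp] theorem num_fresh (κ : Option (Fin m)) (i : Fin n) : (fresh n m).num κ i = 0 := by
  cases κ <;> simp [num, fresh]

@[simp] theorem dev_fresh (μ : Fin n → Fin m → ℝ) (κ : Option (Fin m)) (i : Fin n) :
    (fresh n m).dev μ κ i = 0 := by
  cases κ <;> simp [dev, sum, meanSum, fresh]

@[simp] theorem num_update (e : Elim n m) (β : ℕ → ℝ) : (e.update β).num = e.num := by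
  funext κ i; cases κ <;> rfl

@[simp] theorem dev_update (e : Elim n m) (β : ℕ → ℝ) (μ : Fin n → Fin m → ℝ) :
    (e.update β).dev μ = e.dev μ := by
  funext κ i; cases κ <;> rfl

/-- A sample of the pair `p` is a sample of the tracked parameter `(κ, i)`. -/
def Tracks (κ : Option (Fin m)) (i : Fin n) (p : Fin n × Fin m) : Prop :=
  p.1 = i ∧ (κ = none ∨ κ = some p.2)

instance (κ : Option (Fin m)) (i : Fin n) (p : Fin n × Fin m) : Decidable (Tracks κ i p) := by
  unfold Tracks; infer_instance

theorem num_record (e : Elim n m) (p : Fin n × Fin m) (y : ℝ) (κ : Option (Fin m)) (i : Fin n) :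
    (e.record p.1 p.2 y).num κ i = e.num κ i + if Tracks κ i p then 1 else 0 := by
  obtain ⟨a, k⟩ := p
  cases κ with
  | none =>
    simp only [num, record, Tracks, true_or, and_true]
    by_cases h : a = i
    · subst h
      have : ∀ x, (if x = k then e.count a x + 1 else e.count a x) =
          e.count a x + if x = k then 1 else 0 := fun x => by split_ifs <;> rfl
      simp [this, Finset.sum_add_distrib]
    · simp [h, Ne.symm h]
  | some k' =>
    simp only [num, record, Tracks, Option.some.injEq, reduceCtorEq, false_or]
    by_cases h : a = i
    · by_cases hk : k' = k <;> simp [h, hk]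
    · simp [h, Ne.symm h]

theorem dev_record (e : Elim n m) (μ : Fin n → Fin m → ℝ) (p : Fin n × Fin m) (y : ℝ)
    (κ : Option (Fin m)) (i : Fin n) :
    (e.record p.1 p.2 y).dev μ κ i =
      e.dev μ κ i + if Tracks κ i p then y - μ p.1 p.2 else 0 := by
  obtain ⟨a, k⟩ := p
  cases κ with
  | none =>
    simp only [dev, sum, meanSum, record, Tracks, true_or, and_true]
    by_cases h : a = i
    · subst h
      have h1 : ∀ x, (if x = k then e.total a x + y else e.total a x) =
          e.total a x + if x = k then y else 0 := fun x => by split_ifs <;> simp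
      have h2 : ∀ x, ((if x = k then e.count a x + 1 else e.count a x : ℕ) : ℝ) * μ a x =
          e.count a x * μ a x + if x = k then μ a x else 0 := fun x => by
        split_ifs <;> simp [add_mul]
      simp only [true_and, if_true]
      simp only [h1, h2, Finset.sum_add_distrib, Finset.sum_ite_eq', Finset.mem_univ, if_true]
      ring
    · simp [h, Ne.symm h]
  | some k' =>
    simp only [dev, sum, meanSum, record, Tracks, Option.some.injEq, reduceCtorEq, false_or]
    by_cases h : a = i
    · by_cases hk : k' = k
      · simp [h, hk, add_mul]; ring
      · simp [h, hk]
    · simp [h, Ne.symm h]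

end Elim

/-! ### Sample sizes and radii of the confidence intervals -/

/-- Confidence parameters that do not decrease with the level and are at least `2`. -/
structure Admissible (β : ℕ → ℝ) : Prop where
  two_le : ∀ l, 0 < l → 2 ≤ β l
  le_succ : ∀ l, 0 < l → β l ≤ β (l + 1)

namespace Admissible

open Elim

variable {β : ℕ → ℝ}

theorem half_lt_log (h : Admissible β) {l : ℕ} (hl : 0 < l) : 1 / 2 < Real.log (β l) :=
  lt_of_lt_of_le (by linarith [Real.log_two_gt_d9])
    (Real.log_le_log (by norm_num) (h.two_le l hl))

theorem le_level (β : ℕ → ℝ) (l : ℕ) : (4 : ℝ) ^ (l + 1) * Real.log (β l) ≤ level β l :=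
  Nat.le_ceil _

theorem level_le (h : Admissible β) {l : ℕ} (hl : 0 < l) :
    (level β l : ℝ) ≤ (4 : ℝ) ^ (l + 1) * Real.log (β l) + 1 :=
  (Nat.ceil_lt_add_one (mul_nonneg (by positivity) (by linarith [h.half_lt_log hl]))).le

theorem four_pow_le_level (h : Admissible β) {l : ℕ} (hl : 0 < l) : (4 : ℝ) ^ l ≤ level β l := by
  refine le_trans ?_ (le_level β l)
  rw [pow_succ]
  nlinarith [h.half_lt_log hl, pow_pos (show (0 : ℝ) < 4 by norm_num) l]

theorem level_pos (h : Admissible β) {l : ℕ} (hl : 0 < l) : 0 < level β l := by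
  have := h.four_pow_le_level hl
  have h4 := pow_pos (show (0 : ℝ) < 4 by norm_num) l
  exact_mod_cast h4.trans_le this

theorem level_lt_succ (h : Admissible β) {l : ℕ} (hl : 0 < l) : level β l < level β (l + 1) := by
  have h1 := h.level_le hl
  have h2 := le_level β (l + 1)
  have h3 : Real.log (β l) ≤ Real.log (β (l + 1)) :=
    Real.log_le_log (by linarith [h.two_le l hl]) (h.le_succ l hl)
  have h4 := h.half_lt_log hl
  have h5 : (4 : ℝ) ≤ 4 ^ (l + 1) := by
    rw [pow_succ]; nlinarith [one_le_pow₀ (show (1 : ℝ) ≤ 4 by norm_num) (n := l)]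
  have h6 : (4 : ℝ) ^ (l + 1 + 1) = 4 * 4 ^ (l + 1) := by ring
  rw [h6] at h2
  have : (level β l : ℝ) < level β (l + 1) := by nlinarith
  exact_mod_cast this

theorem level_lt (h : Admissible β) {l l' : ℕ} (hl : 0 < l) (hll : l < l') :
    level β l < level β l' := by
  induction l', hll using Nat.le_induction with
  | base => exact h.level_lt_succ hl
  | succ k hk ih => exact ih.trans (h.level_lt_succ (by omega))

theorem level_injective (h : Admissible β) {l l' : ℕ} (hl : 0 < l) (hl' : 0 < l')
    (heq : level β l' = level β l) : l' = l := by
  rcases lt_trichotomy l l' with hlt | hlt | hlt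
  · exact absurd heq (h.level_lt hl hlt).ne'
  · exact hlt.symm
  · exact absurd heq (h.level_lt hl' hlt).ne

theorem level_mul_radius_sq (h : Admissible β) {l : ℕ} (hl : 0 < l) :
    level β l * radius β l ^ 2 = Real.log (β l) := by
  have h0 : (0 : ℝ) < level β l := by exact_mod_cast h.level_pos hl
  rw [radius, Real.sq_sqrt (div_nonneg (by linarith [h.half_lt_log hl]) h0.le)]
  field_simp

theorem radius_le (h : Admissible β) {l : ℕ} (hl : 0 < l) : radius β l ≤ (1 / 2) ^ (l + 1) := by
  have h0 : (0 : ℝ) < level β l := by exact_mod_cast h.level_pos hl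
  refine Real.sqrt_le_iff.2 ⟨by positivity, ?_⟩
  rw [div_le_iff₀ h0, ← pow_mul, mul_comm (l + 1) 2, pow_mul]
  have h1 := le_level β l
  have h4 : (0 : ℝ) < 4 ^ (l + 1) := by positivity
  have h2 : ((1 / 2 : ℝ) ^ 2) ^ (l + 1) = 1 / 4 ^ (l + 1) := by
    rw [show ((1 / 2 : ℝ) ^ 2) = 1 / 4 by norm_num, one_div_pow]
  rw [h2, one_div_mul_eq_div, le_div_iff₀ h4]
  linarith

end Admissible

/-! ### One side of the algorithm along a run -/

/-- What concerns one side (rows or columns) in a state: the statistics, the planned samples as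
pairs (item, opponent), and an index that increases whenever the statistics restart. -/
structure SideState (n m : ℕ) where
  elim : Elim n m
  todo : List (Fin n × Fin m)
  epoch : ℕ∞

/-- The samples of all active items against `k`. -/
def Elim.plan {n m : ℕ} (e : Elim n m) (k : Fin m) : List (Fin n × Fin m) :=
  ((List.finRange n).filter fun a => a ∈ e.active).map fun a => (a, k)

/-- The possible effects on one side of the reception of a reward; the last index tells whether a
new round begins. -/
inductive SideStep {n m : ℕ} (β : ℕ∞ → ℕ → ℝ) (y : ℝ) (V : SideState n m) :
    SideState n m → Bool → Prop
  | idle : SideStep β y V V false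
  | sample (p : Fin n × Fin m) (l : List (Fin n × Fin m)) (h : V.todo = p :: l) :
      SideStep β y V ⟨V.elim.record p.1 p.2 y, l, V.epoch⟩ false
  | round (e : Elim n m) (k : Fin m)
      (h : V.todo = [] ∧ e = V.elim ∨ ∃ p, V.todo = [p] ∧ e = V.elim.record p.1 p.2 y) :
      SideStep β y V ⟨e.update (β V.epoch), (e.update (β V.epoch)).plan k, V.epoch⟩ true
  | reset (k : Fin m) (w : ℕ∞) (h : V.epoch < w) :
      SideStep β y V
        ⟨(Elim.fresh n m).update (β w), ((Elim.fresh n m).update (β w)).plan k, w⟩ true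

namespace SideState

variable {n m : ℕ}

/-- The number of samples of a tracked parameter, including those planned in the current round. -/
def planned (V : SideState n m) (κ : Option (Fin m)) (i : Fin n) : ℕ :=
  V.elim.num κ i + V.todo.countP fun p => Elim.Tracks κ i p

theorem planned_of_todo_eq_nil {V : SideState n m} (h : V.todo = []) (κ : Option (Fin m))
    (i : Fin n) : V.planned κ i = V.elim.num κ i := by
  simp [planned, h]

theorem planned_record (V : SideState n m) {p : Fin n × Fin m} {l : List (Fin n × Fin m)}
    (h : V.todo = p :: l) (y : ℝ) (w : ℕ∞) (κ : Option (Fin m)) (i : Fin n) :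
    planned ⟨V.elim.record p.1 p.2 y, l, w⟩ κ i = V.planned κ i := by
  simp only [planned, h, Elim.num_record, List.countP_cons, decide_eq_true_eq]
  ring

theorem countP_plan (e : Elim n m) (k : Fin m) (κ : Option (Fin m)) (i : Fin n) :
    ((e.plan k).countP fun p => Elim.Tracks κ i p) =
      if i ∈ e.active ∧ (κ = none ∨ κ = some k) then 1 else 0 := by
  rw [Elim.plan, List.countP_map, List.countP_filter]
  by_cases hk : κ = none ∨ κ = some k
  · by_cases hi : i ∈ e.active
    · have : List.countP (fun a => decide (a = i)) (List.finRange n) = 1 := by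
        have h1 : List.count i (List.finRange n) = 1 :=
          List.count_eq_one_of_mem (List.nodup_finRange n) (List.mem_finRange i)
        rw [← h1, List.count]
        exact List.countP_congr fun a _ => by simp
      rw [if_pos ⟨hi, hk⟩, ← this]
      refine List.countP_congr fun a _ => ?_
      simp only [Function.comp_apply, Elim.Tracks, hk, and_true, Bool.and_eq_true,
        decide_eq_true_eq]
      exact ⟨fun h => h.1, fun h => ⟨h, h ▸ hi⟩⟩
    · rw [if_neg fun h => hi h.1, List.countP_eq_zero]
      intro a _
      simp only [Function.comp_apply, Bool.and_eq_true, decide_eq_true_eq]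
      rintro ⟨⟨h, -⟩, h2⟩
      exact hi (h ▸ h2)
  · rw [if_neg fun h => hk h.2, List.countP_eq_zero]
    intro a _
    simp only [Function.comp_apply, Bool.and_eq_true, decide_eq_true_eq]
    rintro ⟨⟨-, h⟩, -⟩
    exact hk h

theorem planned_update_plan (e : Elim n m) (β : ℕ → ℝ) (k : Fin m) (w : ℕ∞) (κ : Option (Fin m))
    (i : Fin n) : planned ⟨e.update β, (e.update β).plan k, w⟩ κ i =
      e.num κ i + if i ∈ (e.update β).active ∧ (κ = none ∨ κ = some k) then 1 else 0 := by
  simp only [planned, Elim.num_update, countP_plan]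

/-- Within a round, the planned numbers of samples are the same for all active items. -/
structure WellFormed (V : SideState n m) : Prop where
  consistent : V.elim.Consistent
  balanced : ∀ a ∈ V.elim.active, ∀ b ∈ V.elim.active, ∀ k,
    V.planned (some k) a = V.planned (some k) b

theorem wellFormed_update_plan {e : Elim n m} (he : e.Consistent)
    (hb : ∀ a ∈ e.active, ∀ b ∈ e.active, ∀ k, e.count a k = e.count b k) (β : ℕ → ℝ) (k : Fin m)
    (w : ℕ∞) : WellFormed ⟨e.update β, (e.update β).plan k, w⟩ where
  consistent := he.update β
  balanced a ha b hb' k' := by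
    simp only [planned_update_plan, Elim.num]
    rw [hb a (Elim.active_update_subset e β ha) b (Elim.active_update_subset e β hb')]
    simp only at ha hb'
    simp [ha, hb']

end SideState

namespace SideStep

variable {n m : ℕ} {β : ℕ∞ → ℕ → ℝ} {y : ℝ} {V V' : SideState n m} {r : Bool}

open SideState

/-- At the end of a round all planned samples have been taken. -/
theorem num_eq_planned {e : Elim n m}
    (h : V.todo = [] ∧ e = V.elim ∨ ∃ p, V.todo = [p] ∧ e = V.elim.record p.1 p.2 y)
    (κ : Option (Fin m)) (i : Fin n) : e.num κ i = V.planned κ i := by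
  rcases h with ⟨h, rfl⟩ | ⟨p, h, rfl⟩
  · rw [planned_of_todo_eq_nil h]
  · rw [← V.planned_record h y 0, planned_of_todo_eq_nil rfl]

theorem active_eq_of_end {e : Elim n m}
    (h : V.todo = [] ∧ e = V.elim ∨ ∃ p, V.todo = [p] ∧ e = V.elim.record p.1 p.2 y) :
    e.active = V.elim.active := by
  rcases h with ⟨h, rfl⟩ | ⟨p, h, rfl⟩ <;> rfl

theorem bounds_eq_of_end {e : Elim n m}
    (h : V.todo = [] ∧ e = V.elim ∨ ∃ p, V.todo = [p] ∧ e = V.elim.record p.1 p.2 y) :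
    e.lo = V.elim.lo ∧ e.hi = V.elim.hi := by
  rcases h with ⟨h, rfl⟩ | ⟨p, h, rfl⟩ <;> exact ⟨rfl, rfl⟩

theorem balanced_of_end {e : Elim n m} (hV : V.WellFormed)
    (h : V.todo = [] ∧ e = V.elim ∨ ∃ p, V.todo = [p] ∧ e = V.elim.record p.1 p.2 y) :
    ∀ a ∈ e.active, ∀ b ∈ e.active, ∀ k, e.count a k = e.count b k := by
  intro a ha b hb k
  rw [active_eq_of_end h] at ha hb
  have := hV.balanced a ha b hb k
  rwa [← num_eq_planned h, ← num_eq_planned h] at this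

theorem consistent_of_end {e : Elim n m} (hV : V.WellFormed)
    (h : V.todo = [] ∧ e = V.elim ∨ ∃ p, V.todo = [p] ∧ e = V.elim.record p.1 p.2 y) :
    e.Consistent := fun κ i => by
  rw [(bounds_eq_of_end h).1, (bounds_eq_of_end h).2]; exact hV.consistent κ i

theorem wellFormed (h : SideStep β y V V' r) (hV : V.WellFormed) : V'.WellFormed := by
  cases h with
  | idle => exact hV
  | sample p l h =>
    refine ⟨hV.consistent, fun a ha b hb k => ?_⟩
    rw [V.planned_record h, V.planned_record h]
    exact hV.balanced a ha b hb k
  | round e k h =>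
    exact wellFormed_update_plan (consistent_of_end hV h) (balanced_of_end hV h) _ _ _
  | reset k w h =>
    exact wellFormed_update_plan Elim.consistent_fresh (fun _ _ _ _ _ => rfl) _ _ _

theorem epoch_le (h : SideStep β y V V' r) : V.epoch ≤ V'.epoch := by
  cases h with
  | reset k w h => exact h.le
  | _ => exact le_rfl

theorem active_subset (h : SideStep β y V V' r) (he : V'.epoch = V.epoch) :
    V'.elim.active ⊆ V.elim.active := by
  cases h with
  | idle => exact subset_rfl
  | sample p l h => exact subset_rfl
  | round e k h => rw [← active_eq_of_end h]; exact Elim.active_update_subset _ _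
  | reset k w h => exact absurd he h.ne'

end SideStep

/-- A sum over the rounds begun along a list of rewards; `r y L` tells whether a round begins with
the reception of `y` after `L`. -/
def roundSum (r : ℝ → List ℝ → Bool) (f : List ℝ → ℕ) : List ℝ → ℕ
  | [] => f []
  | y :: L => roundSum r f L + if r y L then f (y :: L) else 0

/-- A round begins after the rewards of the list. -/
def IsStart (r : ℝ → List ℝ → Bool) : List ℝ → Prop
  | [] => True
  | y :: L => r y L = true

/-- The evolution of one side along all lists of rewards. -/
structure SidePath {n m : ℕ} (β : ℕ∞ → ℕ → ℝ) (V : List ℝ → SideState n m)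
    (r : ℝ → List ℝ → Bool) : Prop where
  start : ∃ k w, V [] =
    ⟨(Elim.fresh n m).update (β w), ((Elim.fresh n m).update (β w)).plan k, w⟩
  step : ∀ y L, SideStep β y (V L) (V (y :: L)) (r y L)

namespace SidePath

open SideState

variable {n m : ℕ} {β : ℕ∞ → ℕ → ℝ} {V : List ℝ → SideState n m} {r : ℝ → List ℝ → Bool}

theorem wellFormed (hV : SidePath β V r) (L : List ℝ) : (V L).WellFormed := by
  induction L with
  | nil =>
    obtain ⟨k, w, h⟩ := hV.start
    rw [h]
    exact wellFormed_update_plan Elim.consistent_fresh (fun _ _ _ _ _ => rfl) _ _ _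
  | cons y L ih => exact (hV.step y L).wellFormed ih

theorem epoch_mono (hV : SidePath β V r) {L L' : List ℝ} (h : L' <:+ L) :
    (V L').epoch ≤ (V L).epoch := by
  induction L with
  | nil => rw [List.suffix_nil.1 h]
  | cons y L ih =>
    rcases List.suffix_cons_iff.1 h with rfl | h
    · exact le_rfl
    · exact (ih h).trans (hV.step y L).epoch_le

/-- The best item stays active in an epoch if the relevant one-sided confidence bounds hold at all
the update times of this epoch. -/
theorem sound (hV : SidePath β V r) {μ : Fin n → Fin m → ℝ} {b : Fin n}
    (hμ : ∀ a k, μ a k ≤ μ b k) {w : ℕ∞} {L : List ℝ} (hw : (V L).epoch = w)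
    (hup : ∀ L', L' <:+ L → (V L').epoch = w → ∀ κ a l, a ≠ b → 0 < l →
      (V L').elim.num κ a = Elim.level (β w) l →
      (V L').elim.dev μ κ a ≤ (V L').elim.num κ a * Elim.radius (β w) l)
    (hdown : ∀ L', L' <:+ L → (V L').epoch = w → ∀ κ l, 0 < l →
      (V L').elim.num κ b = Elim.level (β w) l →
      -((V L').elim.num κ b * Elim.radius (β w) l) ≤ (V L').elim.dev μ κ b) :
    (V L).elim.Sound b := by
  have fresh_case : ∀ {W : SideState n m} {k},
      W = ⟨(Elim.fresh n m).update (β w), ((Elim.fresh n m).update (β w)).plan k, w⟩ →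
      (∀ κ a l, a ≠ b → 0 < l → W.elim.num κ a = Elim.level (β w) l →
        W.elim.dev μ κ a ≤ W.elim.num κ a * Elim.radius (β w) l) →
      (∀ κ l, 0 < l → W.elim.num κ b = Elim.level (β w) l →
        -(W.elim.num κ b * Elim.radius (β w) l) ≤ W.elim.dev μ κ b) → W.elim.Sound b := by
    rintro W k rfl h1 h2
    simp only [Elim.num_update, Elim.dev_update] at h1 h2
    exact (Elim.sound_fresh b).update (fun _ _ _ => rfl) hμ h1 h2
  induction L with
  | nil =>
    obtain ⟨k, w', h⟩ := hV.start
    have hw' : w' = w := by rw [← hw, h]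
    subst hw'
    exact fresh_case h (hup [] (List.suffix_refl _) hw) (hdown [] (List.suffix_refl _) hw)
  | cons y L ih =>
    have hup0 := hup _ (List.suffix_refl _) hw
    have hdown0 := hdown _ (List.suffix_refl _) hw
    have ih' : (V L).epoch = w → (V L).elim.Sound b := fun hw' => ih hw'
      (fun L' hL' => hup L' (hL'.trans (List.suffix_cons y L)))
      (fun L' hL' => hdown L' (hL'.trans (List.suffix_cons y L)))
    have hs := hV.step y L
    have hwf := hV.wellFormed L
    revert hs hw hup0 hdown0
    generalize V (y :: L) = W
    generalize r y L = ρ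
    intro hw hup0 hdown0 hs
    cases hs with
    | idle => exact ih' hw
    | sample p l h => exact ih' hw
    | round e k h =>
      have hs := ih' hw
      simp only at hw
      rw [hw] at hup0 hdown0 ⊢
      simp only [Elim.num_update, Elim.dev_update] at hup0 hdown0
      have hse : e.Sound b := by
        refine ⟨by rw [SideStep.active_eq_of_end h]; exact hs.1, fun κ a ha => ?_⟩
        rw [SideStep.active_eq_of_end h] at ha
        rw [(SideStep.bounds_eq_of_end h).1, (SideStep.bounds_eq_of_end h).2]
        exact hs.2 κ a ha
      exact hse.update (fun a ha => SideStep.balanced_of_end hwf h a ha b hse.1) hμ hup0 hdown0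
    | reset k w' h =>
      simp only at hw
      subst hw
      exact fresh_case rfl hup0 hdown0

/-- The number of rounds in which two items with means at distance `g` are both sampled for the
parameter `κ` is at most the sample size of a level whose radius is below `g/4`, unless a deviation
is large at this sample size. -/
theorem roundSum_le_level (hV : SidePath β V r) {μ : Fin n → Fin m → ℝ} {a b : Fin n} {w : ℕ∞}
    {κ : Option (Fin m)} {g : ℝ} (hμ : ∀ k, κ = none ∨ κ = some k → μ a k + g ≤ μ b k)
    (hβ : Admissible (β w)) {l : ℕ} (hl : 0 < l) (hr : Elim.radius (β w) l < g / 4)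
    {f : List ℝ → ℕ} (hf1 : ∀ L, f L ≤ 1) (hf : ∀ L, IsStart r L → f L ≠ 0 → (V L).epoch = w ∧
      a ∈ (V L).elim.active ∧ b ∈ (V L).elim.active ∧
      ((V L).todo.countP fun p => Elim.Tracks κ a p) = 1) {L : List ℝ}
    (ha : ∀ L', L' <:+ L → (V L').epoch = w → (V L').elim.num κ a = Elim.level (β w) l →
      (V L').elim.dev μ κ a < Elim.level (β w) l * (g / 4))
    (hb : ∀ L', L' <:+ L → (V L').epoch = w → (V L').elim.num κ b = Elim.level (β w) l →
      -(Elim.level (β w) l * (g / 4)) < (V L').elim.dev μ κ b) :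
    roundSum r f L ≤ Elim.level (β w) l := by
  set K := Elim.level (β w) l with hK
  have hK0 : 0 < K := hβ.level_pos hl
  -- The invariant also compares with the planned number of samples.
  let Inv : SideState n m → ℕ → Prop := fun W q => q ≤ K ∧ (W.epoch < w → q = 0) ∧
    (W.epoch = w → q ≤ W.planned κ a ∧
      (a ∈ W.elim.active → b ∈ W.elim.active → W.planned κ a ≤ K))
  suffices h : Inv (V L) (roundSum r f L) from h.1
  have fresh_case : ∀ {L' : List ℝ} {k w'}, IsStart r L' → V L' =
      ⟨(Elim.fresh n m).update (β w'), ((Elim.fresh n m).update (β w')).plan k, w'⟩ →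
      Inv (V L') (f L') := by
    intro L' k w' hst h
    refine ⟨(hf1 L').trans hK0, fun hlt => ?_, fun he => ⟨?_, fun _ _ => ?_⟩⟩
    · by_contra h0
      exact hlt.ne (hf L' hst h0).1
    · by_cases h0 : f L' = 0
      · simp [h0]
      · rw [planned, (hf L' hst h0).2.2.2]
        exact (hf1 L').trans (Nat.le_add_left _ _)
    · rw [h, planned_update_plan, Elim.num_fresh]
      split_ifs <;> omega
  induction L with
  | nil =>
    obtain ⟨k, w', h⟩ := hV.start
    exact fresh_case trivial h
  | cons y L ih =>
    have ha0 := ha _ (List.suffix_refl _)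
    have hb0 := hb _ (List.suffix_refl _)
    have hf0 := hf (y :: L)
    have hf10 := hf1 (y :: L)
    have hfc := @fresh_case (y :: L)
    rw [IsStart] at hf0 hfc
    have ih := ih (fun L' hL' => ha L' (hL'.trans (List.suffix_cons y L)))
      (fun L' hL' => hb L' (hL'.trans (List.suffix_cons y L)))
    have hs := hV.step y L
    have hwf := hV.wellFormed L
    rw [roundSum]
    revert hs ha0 hb0 hf0 hfc
    generalize V (y :: L) = W
    generalize r y L = ρ
    intro ha0 hb0 hf0 hfc hs
    cases hs with
    | idle => simpa using ih
    | sample p t h =>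
      simp only [Bool.false_eq_true, if_false, add_zero]
      refine ⟨ih.1, ih.2.1, fun he => ?_⟩
      rw [(V L).planned_record h]
      exact ih.2.2 he
    | round e k h =>
      simp only [if_true]
      set q := roundSum r f L with hq
      obtain ⟨i1, i2, i3⟩ := ih
      by_cases he : (V L).epoch = w
      · obtain ⟨i3, i4⟩ := i3 he
        rw [← SideStep.num_eq_planned h] at i3 i4
        simp only [he] at ha0 hb0 hf0 ⊢
        simp only [Elim.num_update, Elim.dev_update, true_imp_iff, true_and] at ha0 hb0 hf0
        have hsub := Elim.active_update_subset e (β w)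
        have hact := SideStep.active_eq_of_end h
        -- If both items stay active, the sample size has not reached the level.
        have hlt : a ∈ (e.update (β w)).active → b ∈ (e.update (β w)).active →
            e.num κ a < K := fun h1 h2 => by
          refine lt_of_le_of_ne (i4 (hact ▸ hsub h1) (hact ▸ hsub h2)) fun heq => ?_
          have hc : ∀ k, e.count a k = e.count b k :=
            SideStep.balanced_of_end hwf h a (hsub h1) b (hsub h2)
          exact Elim.not_both_mem_active_update (SideStep.consistent_of_end hwf h) hc hl heq hK0
            (fun l' hl' h => hβ.level_injective hl hl' h) hr hμ (ha0 heq)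
            (hb0 ((Elim.num_congr hc κ).symm.trans heq)) ⟨h1, h2⟩
        refine ⟨?_, fun hw => absurd rfl hw.ne, fun _ => ⟨?_, fun h1 h2 => ?_⟩⟩
        · by_cases h0 : f (y :: L) = 0
          · rw [h0]; exact i1
          · have := hlt (hf0 h0).1 (hf0 h0).2.1
            omega
        · by_cases h0 : f (y :: L) = 0
          · rw [h0, planned_update_plan]; omega
          · rw [planned, (hf0 h0).2.2, Elim.num_update]; omega
        · have := hlt h1 h2
          rw [planned_update_plan]
          split_ifs <;> omega
      · have h0 : f (y :: L) = 0 := by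
          by_contra h0
          exact he (hf0 rfl h0).1
        rw [h0, add_zero]
        exact ⟨i1, i2, fun h => absurd h he⟩
    | reset k w' h =>
      simp only [if_true]
      by_cases he : w' ≤ w
      · have hlt : (V L).epoch < w := h.trans_le he
        rw [ih.2.1 hlt, zero_add]
        have := @hfc k w' rfl rfl
        exact this
      · have h0 : f (y :: L) = 0 := by
          by_contra h0
          exact he (hf0 rfl h0).1.le
        rw [h0, add_zero]
        refine ⟨ih.1, fun hlt => absurd hlt.le he, fun h => absurd h.le he⟩

end SidePath

namespace State

variable {N M : ℕ}

/-! ### The steps of Pair-Elim -/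

/-- The confidence parameters of the columns, by epoch: the epoch `⊤` is the second phase. -/
noncomputable def colEpochBeta (N M : ℕ) (δ : ℝ) (w : ℕ∞) (l : ℕ) : ℝ :=
  if w = ⊤ then sureBeta N M δ l else windowBeta w.toNat l

/-- The index of the current column statistics: that of the window in the first phase, `⊤` in the
second one. -/
def colEpoch (st : State N M) : ℕ∞ := if st.rowPhase then (st.window : ℕ∞) else ⊤

theorem colBeta_eq (δ : ℝ) (st : State N M) : st.colBeta δ = colEpochBeta N M δ st.colEpoch := by
  funext l
  cases h : st.rowPhase <;> simp [colBeta, colEpochBeta, colEpoch, h]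

/-- The rows in a state; their statistics never restart. -/
def rowView (st : State N M) : SideState N M := ⟨st.rows, st.todoRows, 0⟩

/-- The columns in a state. -/
def colView (st : State N M) : SideState M N :=
  ⟨st.cols, st.todoCols.map Prod.swap, st.colEpoch⟩

/-- The state after the last reward of a round, sampled from the pair `p`. -/
def lastCol (st : State N M) (p : Fin N × Fin M) (y : ℝ) : State N M :=
  { st with cols := st.cols.record p.2 p.1 y, spent := st.spent + 1, todoCols := [] }

theorem rowView_beginRound (δ : ℝ) (ξ : ℕ → Fin N × Fin M) (st : State N M) :
    ∃ k ∈ (st.cols.update (st.colBeta δ)).active, (beginRound δ ξ st).rowView =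
      ⟨st.rows.update (sureBeta N M δ), (st.rows.update (sureBeta N M δ)).plan k, 0⟩ :=
  ⟨_, Elim.rep_mem_active _ _, rfl⟩

theorem colView_beginRound (δ : ℝ) (ξ : ℕ → Fin N × Fin M) (st : State N M) :
    ∃ k ∈ (st.rows.update (sureBeta N M δ)).active, (beginRound δ ξ st).colView =
      ⟨st.cols.update (colEpochBeta N M δ st.colEpoch),
        (st.cols.update (colEpochBeta N M δ st.colEpoch)).plan k, st.colEpoch⟩ := by
  refine ⟨_, Elim.rep_mem_active _ (ξ st.round).1, ?_⟩
  rw [← colBeta_eq]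
  simp only [colView, beginRound, Elim.plan, List.map_map]
  rfl

theorem plan_ne_nil {n m : ℕ} [NeZero n] (e : Elim n m) (k : Fin m) : e.plan k ≠ [] := by
  obtain ⟨a, ha⟩ := e.active_nonempty
  refine List.ne_nil_of_mem (a := (a, k)) ?_
  simp [Elim.plan, ha]

theorem todoCols_beginRound_ne_nil [NeZero M] (δ : ℝ) (ξ : ℕ → Fin N × Fin M) (st : State N M) :
    (beginRound δ ξ st).todoCols ≠ [] := by
  obtain ⟨k, -, h⟩ := colView_beginRound δ ξ st
  intro h0
  have := congrArg SideState.todo h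
  simp only [colView, h0, List.map_nil] at this
  exact plan_ne_nil _ _ this.symm

variable [NeZero N] [NeZero M]

/-- Consistency of the flags of a state with the planned samples and the active sets. -/
structure Coherent (st : State N M) : Prop where
  todo_of_none : st.result = none → st.todoCols ≠ []
  todo_of_some : st.result ≠ none → st.todoRows = [] ∧ st.todoCols = []
  card_rows : st.rowPhase = false → st.rows.active.card = 1
  of_some : ∀ p, st.result = some p →
    st.rowPhase = false ∧ st.cols.active.card = 1 ∧ p = (st.rows.rep 0, st.cols.rep 0)

/-- The possible effects of the reception of a reward; the last index tells whether a new round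
begins. -/
inductive Step (δ : ℝ) (ξ : ℕ → Fin N × Fin M) (y : ℝ) (st : State N M) : State N M → Bool → Prop
  | stopped (h : st.result ≠ none) : Step δ ξ y st st false
  | row (p : Fin N × Fin M) (l : List (Fin N × Fin M)) (h : st.todoRows = p :: l)
      (hr : st.result = none) :
      Step δ ξ y st
        { st with rows := st.rows.record p.1 p.2 y, spent := st.spent + 1, todoRows := l } false
  | col (p q : Fin N × Fin M) (l : List (Fin N × Fin M)) (h : st.todoRows = [])
      (h' : st.todoCols = p :: q :: l) (hr : st.result = none) :
      Step δ ξ y st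
        { st with cols := st.cols.record p.2 p.1 y, spent := st.spent + 1, todoCols := q :: l }
        false
  | detect (p : Fin N × Fin M) (h : st.todoRows = []) (h' : st.todoCols = [p])
      (hr : st.result = none) (hp : st.rowPhase = true) (hc : st.rows.active.card = 1) :
      Step δ ξ y st (beginRound δ ξ
        { st.lastCol p y with rowPhase := false, cols := Elim.fresh M N }) true
  | window (p : Fin N × Fin M) (h : st.todoRows = []) (h' : st.todoCols = [p])
      (hr : st.result = none) (hp : st.rowPhase = true) (hc : st.rows.active.card ≠ 1)
      (hs : 2 ^ (2 ^ st.window) < st.spent + 1) :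
      Step δ ξ y st (beginRound δ ξ
        { st.lastCol p y with window := st.window + 1, spent := 0, cols := Elim.fresh M N }) true
  | round (p : Fin N × Fin M) (h : st.todoRows = []) (h' : st.todoCols = [p])
      (hr : st.result = none) (hp : st.rowPhase = true) (hc : st.rows.active.card ≠ 1)
      (hs : ¬ 2 ^ (2 ^ st.window) < st.spent + 1) :
      Step δ ξ y st (beginRound δ ξ (st.lastCol p y)) true
  | final (p : Fin N × Fin M) (h : st.todoRows = []) (h' : st.todoCols = [p])
      (hr : st.result = none) (hp : st.rowPhase = false) (hc : st.cols.active.card = 1) :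
      Step δ ξ y st
        { st.lastCol p y with result := some (st.rows.rep 0, st.cols.rep 0) } false
  | late (p : Fin N × Fin M) (h : st.todoRows = []) (h' : st.todoCols = [p])
      (hr : st.result = none) (hp : st.rowPhase = false) (hc : st.cols.active.card ≠ 1) :
      Step δ ξ y st (beginRound δ ξ (st.lastCol p y)) true

theorem observe_step (δ : ℝ) (ξ : ℕ → Fin N × Fin M) (y : ℝ) {st : State N M} (hst : st.Coherent) :
    Step δ ξ y st (st.observe δ ξ y) (decide ((st.observe δ ξ y).round ≠ st.round)) := by
  by_cases hr : st.result = none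
  · have hcols := hst.todo_of_none hr
    rcases hR : st.todoRows with _ | ⟨p, l⟩
    · rcases hC : st.todoCols with _ | ⟨p, _ | ⟨q, l⟩⟩
      · exact absurd hC hcols
      · have hrec : st.receive y = st.lastCol p y := by simp [receive, hR, hC, lastCol]
        have hobs : st.observe δ ξ y = if (st.lastCol p y).endRound.result = none then
            (st.lastCol p y).endRound.beginRound δ ξ else (st.lastCol p y).endRound := by
          unfold observe
          simp only [hrec]
          rw [if_pos]
          exact ⟨hR, rfl⟩
        have hres : (st.lastCol p y).result = none := hr
        cases hp : st.rowPhase with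
        | true =>
          have hp' : (st.lastCol p y).rowPhase = true := hp
          by_cases hc : st.rows.active.card = 1
          · have he : (st.lastCol p y).endRound =
                { st.lastCol p y with rowPhase := false, cols := Elim.fresh M N } := by
              rw [endRound, if_pos hp', if_pos (by exact hc)]
            rw [he, if_pos (by exact hres)] at hobs
            rw [hobs]
            convert Step.detect (δ := δ) (ξ := ξ) (y := y) p hR hC hr hp hc using 1
            simp [beginRound, lastCol]
          · by_cases hs : 2 ^ (2 ^ st.window) < st.spent + 1
            · have he : (st.lastCol p y).endRound = { st.lastCol p y with
                  window := st.window + 1, spent := 0, cols := Elim.fresh M N } := by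
                rw [endRound, if_pos hp', if_neg (by exact hc), if_pos (by exact hs)]
                rfl
              rw [he, if_pos (by exact hres)] at hobs
              rw [hobs]
              convert Step.window (δ := δ) (ξ := ξ) (y := y) p hR hC hr hp hc hs using 1
              simp [beginRound, lastCol]
            · have he : (st.lastCol p y).endRound = st.lastCol p y := by
                rw [endRound, if_pos hp', if_neg (by exact hc), if_neg (by exact hs)]
              rw [he, if_pos (by exact hres)] at hobs
              rw [hobs]
              convert Step.round (δ := δ) (ξ := ξ) (y := y) p hR hC hr hp hc hs using 1
              simp [beginRound, lastCol]
        | false =>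
          have hp' : ¬ (st.lastCol p y).rowPhase = true := by simp [lastCol, hp]
          by_cases hc : st.cols.active.card = 1
          · have he : (st.lastCol p y).endRound = { st.lastCol p y with
                result := some (st.rows.rep 0, st.cols.rep 0) } := by
              rw [endRound, if_neg hp', if_pos (by exact hc)]
              rfl
            rw [he, if_neg (by simp)] at hobs
            rw [hobs]
            convert Step.final (δ := δ) (ξ := ξ) (y := y) p hR hC hr hp hc using 1
            simp [lastCol]
          · have he : (st.lastCol p y).endRound = st.lastCol p y := by
              rw [endRound, if_neg hp', if_neg (by exact hc)]
            rw [he, if_pos (by exact hres)] at hobs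
            rw [hobs]
            convert Step.late (δ := δ) (ξ := ξ) (y := y) p hR hC hr hp hc using 1
            simp [beginRound, lastCol]
      · have hobs : st.observe δ ξ y = { st with
            cols := st.cols.record p.2 p.1 y, spent := st.spent + 1, todoCols := q :: l } := by
          simp [observe, receive, hR, hC]
        rw [hobs]
        convert Step.col (δ := δ) (ξ := ξ) (y := y) p q l hR hC hr using 1
        simp
    · have hobs : st.observe δ ξ y = { st with
          rows := st.rows.record p.1 p.2 y, spent := st.spent + 1, todoRows := l } := by
        simp [observe, receive, hR, hcols]
      rw [hobs]
      convert Step.row (δ := δ) (ξ := ξ) (y := y) p l hR hr using 1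
      simp
  · obtain ⟨hR, hC⟩ := hst.todo_of_some hr
    obtain ⟨p, hp⟩ := Option.ne_none_iff_exists'.1 hr
    obtain ⟨h1, h2, h3⟩ := hst.of_some p hp
    have hrec : st.receive y = st := by simp [receive, hR, hC]
    have he : st.endRound = st := by
      rw [endRound, if_neg (by simp [h1]), if_pos h2, ← h3, ← hp]
    have hobs : st.observe δ ξ y = st := by
      unfold observe
      simp only [hrec, he]
      rw [if_pos ⟨hR, hC⟩, if_neg hr]
    rw [hobs]
    convert Step.stopped (δ := δ) (ξ := ξ) (y := y) hr using 1
    simp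

theorem card_active_update {n m : ℕ} [NeZero n] {e : Elim n m} (h : e.active.card = 1)
    (β : ℕ → ℝ) : (e.update β).active.card = 1 :=
  le_antisymm (h ▸ Finset.card_le_card (e.active_update_subset β))
    (Finset.card_pos.2 (Elim.active_nonempty _))

theorem coherent_beginRound (δ : ℝ) (ξ : ℕ → Fin N × Fin M) {st : State N M}
    (h1 : st.result = none) (h2 : st.rowPhase = false → st.rows.active.card = 1) :
    (beginRound δ ξ st).Coherent where
  todo_of_none _ := todoCols_beginRound_ne_nil δ ξ st
  todo_of_some h := absurd h1 h
  card_rows h := card_active_update (h2 h) _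
  of_some p h := by
    have : st.result = some p := h
    simp [h1] at this

theorem Step.coherent {δ : ℝ} {ξ : ℕ → Fin N × Fin M} {y : ℝ} {st st' : State N M} {r : Bool}
    (h : Step δ ξ y st st' r) (hst : st.Coherent) : st'.Coherent := by
  cases h with
  | stopped h => exact hst
  | row p l h hr =>
    exact ⟨fun _ => hst.todo_of_none hr, fun h => absurd hr h, hst.card_rows,
      fun p h => by simp [hr] at h⟩
  | col p q l h h' hr =>
    exact ⟨fun _ => by simp, fun h => absurd hr h, hst.card_rows, fun p h => by simp [hr] at h⟩
  | detect p h h' hr hp hc => exact coherent_beginRound δ ξ hr fun _ => hc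
  | window p h h' hr hp hc hs =>
    exact coherent_beginRound δ ξ hr fun h => absurd (hp.symm.trans h) (by simp)
  | round p h h' hr hp hc hs =>
    exact coherent_beginRound δ ξ hr fun h => absurd (hp.symm.trans h) (by simp)
  | final p h h' hr hp hc =>
    exact ⟨fun h => by simp at h, fun _ => ⟨h, rfl⟩, hst.card_rows,
      fun q hq => ⟨hp, hc, (Option.some.inj hq).symm⟩⟩
  | late p h h' hr hp hc => exact coherent_beginRound δ ξ hr hst.card_rows

theorem coherent_after (δ : ℝ) (ξ : ℕ → Fin N × Fin M) (L : List ℝ) :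
    (after δ ξ L).Coherent := by
  induction L with
  | nil => exact coherent_beginRound δ ξ rfl fun h => by simp [init] at h
  | cons y L ih => exact (observe_step δ ξ y ih).coherent ih

/-- A round begins with the reception of the reward `y` after the list `L`. -/
noncomputable def newRound (δ : ℝ) (ξ : ℕ → Fin N × Fin M) (y : ℝ) (L : List ℝ) : Bool :=
  decide ((after δ ξ (y :: L)).round ≠ (after δ ξ L).round)

theorem after_step (δ : ℝ) (ξ : ℕ → Fin N × Fin M) (y : ℝ) (L : List ℝ) :
    Step δ ξ y (after δ ξ L) (after δ ξ (y :: L)) (newRound δ ξ y L) :=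
  observe_step δ ξ y (coherent_after δ ξ L)

theorem Step.row_side {δ : ℝ} {ξ : ℕ → Fin N × Fin M} {y : ℝ} {st st' : State N M} {r : Bool}
    (h : Step δ ξ y st st' r) :
    SideStep (fun _ => sureBeta N M δ) y st.rowView st'.rowView r := by
  have begin : ∀ st1 : State N M, st.todoRows = [] → st1.rows = st.rows →
      SideStep (fun _ => sureBeta N M δ) y st.rowView (beginRound δ ξ st1).rowView true := by
    intro st1 h h1
    obtain ⟨k, -, hk⟩ := rowView_beginRound δ ξ st1
    rw [hk, h1]
    exact SideStep.round (V := st.rowView) st.rows k (Or.inl ⟨h, rfl⟩)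
  cases h with
  | stopped h => exact SideStep.idle
  | row p l h hr => exact SideStep.sample (V := st.rowView) p l h
  | col p q l h h' hr => exact SideStep.idle
  | detect p h h' hr hp hc => exact begin _ h rfl
  | window p h h' hr hp hc hs => exact begin _ h rfl
  | round p h h' hr hp hc hs => exact begin _ h rfl
  | final p h h' hr hp hc => exact SideStep.idle
  | late p h h' hr hp hc => exact begin _ h rfl

theorem Step.col_side {δ : ℝ} {ξ : ℕ → Fin N × Fin M} {y : ℝ} {st st' : State N M} {r : Bool}
    (h : Step δ ξ y st st' r) :
    SideStep (colEpochBeta N M δ) y st.colView st'.colView r := by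
  have hsome : ∀ {p : Fin N × Fin M}, st.todoCols = [p] → st.colView.todo = [p.swap] :=
    fun h' => by simp [colView, h']
  have keep : ∀ p, st.todoCols = [p] →
      SideStep (colEpochBeta N M δ) y st.colView (beginRound δ ξ (st.lastCol p y)).colView true := by
    intro p h'
    obtain ⟨k, -, hk⟩ := colView_beginRound δ ξ (st.lastCol p y)
    rw [hk]
    exact SideStep.round (V := st.colView) (st.cols.record p.2 p.1 y) k
      (Or.inr ⟨p.swap, hsome h', rfl⟩)
  cases h with
  | stopped h => exact SideStep.idle
  | row p l h hr => exact SideStep.idle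
  | col p q l h h' hr =>
    exact SideStep.sample (V := st.colView) p.swap ((q :: l).map Prod.swap) (by simp [colView, h'])
  | detect p h h' hr hp hc =>
    obtain ⟨k, -, hk⟩ := colView_beginRound δ ξ
      { st.lastCol p y with rowPhase := false, cols := Elim.fresh M N }
    rw [hk]
    refine SideStep.reset (V := st.colView) k _ ?_
    simp [colView, colEpoch, hp]
  | window p h h' hr hp hc hs =>
    obtain ⟨k, -, hk⟩ := colView_beginRound δ ξ
      { st.lastCol p y with window := st.window + 1, spent := 0, cols := Elim.fresh M N }
    rw [hk]
    refine SideStep.reset (V := st.colView) k _ ?_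
    simp only [colView, colEpoch, lastCol, hp, if_true]
    exact_mod_cast Nat.lt_succ_self _
  | round p h h' hr hp hc hs => exact keep p h'
  | final p h h' hr hp hc =>
    exact SideStep.sample (V := st.colView) p.swap [] (hsome h')
  | late p h h' hr hp hc => exact keep p h'

theorem row_path (δ : ℝ) (ξ : ℕ → Fin N × Fin M) :
    SidePath (fun _ => sureBeta N M δ) (fun L => (after δ ξ L).rowView) (newRound δ ξ) where
  start := by
    obtain ⟨k, -, hk⟩ := rowView_beginRound δ ξ (init N M)
    exact ⟨k, 0, hk⟩
  step y L := (after_step δ ξ y L).row_side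

theorem col_path (δ : ℝ) (ξ : ℕ → Fin N × Fin M) :
    SidePath (colEpochBeta N M δ) (fun L => (after δ ξ L).colView) (newRound δ ξ) where
  start := by
    obtain ⟨k, -, hk⟩ := colView_beginRound δ ξ (init N M)
    exact ⟨k, _, hk⟩
  step y L := (after_step δ ξ y L).col_side

/-- At the start of a round, all active items are planned against an active opponent. -/
theorem todo_of_isStart {δ : ℝ} {ξ : ℕ → Fin N × Fin M} {L : List ℝ}
    (h : IsStart (newRound δ ξ) L) :
    (after δ ξ L).result = none ∧
      (∃ k ∈ (after δ ξ L).cols.active, (after δ ξ L).todoRows = (after δ ξ L).rows.plan k) ∧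
      ∃ k ∈ (after δ ξ L).rows.active,
        (after δ ξ L).todoCols.map Prod.swap = (after δ ξ L).cols.plan k := by
  have key : ∀ st1 : State N M, st1.result = none → (beginRound δ ξ st1).result = none ∧
      (∃ k ∈ (beginRound δ ξ st1).cols.active,
        (beginRound δ ξ st1).todoRows = (beginRound δ ξ st1).rows.plan k) ∧
      ∃ k ∈ (beginRound δ ξ st1).rows.active,
        (beginRound δ ξ st1).todoCols.map Prod.swap = (beginRound δ ξ st1).cols.plan k := by
    intro st1 h1
    obtain ⟨k, hk, hR⟩ := rowView_beginRound δ ξ st1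
    obtain ⟨k', hk', hC⟩ := colView_beginRound δ ξ st1
    refine ⟨h1, ⟨k, hk, congrArg SideState.todo hR⟩, k', hk', ?_⟩
    have h2 := congrArg SideState.todo hC
    have h3 := congrArg SideState.elim hC
    simp only [colView] at h2 h3
    rw [h2, h3]
  cases L with
  | nil => exact key _ rfl
  | cons y L =>
    have hs := after_step δ ξ y L
    rw [IsStart] at h
    rw [h] at hs
    generalize after δ ξ (y :: L) = st' at hs ⊢
    cases hs with
    | detect p _ _ hr => exact key _ hr
    | window p _ _ hr => exact key _ hr
    | round p _ _ hr => exact key _ hr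
    | late p _ _ hr => exact key _ hr

end State

/-! ### Measurability of the states -/

/-- A countable type of discrete data, with all sets measurable. -/
structure Disc (α : Type*) where
  val : α

namespace Disc

variable {α : Type*}

instance : MeasurableSpace (Disc α) := ⊤

instance : DiscreteMeasurableSpace (Disc α) := ⟨fun _ => trivial⟩

instance [Countable α] : Countable (Disc α) :=
  Function.Injective.countable (f := Disc.val) fun x y h => by cases x; cases y; simp_all

end Disc

namespace Elim

variable {n m : ℕ}

/-- The discrete data of one side. -/
def disc (e : Elim n m) : Disc ((Fin n → Fin m → ℕ) × (Fin n → Fin n)) := ⟨(e.count, e.rep)⟩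

/-- The numerical data of one side. -/
def numData (e : Elim n m) : (Fin n → Fin m → ℝ) × (Option (Fin m) → Fin n → EReal) ×
    (Option (Fin m) → Fin n → EReal) := (e.total, e.lo, e.hi)

noncomputable instance : MeasurableSpace (Elim n m) :=
  MeasurableSpace.comap (fun e => (e.disc, e.numData)) inferInstance

variable {α : Type*} [MeasurableSpace α]

theorem measurable_disc : Measurable (disc : Elim n m → _) :=
  measurable_fst.comp (comap_measurable fun e : Elim n m => (e.disc, e.numData))

theorem measurable_numData : Measurable (numData : Elim n m → _) :=
  measurable_snd.comp (comap_measurable fun e : Elim n m => (e.disc, e.numData))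

theorem measurable_total (i : Fin n) (k : Fin m) : Measurable fun e : Elim n m => e.total i k :=
  (measurable_pi_apply k).comp ((measurable_pi_apply i).comp
    (measurable_fst.comp measurable_numData))

theorem measurable_lo (κ : Option (Fin m)) (i : Fin n) : Measurable fun e : Elim n m => e.lo κ i :=
  (measurable_pi_apply i).comp ((measurable_pi_apply κ).comp
    (measurable_fst.comp (measurable_snd.comp measurable_numData)))

theorem measurable_hi (κ : Option (Fin m)) (i : Fin n) : Measurable fun e : Elim n m => e.hi κ i :=
  (measurable_pi_apply i).comp ((measurable_pi_apply κ).comp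
    (measurable_snd.comp (measurable_snd.comp measurable_numData)))

theorem measurable_of_parts {f : α → Elim n m} (hd : Measurable fun a => (f a).disc)
    (ht : ∀ i k, Measurable fun a => (f a).total i k)
    (hl : ∀ κ i, Measurable fun a => (f a).lo κ i)
    (hh : ∀ κ i, Measurable fun a => (f a).hi κ i) : Measurable f := by
  refine measurable_comap_iff.2 (hd.prodMk (Measurable.prodMk ?_ (Measurable.prodMk ?_ ?_)))
  · exact measurable_pi_iff.2 fun i => measurable_pi_iff.2 fun k => ht i k
  · exact measurable_pi_iff.2 fun κ => measurable_pi_iff.2 fun i => hl κ i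
  · exact measurable_pi_iff.2 fun κ => measurable_pi_iff.2 fun i => hh κ i

theorem measurable_record (i : Fin n) (k : Fin m) :
    Measurable fun z : Elim n m × ℝ => z.1.record i k z.2 := by
  have hlo : ∀ κ a, Measurable fun z : Elim n m × ℝ => z.1.lo κ a := fun κ a =>
    (measurable_lo κ a).comp measurable_fst
  have hhi : ∀ κ a, Measurable fun z : Elim n m × ℝ => z.1.hi κ a := fun κ a =>
    (measurable_hi κ a).comp measurable_fst
  refine measurable_of_parts ?_ (fun a b => ?_) hlo hhi
  · exact (Measurable.of_discrete (f := fun d : Disc ((Fin n → Fin m → ℕ) × (Fin n → Fin n)) =>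
      (⟨(fun a b => if a = i ∧ b = k then d.val.1 a b + 1 else d.val.1 a b, d.val.2)⟩ :
        Disc ((Fin n → Fin m → ℕ) × (Fin n → Fin n))))).comp (measurable_disc.comp measurable_fst)
  · simp only [record]
    split_ifs
    · exact ((measurable_total a b).comp measurable_fst).add measurable_snd
    · exact (measurable_total a b).comp measurable_fst

theorem measurable_num (κ : Option (Fin m)) (i : Fin n) :
    Measurable fun e : Elim n m => e.num κ i := by
  have : (fun e : Elim n m => e.num κ i) =
      (fun d : Disc ((Fin n → Fin m → ℕ) × (Fin n → Fin n)) =>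
        Option.elim κ (∑ k, d.val.1 i k) (fun k => d.val.1 i k)) ∘ disc := by
    funext e; cases κ <;> rfl
  rw [this]
  exact (Measurable.of_discrete).comp measurable_disc

theorem measurable_sum (κ : Option (Fin m)) (i : Fin n) :
    Measurable fun e : Elim n m => e.sum κ i := by
  cases κ with
  | none => exact Finset.measurable_fun_sum _ fun k _ => measurable_total i k
  | some k => exact measurable_total i k

theorem measurable_meanSum (μ : Fin n → Fin m → ℝ) (κ : Option (Fin m)) (i : Fin n) :
    Measurable fun e : Elim n m => e.meanSum μ κ i := by
  have : (fun e : Elim n m => e.meanSum μ κ i) =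
      (fun d : Disc ((Fin n → Fin m → ℕ) × (Fin n → Fin n)) =>
        Option.elim κ (∑ k, d.val.1 i k * μ i k) (fun k => d.val.1 i k * μ i k)) ∘ disc := by
    funext e; cases κ <;> rfl
  rw [this]
  exact (Measurable.of_discrete).comp measurable_disc

theorem measurable_dev (μ : Fin n → Fin m → ℝ) (κ : Option (Fin m)) (i : Fin n) :
    Measurable fun e : Elim n m => e.dev μ κ i :=
  (measurable_sum κ i).sub (measurable_meanSum μ κ i)

theorem measurable_mean (κ : Option (Fin m)) (i : Fin n) :
    Measurable fun e : Elim n m => e.mean κ i := by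
  have : (fun e : Elim n m => e.mean κ i) = fun e => e.sum κ i / (e.num κ i : ℝ) := by
    funext e; cases κ <;> rfl
  rw [this]
  exact (measurable_sum κ i).div ((measurable_from_top (f := fun k : ℕ => (k : ℝ))).comp
    (measurable_num κ i))

open Classical in
theorem measurable_refresh (β : ℕ → ℝ) : Measurable fun e : Elim n m => e.refresh β := by
  refine measurable_of_parts measurable_disc measurable_total (fun κ i => ?_) (fun κ i => ?_)
  · refine measurable_of_countable_cases (measurable_num κ i) (f := fun (k : ℕ) (e : Elim n m) =>
      if h : ∃ l, 0 < l ∧ k = level β l then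
        ((e.mean κ i - radius β (Nat.find h) : ℝ) : EReal) else e.lo κ i) fun k => ?_
    by_cases h : ∃ l, 0 < l ∧ k = level β l
    · simp only [dif_pos h]
      exact measurable_coe_real_ereal.comp ((measurable_mean κ i).sub_const _)
    · simp only [dif_neg h]
      exact measurable_lo κ i
  · refine measurable_of_countable_cases (measurable_num κ i) (f := fun (k : ℕ) (e : Elim n m) =>
      if h : ∃ l, 0 < l ∧ k = level β l then
        ((e.mean κ i + radius β (Nat.find h) : ℝ) : EReal) else e.hi κ i) fun k => ?_
    by_cases h : ∃ l, 0 < l ∧ k = level β l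
    · simp only [dif_pos h]
      exact measurable_coe_real_ereal.comp ((measurable_mean κ i).add_const _)
    · simp only [dif_neg h]
      exact measurable_hi κ i

theorem measurable_dominated :
    Measurable fun e : Elim n m => (⟨e.Dominated⟩ : Disc (Fin n → Fin n → Prop)) := by
  refine measurable_to_countable' fun T => ?_
  have : (fun e : Elim n m => (⟨e.Dominated⟩ : Disc (Fin n → Fin n → Prop))) ⁻¹' {T} =
      ⋂ i, ⋂ j, {e | e.Dominated i j ↔ T.val i j} := by
    ext e
    simp only [Set.mem_preimage, Set.mem_singleton_iff, Set.mem_iInter, Set.mem_ofPred_eq]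
    constructor
    · rintro rfl i j; rfl
    · intro h
      obtain ⟨T⟩ := T
      congr 1
      funext i j
      exact propext (h i j)
  rw [this]
  refine MeasurableSet.iInter fun i => MeasurableSet.iInter fun j => ?_
  have hD : MeasurableSet {e : Elim n m | e.Dominated i j} := by
    have : {e : Elim n m | e.Dominated i j} = ⋃ κ, {e | e.hi κ i < e.lo κ j} := by
      ext e; simp [Dominated]
    rw [this]
    exact MeasurableSet.iUnion fun κ => measurableSet_lt (measurable_hi κ i) (measurable_lo κ j)
  by_cases hT : T.val i j
  · simpa [hT] using hD
  · have : {e : Elim n m | e.Dominated i j ↔ T.val i j} = {e | e.Dominated i j}ᶜ := by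
      ext e; simp [hT]
    rw [this]
    exact hD.compl

open Classical in
theorem dropItem_congr {e e' : Elim n m} (h : e.Dominated = e'.Dominated) :
    e.dropItem = e'.dropItem :=
  congrArg (fun (P : Fin n → Fin n → Prop) (r : Fin n → Fin n) (d : Fin n) =>
    let D : Finset (Fin n) := (Finset.univ.image r).filter fun j => P d j
    if h : d ∈ Finset.univ.image r ∧ D.Nonempty then
      fun i => if r i = d then D.max' h.2 else r i
    else r) h

theorem measurable_update (β : ℕ → ℝ) : Measurable fun e : Elim n m => e.update β := by
  classical
  have hr := measurable_refresh (n := n) (m := m) β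
  have hlo : ∀ κ i, Measurable fun e : Elim n m => (e.refresh β).lo κ i := fun κ i =>
    (measurable_lo κ i).comp hr
  have hhi : ∀ κ i, Measurable fun e : Elim n m => (e.refresh β).hi κ i := fun κ i =>
    (measurable_hi κ i).comp hr
  refine measurable_of_parts ?_ (fun i k => measurable_total i k) hlo hhi
  -- The result of the eliminations is a function of discrete data.
  let G : Disc (Fin n → Fin n → Prop) → (Fin n → Fin n) → Fin n → Fin n := fun T ρ =>
    if h : ∃ e : Elim n m, e.Dominated = T.val then
      (List.finRange n).foldl h.choose.dropItem ρ else ρ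
  have hG : ∀ e : Elim n m, (e.update β).disc =
      ⟨((e.refresh β).count, G ⟨(e.refresh β).Dominated⟩ (e.refresh β).rep)⟩ := fun e => by
    have h : ∃ e' : Elim n m, e'.Dominated = (e.refresh β).Dominated := ⟨_, rfl⟩
    simp only [G, dif_pos h, dropItem_congr h.choose_spec]
    rfl
  simp only [hG]
  have hd : Measurable fun e : Elim n m =>
      (⟨(e.refresh β).Dominated⟩ : Disc (Fin n → Fin n → Prop)) := measurable_dominated.comp hr
  refine measurable_of_countable_cases hd (f := fun T (e : Elim n m) =>
    (⟨((e.refresh β).count, G T (e.refresh β).rep)⟩ :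
      Disc ((Fin n → Fin m → ℕ) × (Fin n → Fin n)))) fun T => ?_
  exact (Measurable.of_discrete (f := fun d : Disc ((Fin n → Fin m → ℕ) × (Fin n → Fin n)) =>
    (⟨(d.val.1, G T d.val.2)⟩ : Disc ((Fin n → Fin m → ℕ) × (Fin n → Fin n))))).comp
      (measurable_disc.comp hr)

theorem measurable_rep : Measurable fun e : Elim n m => (⟨e.rep⟩ : Disc (Fin n → Fin n)) :=
  (Measurable.of_discrete (f := fun d : Disc ((Fin n → Fin m → ℕ) × (Fin n → Fin n)) =>
    (⟨d.val.2⟩ : Disc (Fin n → Fin n)))).comp measurable_disc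

end Elim

namespace State

variable {N M : ℕ}

/-- The discrete data of a state, besides those of the two sides. -/
def disc (st : State N M) : Disc (Bool × ℕ × ℕ × ℕ × List (Fin N × Fin M) ×
    List (Fin N × Fin M) × Option (Fin N × Fin M)) :=
  ⟨(st.rowPhase, st.window, st.spent, st.round, st.todoRows, st.todoCols, st.result)⟩

noncomputable instance : MeasurableSpace (State N M) :=
  MeasurableSpace.comap (fun st => (st.disc, st.rows, st.cols)) inferInstance

variable {α : Type*} [MeasurableSpace α]

theorem measurable_disc : Measurable (disc : State N M → _) :=
  measurable_fst.comp (comap_measurable fun st : State N M => (st.disc, st.rows, st.cols))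

theorem measurable_rows : Measurable fun st : State N M => st.rows :=
  measurable_fst.comp (measurable_snd.comp
    (comap_measurable fun st : State N M => (st.disc, st.rows, st.cols)))

theorem measurable_cols : Measurable fun st : State N M => st.cols :=
  measurable_snd.comp (measurable_snd.comp
    (comap_measurable fun st : State N M => (st.disc, st.rows, st.cols)))

theorem measurable_of_parts {f : α → State N M} (hd : Measurable fun a => (f a).disc)
    (hr : Measurable fun a => (f a).rows) (hc : Measurable fun a => (f a).cols) : Measurable f :=
  measurable_comap_iff.2 (hd.prodMk (hr.prodMk hc))

/-- Any function of the discrete data is measurable. -/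
theorem measurable_of_disc {β : Type*} [MeasurableSpace β] {f : State N M → β}
    (g : Disc (Bool × ℕ × ℕ × ℕ × List (Fin N × Fin M) ×
      List (Fin N × Fin M) × Option (Fin N × Fin M)) → β) (h : ∀ st, f st = g st.disc) :
    Measurable f := by
  rw [show f = g ∘ disc from funext h]
  exact Measurable.of_discrete.comp measurable_disc

theorem measurable_colUpdate (δ : ℝ) :
    Measurable fun st : State N M => st.cols.update (st.colBeta δ) := by
  refine measurable_of_countable_cases measurable_disc (f := fun d (st : State N M) =>
    st.cols.update (if d.val.1 then windowBeta d.val.2.1 else sureBeta N M δ)) fun d => ?_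
  exact (Elim.measurable_update _).comp measurable_cols

theorem measurable_beginRound (δ : ℝ) :
    Measurable fun z : (ℕ → Fin N × Fin M) × State N M => beginRound δ z.1 z.2 := by
  have hrows : Measurable fun z : (ℕ → Fin N × Fin M) × State N M =>
      z.2.rows.update (sureBeta N M δ) :=
    (Elim.measurable_update _).comp (measurable_rows.comp measurable_snd)
  have hcols : Measurable fun z : (ℕ → Fin N × Fin M) × State N M =>
      z.2.cols.update (z.2.colBeta δ) := (measurable_colUpdate δ).comp measurable_snd
  refine measurable_of_parts ?_ hrows hcols
  have hpick : Measurable fun z : (ℕ → Fin N × Fin M) × State N M => z.1 z.2.round :=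
    measurable_of_countable_cases (measurable_disc.comp measurable_snd)
      (f := fun d (z : (ℕ → Fin N × Fin M) × State N M) => z.1 d.val.2.2.2.1) fun d =>
        (measurable_pi_apply _).comp measurable_fst
  refine measurable_of_countable_cases (measurable_disc.comp measurable_snd)
    (f := fun d (z : (ℕ → Fin N × Fin M) × State N M) => (⟨(d.val.1, d.val.2.1, d.val.2.2.1,
      d.val.2.2.2.1 + 1, (beginRound δ z.1 z.2).todoRows, (beginRound δ z.1 z.2).todoCols,
      d.val.2.2.2.2.2.2)⟩ : Disc (Bool × ℕ × ℕ × ℕ × List (Fin N × Fin M) ×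
        List (Fin N × Fin M) × Option (Fin N × Fin M)))) fun d => ?_
  refine measurable_of_countable_cases (Elim.measurable_rep.comp hrows)
    (f := fun ρ (z : (ℕ → Fin N × Fin M) × State N M) => (⟨(d.val.1, d.val.2.1, d.val.2.2.1,
      d.val.2.2.2.1 + 1,
      (((List.finRange N).filter fun a => a ∈ Finset.univ.image ρ.val).map fun a =>
        (a, (z.2.cols.update (z.2.colBeta δ)).rep (z.1 z.2.round).2)),
      (((List.finRange M).filter fun b =>
        b ∈ (z.2.cols.update (z.2.colBeta δ)).active).map fun b => (ρ.val (z.1 z.2.round).1, b)),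
      d.val.2.2.2.2.2.2)⟩ : Disc (Bool × ℕ × ℕ × ℕ × List (Fin N × Fin M) ×
        List (Fin N × Fin M) × Option (Fin N × Fin M)))) fun ρ => ?_
  refine measurable_of_countable_cases (Elim.measurable_rep.comp hcols)
    (f := fun σ (z : (ℕ → Fin N × Fin M) × State N M) => (⟨(d.val.1, d.val.2.1, d.val.2.2.1,
      d.val.2.2.2.1 + 1,
      (((List.finRange N).filter fun a => a ∈ Finset.univ.image ρ.val).map fun a =>
        (a, σ.val (z.1 z.2.round).2)),
      (((List.finRange M).filter fun b =>
        b ∈ Finset.univ.image σ.val).map fun b => (ρ.val (z.1 z.2.round).1, b)),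
      d.val.2.2.2.2.2.2)⟩ : Disc (Bool × ℕ × ℕ × ℕ × List (Fin N × Fin M) ×
        List (Fin N × Fin M) × Option (Fin N × Fin M)))) fun σ => ?_
  exact measurable_of_countable_cases hpick
    (f := fun p (_ : (ℕ → Fin N × Fin M) × State N M) => (⟨(d.val.1, d.val.2.1, d.val.2.2.1,
      d.val.2.2.2.1 + 1,
      (((List.finRange N).filter fun a => a ∈ Finset.univ.image ρ.val).map fun a =>
        (a, σ.val p.2)),
      (((List.finRange M).filter fun b =>
        b ∈ Finset.univ.image σ.val).map fun b => (ρ.val p.1, b)),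
      d.val.2.2.2.2.2.2)⟩ : Disc (Bool × ℕ × ℕ × ℕ × List (Fin N × Fin M) ×
        List (Fin N × Fin M) × Option (Fin N × Fin M)))) fun p => measurable_const

theorem measurable_receive : Measurable fun z : ℝ × State N M => receive z.1 z.2 := by
  have hd : Measurable fun z : ℝ × State N M => z.2.disc := measurable_disc.comp measurable_snd
  have hr : Measurable fun z : ℝ × State N M => z.2.rows := measurable_rows.comp measurable_snd
  have hc : Measurable fun z : ℝ × State N M => z.2.cols := measurable_cols.comp measurable_snd
  refine measurable_of_countable_cases hd (f := fun d (z : ℝ × State N M) =>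
    match d.val.2.2.2.2.1, d.val.2.2.2.2.2.1 with
    | p :: L, _ =>
      { z.2 with rows := z.2.rows.record p.1 p.2 z.1, spent := z.2.spent + 1, todoRows := L }
    | [], p :: L =>
      { z.2 with cols := z.2.cols.record p.2 p.1 z.1, spent := z.2.spent + 1, todoCols := L }
    | [], [] => z.2) fun d => ?_
  rcases h1 : d.val.2.2.2.2.1 with _ | ⟨p, L⟩
  · rcases h2 : d.val.2.2.2.2.2.1 with _ | ⟨p, L⟩
    · exact measurable_snd
    · refine measurable_of_parts ?_ hr ((Elim.measurable_record p.2 p.1).comp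
        (hc.prodMk measurable_fst))
      exact (measurable_of_disc (f := fun st : State N M =>
        disc { st with spent := st.spent + 1, todoCols := L }) (fun d => ⟨(d.val.1, d.val.2.1,
          d.val.2.2.1 + 1, d.val.2.2.2.1, d.val.2.2.2.2.1, L, d.val.2.2.2.2.2.2)⟩)
          fun st => rfl).comp measurable_snd
  · refine measurable_of_parts ?_ ((Elim.measurable_record p.1 p.2).comp
      (hr.prodMk measurable_fst)) hc
    exact (measurable_of_disc (f := fun st : State N M =>
      disc { st with spent := st.spent + 1, todoRows := L }) (fun d => ⟨(d.val.1, d.val.2.1,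
        d.val.2.2.1 + 1, d.val.2.2.2.1, L, d.val.2.2.2.2.2)⟩) fun st => rfl).comp measurable_snd

variable [NeZero N] [NeZero M]

theorem measurable_endRound : Measurable (endRound : State N M → State N M) := by
  have hrr : Measurable fun st : State N M => (⟨st.rows.rep⟩ : Disc (Fin N → Fin N)) :=
    Elim.measurable_rep.comp measurable_rows
  have hcr : Measurable fun st : State N M => (⟨st.cols.rep⟩ : Disc (Fin M → Fin M)) :=
    Elim.measurable_rep.comp measurable_cols
  refine measurable_of_countable_cases (measurable_disc.prodMk (hrr.prodMk hcr))
    (f := fun d (st : State N M) =>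
      if d.1.val.1 then
        if (Finset.univ.image d.2.1.val).card = 1 then
          { st with rowPhase := false, cols := Elim.fresh M N }
        else if 2 ^ (2 ^ d.1.val.2.1) < d.1.val.2.2.1 then
          { st with window := st.window + 1, spent := 0, cols := Elim.fresh M N }
        else st
      else if (Finset.univ.image d.2.2.val).card = 1 then
        { st with result := some (d.2.1.val 0, d.2.2.val 0) }
      else st) fun d => ?_
  split_ifs
  · exact measurable_of_parts (measurable_of_disc (fun d => ⟨(false, d.val.2)⟩) fun st => rfl)
      measurable_rows measurable_const
  · exact measurable_of_parts (measurable_of_disc (fun d => ⟨(d.val.1, d.val.2.1 + 1, 0,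
      d.val.2.2.2)⟩) fun st => rfl) measurable_rows measurable_const
  · exact measurable_id
  · exact measurable_of_parts (measurable_of_disc (fun d' => ⟨(d'.val.1, d'.val.2.1, d'.val.2.2.1,
      d'.val.2.2.2.1, d'.val.2.2.2.2.1, d'.val.2.2.2.2.2.1, some (d.2.1.val 0, d.2.2.val 0))⟩)
      fun st => rfl) measurable_rows measurable_cols
  · exact measurable_id

theorem measurable_observe (δ : ℝ) :
    Measurable fun z : (ℕ → Fin N × Fin M) × ℝ × State N M => observe δ z.1 z.2.1 z.2.2 := by
  have h1 : Measurable fun z : (ℕ → Fin N × Fin M) × ℝ × State N M => receive z.2.1 z.2.2 :=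
    measurable_receive.comp measurable_snd
  have h2 : Measurable fun z : (ℕ → Fin N × Fin M) × ℝ × State N M =>
      (receive z.2.1 z.2.2).endRound := measurable_endRound.comp h1
  have h3 : Measurable fun z : (ℕ → Fin N × Fin M) × ℝ × State N M =>
      beginRound δ z.1 (receive z.2.1 z.2.2).endRound :=
    (measurable_beginRound δ).comp (measurable_fst.prodMk h2)
  refine Measurable.ite ?_ (Measurable.ite ?_ h3 h2) h1
  · exact (measurable_of_disc (f := fun st : State N M => (⟨(st.todoRows, st.todoCols)⟩ :
      Disc (List (Fin N × Fin M) × List (Fin N × Fin M))))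
      (fun d => ⟨(d.val.2.2.2.2.1, d.val.2.2.2.2.2.1)⟩) fun st => rfl).comp h1
      (MeasurableSet.of_discrete (s := {d | d.val.1 = [] ∧ d.val.2 = []}))
  · exact (measurable_of_disc (f := fun st : State N M => (⟨st.result⟩ :
      Disc (Option (Fin N × Fin M)))) (fun d => ⟨d.val.2.2.2.2.2.2⟩) fun st => rfl).comp h2
      (MeasurableSet.of_discrete (s := {d | d.val = none}))

theorem listMeasurable_after (δ : ℝ) :
    ListMeasurable (after δ : (ℕ → Fin N × Fin M) → List ℝ → State N M) := by
  refine ListMeasurable.of_cons ?_ fun n ih => ?_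
  · exact (measurable_beginRound δ).comp (measurable_id.prodMk measurable_const)
  · exact (measurable_observe δ).comp ((measurable_fst.comp measurable_fst).prodMk
      ((measurable_snd.comp measurable_fst).prodMk
        (ih.comp ((measurable_fst.comp measurable_fst).prodMk measurable_snd))))

end State

theorem pairElim_isMeasurable (N M : ℕ) [NeZero N] [NeZero M] (δ : ℝ) :
    (pairElim N M δ).IsMeasurable := fun n => by
  have h : Measurable (State.next : State N M → Action N M) :=
    State.measurable_of_disc (fun d => match d.val.2.2.2.2.2.2 with
      | some p => Sum.inr p
      | none => match d.val.2.2.2.2.1 ++ d.val.2.2.2.2.2.1 with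
        | p :: _ => Sum.inl p
        | [] => Sum.inr (0, 0)) fun st => rfl
  exact h.comp (State.listMeasurable_after δ n)

/-! ### A maximal inequality for the noise of a tracked parameter -/

namespace Algorithm

variable {N M : ℕ} {A : Algorithm N M}

/-- The evolution along a run of the number `cnt` of samples of a tracked parameter and of the sum
`dv` of their noises. Both restart from zero when the epoch `ep` increases. -/
structure NoisePath (A : Algorithm N M) (F : Fin N × Fin M × ℕ → Measure ℝ)
    (ep : A.Seed → List ℝ → ℕ∞) (cnt : A.Seed → List ℝ → ℕ) (dv : A.Seed → List ℝ → ℝ) :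
    Prop where
  start : ∀ s, cnt s [] = 0 ∧ dv s [] = 0
  step : ∀ s L p, A.action s L = Sum.inl p →
    (∃ w, ep s L < w ∧ ∀ y, ep s (y :: L) = w ∧ cnt s (y :: L) = 0 ∧ dv s (y :: L) = 0) ∨
    (∀ y, ep s (y :: L) = ep s L ∧ cnt s (y :: L) = cnt s L ∧ dv s (y :: L) = dv s L) ∨
    ∃ m, (∀ t, HasSubgaussianMGF (fun y => y - m) (1 / 4 : ℝ≥0) (F (p.1, p.2, t))) ∧
      ∀ y, ep s (y :: L) = ep s L ∧ cnt s (y :: L) = cnt s L + 1 ∧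
        dv s (y :: L) = dv s L + (y - m)
  measurable_ep : ListMeasurable ep
  measurable_cnt : ListMeasurable cnt
  measurable_dv : ListMeasurable dv

namespace NoisePath

variable {F : Fin N × Fin M × ℕ → Measure ℝ} {ep : A.Seed → List ℝ → ℕ∞}
  {cnt : A.Seed → List ℝ → ℕ} {dv : A.Seed → List ℝ → ℝ}

/-- The exponential supermartingale of the epoch `e`, killed after `k` samples. -/
noncomputable def expWeight (ep : A.Seed → List ℝ → ℕ∞) (cnt : A.Seed → List ℝ → ℕ)
    (dv : A.Seed → List ℝ → ℝ) (e : ℕ∞) (k : ℕ) (lam : ℝ) (s : A.Seed) (L : List ℝ) : ℝ≥0∞ :=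
  if ep s L < e then 1
  else if ep s L = e ∧ cnt s L ≤ k then
    ENNReal.ofReal (Real.exp (lam * dv s L - lam ^ 2 / 8 * cnt s L))
  else 0

/-- After one of the past rewards, the parameter had exactly `k` samples in the epoch `e` and the
weight was at least `C`. -/
def Hit (ep : A.Seed → List ℝ → ℕ∞) (cnt : A.Seed → List ℝ → ℕ)
    (dv : A.Seed → List ℝ → ℝ) (e : ℕ∞) (k : ℕ) (lam : ℝ) (C : ℝ≥0∞) (s : A.Seed) :
    List ℝ → Prop
  | [] => ep s [] = e ∧ cnt s [] = k ∧ C ≤ expWeight ep cnt dv e k lam s []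
  | y :: L => (ep s (y :: L) = e ∧ cnt s (y :: L) = k ∧ C ≤ expWeight ep cnt dv e k lam s (y :: L))
      ∨ Hit ep cnt dv e k lam C s L

theorem Hit.of_self {e : ℕ∞} {k : ℕ} {lam : ℝ} {C : ℝ≥0∞} {s : A.Seed} {L : List ℝ}
    (h : ep s L = e ∧ cnt s L = k ∧ C ≤ expWeight ep cnt dv e k lam s L) :
    Hit ep cnt dv e k lam C s L := by
  cases L with
  | nil => exact h
  | cons y L => exact Or.inl h

theorem Hit.mono {e : ℕ∞} {k : ℕ} {lam : ℝ} {C : ℝ≥0∞} {s : A.Seed} {L L' : List ℝ}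
    (hL : L <:+ L') (h : Hit ep cnt dv e k lam C s L) : Hit ep cnt dv e k lam C s L' := by
  obtain ⟨t, rfl⟩ := hL
  induction t with
  | nil => exact h
  | cons y t ih => exact Or.inr ih

theorem listMeasurable_expWeight (h : A.NoisePath F ep cnt dv) (e : ℕ∞) (k : ℕ) (lam : ℝ) :
    ListMeasurable (expWeight ep cnt dv e k lam) := fun n => by
  have h1 := h.measurable_ep n
  have h2 := h.measurable_cnt n
  have h3 := h.measurable_dv n
  have h2' := (measurable_from_top (f := fun k : ℕ => (k : ℝ))).comp h2
  simp only [Function.comp_def] at h2'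
  refine Measurable.ite (h1 (Set.to_countable (Set.Iio e)).measurableSet) measurable_const
    (Measurable.ite ?_ ?_ measurable_const)
  · exact (h1 (measurableSet_singleton e)).inter (h2 (measurableSet_Iic (a := k)))
  · exact ENNReal.measurable_ofReal.comp (Real.measurable_exp.comp
      ((measurable_const.mul h3).sub (measurable_const.mul h2')))

theorem listMeasurable_hit (h : A.NoisePath F ep cnt dv) (e : ℕ∞) (k : ℕ) (lam : ℝ) (C : ℝ≥0∞) :
    ListMeasurable (Hit ep cnt dv e k lam C) := by
  have key : ListMeasurable fun s L =>
      ep s L = e ∧ cnt s L = k ∧ C ≤ expWeight ep cnt dv e k lam s L := fun n =>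
    measurableSet_setOfPred.1 ((h.measurable_ep n (measurableSet_singleton e)).inter
      ((h.measurable_cnt n (measurableSet_singleton k)).inter
        (h.listMeasurable_expWeight e k lam n (measurableSet_Ici (a := C)))))
  refine ListMeasurable.of_cons key.nil fun n ih => ?_
  have h1 := key.cons n
  have h2 : Measurable fun p : (A.Seed × ℝ) × (Fin n → ℝ) =>
      Hit ep cnt dv e k lam C p.1.1 (List.ofFn p.2) :=
    ih.comp ((measurable_fst.comp measurable_fst).prodMk measurable_snd)
  exact h1.or h2

/-- The weight is a supermartingale. -/
theorem stepMean_expWeight_le [∀ q, IsProbabilityMeasure (F q)] (h : A.NoisePath F ep cnt dv)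
    (e : ℕ∞) (k : ℕ) (lam : ℝ) (s : A.Seed) (L : List ℝ) :
    A.stepMean F (expWeight ep cnt dv e k lam) s L ≤ expWeight ep cnt dv e k lam s L := by
  unfold stepMean
  rcases ha : A.action s L with p | p
  · simp only
    rcases h.step s L p ha with ⟨w, hw, hy⟩ | hy | ⟨m, hm, hy⟩
    · have h1 : ∀ y, expWeight ep cnt dv e k lam s (y :: L) ≤ expWeight ep cnt dv e k lam s L := by
        intro y
        obtain ⟨e1, e2, e3⟩ := hy y
        simp only [expWeight, e1, e2, e3]
        by_cases hwe : w ≤ e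
        · rw [if_pos (hw.trans_le hwe)]
          split_ifs <;> simp
        · rw [if_neg fun h => hwe h.le, if_neg fun h => hwe h.1.le]
          exact zero_le
      exact (lintegral_mono h1).trans (by simp)
    · have h1 : ∀ y, expWeight ep cnt dv e k lam s (y :: L) = expWeight ep cnt dv e k lam s L := by
        intro y
        obtain ⟨e1, e2, e3⟩ := hy y
        simp only [expWeight, e1, e2, e3]
      simp [h1]
    · by_cases hlt : ep s L < e
      · have h1 : ∀ y, expWeight ep cnt dv e k lam s (y :: L) = 1 := fun y => by
          rw [expWeight, if_pos (by rw [(hy y).1]; exact hlt)]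
        rw [lintegral_congr h1]
        simp [expWeight, hlt]
      · by_cases hc : ep s L = e ∧ cnt s L ≤ k
        · rw [expWeight, if_neg hlt, if_pos hc]
          have h1 : ∀ y, expWeight ep cnt dv e k lam s (y :: L) ≤
              ENNReal.ofReal (Real.exp (lam * dv s L - lam ^ 2 / 8 * (cnt s L + 1)) *
                Real.exp (lam * (y - m))) := by
            intro y
            obtain ⟨e1, e2, e3⟩ := hy y
            rw [expWeight, if_neg (by rw [e1]; exact hlt)]
            split_ifs
            · rw [e2, e3, ← Real.exp_add]
              refine le_of_eq (congrArg _ (congrArg _ ?_))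
              push_cast
              ring
            · exact zero_le
          refine (lintegral_mono h1).trans ?_
          have hi := (hm L.length).integrable_exp_mul lam
          rw [← ofReal_integral_eq_lintegral_ofReal (hi.const_mul _)
            (Filter.Eventually.of_forall fun y => by positivity), integral_const_mul]
          refine ENNReal.ofReal_le_ofReal ?_
          have h2 := (hm L.length).mgf_le lam
          rw [mgf] at h2
          refine (mul_le_mul_of_nonneg_left h2 (Real.exp_pos _).le).trans (le_of_eq ?_)
          rw [← Real.exp_add]
          congr 1
          push_cast
          ring
        · have h1 : ∀ y, expWeight ep cnt dv e k lam s (y :: L) = 0 := by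
            intro y
            obtain ⟨e1, e2, e3⟩ := hy y
            rw [expWeight, if_neg (by rw [e1]; exact hlt), if_neg]
            rw [e1, e2]
            exact fun h => hc ⟨h.1, by omega⟩
          simp [h1]
  · exact le_rfl

open Classical in
/-- The supermartingale stopped when it is at least `C` with `k` samples in the epoch `e`. -/
noncomputable def stopped (ep : A.Seed → List ℝ → ℕ∞) (cnt : A.Seed → List ℝ → ℕ)
    (dv : A.Seed → List ℝ → ℝ) (e : ℕ∞) (k : ℕ) (lam : ℝ) (C : ℝ≥0∞) (s : A.Seed) (L : List ℝ) :
    ℝ≥0∞ :=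
  if Hit ep cnt dv e k lam C s L then C else expWeight ep cnt dv e k lam s L

theorem listMeasurable_stopped (h : A.NoisePath F ep cnt dv) (e : ℕ∞) (k : ℕ) (lam : ℝ)
    (C : ℝ≥0∞) : ListMeasurable (stopped ep cnt dv e k lam C) := fun n =>
  Measurable.ite (measurableSet_setOfPred.2 (h.listMeasurable_hit e k lam C n)) measurable_const
    (h.listMeasurable_expWeight e k lam n)

theorem stepMean_stopped_le [∀ q, IsProbabilityMeasure (F q)] (h : A.NoisePath F ep cnt dv)
    (e : ℕ∞) (k : ℕ) (lam : ℝ) (C : ℝ≥0∞) (s : A.Seed) (L : List ℝ) :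
    A.stepMean F (stopped ep cnt dv e k lam C) s L ≤ stopped ep cnt dv e k lam C s L := by
  by_cases hL : Hit ep cnt dv e k lam C s L
  · have h1 : ∀ y, stopped ep cnt dv e k lam C s (y :: L) = C := fun y =>
      if_pos (hL.mono (List.suffix_cons y L))
    rw [stepMean]
    split
    · rw [lintegral_congr h1]
      simp [stopped, hL]
    · exact le_rfl
  · have h1 : ∀ y, stopped ep cnt dv e k lam C s (y :: L) ≤
        expWeight ep cnt dv e k lam s (y :: L) := by
      intro y
      rw [stopped]
      split_ifs with hy
      · exact (hy.resolve_right hL).2.2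
      · exact le_rfl
    have h2 : stopped ep cnt dv e k lam C s L = expWeight ep cnt dv e k lam s L := if_neg hL
    rw [h2]
    refine le_trans ?_ (h.stepMean_expWeight_le e k lam s L)
    unfold stepMean
    split
    · exact lintegral_mono fun y => h1 y
    · exact h2.le

theorem lintegral_stopped_le [∀ q, IsProbabilityMeasure (F q)] (h : A.NoisePath F ep cnt dv)
    (hA : A.IsMeasurable) (e : ℕ∞) (k : ℕ) (lam : ℝ) (C : ℝ≥0∞) (t : ℕ) :
    ∫⁻ q, stopped ep cnt dv e k lam C q.2 (A.history q.1 q.2 t)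
      ∂A.runLaw (Measure.infinitePi F) ≤ 1 := by
  induction t with
  | zero =>
    have : ∀ s, stopped ep cnt dv e k lam C s [] ≤ 1 := by
      intro s
      have h1 : expWeight ep cnt dv e k lam s [] ≤ 1 := by
        rw [expWeight, (h.start s).1, (h.start s).2]
        split_ifs <;> simp
      rw [stopped]
      split_ifs with hs
      · exact hs.2.2.trans h1
      · exact h1
    have hp : IsProbabilityMeasure (A.runLaw (Measure.infinitePi F)) := by
      unfold runLaw; infer_instance
    calc _ ≤ ∫⁻ _, 1 ∂A.runLaw (Measure.infinitePi F) := lintegral_mono fun q => this q.2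
      _ = 1 := by simp
  | succ t ih =>
    rw [lintegral_history_succ hA F (h.listMeasurable_stopped e k lam C)]
    exact (lintegral_mono fun q => h.stepMean_stopped_le e k lam C _ _).trans ih

/-- A maximal inequality: it controls the noise at the time when the parameter reaches `k` samples
in the epoch `e`. -/
theorem measure_exists_le [∀ q, IsProbabilityMeasure (F q)] (h : A.NoisePath F ep cnt dv)
    (hA : A.IsMeasurable) (e : ℕ∞) (k : ℕ) (lam a : ℝ) :
    A.runLaw (Measure.infinitePi F) {q | ∃ t, ep q.2 (A.history q.1 q.2 t) = e ∧
      cnt q.2 (A.history q.1 q.2 t) = k ∧ a + lam ^ 2 / 8 * k ≤ lam * dv q.2 (A.history q.1 q.2 t)}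
      ≤ ENNReal.ofReal (Real.exp (-a)) := by
  set C := ENNReal.ofReal (Real.exp a) with hC
  have hC0 : C ≠ 0 := by simp [hC, Real.exp_pos]
  have hinv : C⁻¹ = ENNReal.ofReal (Real.exp (-a)) := by
    rw [hC, ← ENNReal.ofReal_inv_of_pos (Real.exp_pos a), Real.exp_neg]
  have hsub : {q : RewardTable N M × A.Seed | ∃ t, ep q.2 (A.history q.1 q.2 t) = e ∧
      cnt q.2 (A.history q.1 q.2 t) = k ∧
      a + lam ^ 2 / 8 * k ≤ lam * dv q.2 (A.history q.1 q.2 t)} ⊆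
      ⋃ t, {q | Hit ep cnt dv e k lam C q.2 (A.history q.1 q.2 t)} := by
    rintro q ⟨t, h1, h2, h3⟩
    refine Set.mem_iUnion.2 ⟨t, Hit.of_self ⟨h1, h2, ?_⟩⟩
    rw [expWeight, if_neg (by rw [h1]; exact lt_irrefl _), if_pos ⟨h1, h2.le⟩, h2]
    refine ENNReal.ofReal_le_ofReal (Real.exp_le_exp.2 ?_)
    linarith
  refine (measure_mono hsub).trans ?_
  have hmono : Monotone fun t => {q : RewardTable N M × A.Seed |
      Hit ep cnt dv e k lam C q.2 (A.history q.1 q.2 t)} := fun t t' ht q hq =>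
    Hit.mono (A.history_suffix q.1 q.2 ht) hq
  rw [hmono.measure_iUnion, ← hinv]
  refine iSup_le fun t => ?_
  have h1 := mul_meas_ge_le_lintegral₀ (μ := A.runLaw (Measure.infinitePi F))
    (measurable_seed_history hA t (h.listMeasurable_stopped e k lam C)).aemeasurable C
  have h2 : A.runLaw (Measure.infinitePi F)
      {q | Hit ep cnt dv e k lam C q.2 (A.history q.1 q.2 t)} ≤
      A.runLaw (Measure.infinitePi F)
        {q | C ≤ stopped ep cnt dv e k lam C q.2 (A.history q.1 q.2 t)} :=
    measure_mono fun q hq => (if_pos hq : stopped ep cnt dv e k lam C _ _ = C).ge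
  rw [ENNReal.le_inv_iff_mul_le, mul_comm]
  exact (mul_le_mul_right h2 C).trans (h1.trans (h.lintegral_stopped_le hA e k lam C t))

/-- Upper deviations: the maximal inequality at the optimal `lam = 4 * c / k`. -/
theorem measure_exists_dev_ge [∀ q, IsProbabilityMeasure (F q)] (h : A.NoisePath F ep cnt dv)
    (hA : A.IsMeasurable) (e : ℕ∞) {k : ℕ} (hk : 0 < k) {c : ℝ} (hc : 0 ≤ c) :
    A.runLaw (Measure.infinitePi F) {q | ∃ t, ep q.2 (A.history q.1 q.2 t) = e ∧
      cnt q.2 (A.history q.1 q.2 t) = k ∧ c ≤ dv q.2 (A.history q.1 q.2 t)} ≤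
      ENNReal.ofReal (Real.exp (-(2 * c ^ 2 / k))) := by
  refine (measure_mono ?_).trans (h.measure_exists_le hA e k (4 * c / k) _)
  rintro q ⟨t, h1, h2, h3⟩
  have hk' : (0 : ℝ) < k := by exact_mod_cast hk
  refine ⟨t, h1, h2, ?_⟩
  calc _ = 4 * c / k * c := by field_simp; ring
    _ ≤ _ := by gcongr

/-- Lower deviations, from the exponent `lam = -(4 * c / k)`. -/
theorem measure_exists_dev_le [∀ q, IsProbabilityMeasure (F q)] (h : A.NoisePath F ep cnt dv)
    (hA : A.IsMeasurable) (e : ℕ∞) {k : ℕ} (hk : 0 < k) {c : ℝ} (hc : 0 ≤ c) :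
    A.runLaw (Measure.infinitePi F) {q | ∃ t, ep q.2 (A.history q.1 q.2 t) = e ∧
      cnt q.2 (A.history q.1 q.2 t) = k ∧ dv q.2 (A.history q.1 q.2 t) ≤ -c} ≤
      ENNReal.ofReal (Real.exp (-(2 * c ^ 2 / k))) := by
  refine (measure_mono ?_).trans (h.measure_exists_le hA e k (-(4 * c / k)) _)
  rintro q ⟨t, h1, h2, h3⟩
  have hk' : (0 : ℝ) < k := by exact_mod_cast hk
  refine ⟨t, h1, h2, ?_⟩
  have h4 : 0 ≤ 4 * c / k := by positivity
  calc _ = 4 * c / k * c := by field_simp; ring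
    _ ≤ _ := by nlinarith

end NoisePath
end Algorithm

/-! ### The noises of Pair-Elim -/

namespace State

theorem measurable_colEpoch (N M : ℕ) : Measurable fun st : State N M => st.colEpoch :=
  measurable_of_disc (fun d => if d.val.1 then (d.val.2.1 : ℕ∞) else ⊤) fun _ => rfl

variable {N M : ℕ} [NeZero N] [NeZero M]

theorem next_eq_inl {st : State N M} {p : Fin N × Fin M} (h : st.next = Sum.inl p) :
    st.result = none ∧ ((∃ l, st.todoRows = p :: l) ∨ st.todoRows = [] ∧ ∃ l, st.todoCols = p :: l) := by
  unfold next at h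
  rcases hr : st.result with _ | q
  · refine ⟨rfl, ?_⟩
    simp only [hr] at h
    rcases hR : st.todoRows with _ | ⟨p', l⟩
    · rcases hC : st.todoCols with _ | ⟨p', l⟩
      · simp [hR, hC] at h
      · simp only [hR, hC, List.nil_append, Sum.inl.injEq] at h
        exact Or.inr ⟨rfl, l, by rw [h]⟩
    · simp only [hR, List.cons_append, Sum.inl.injEq] at h
      exact Or.inl ⟨l, by rw [h]⟩
  · simp [hr] at h

variable {u : Fin N → ℝ} {v : Fin M → ℝ} {F : Fin N × Fin M × ℕ → Measure ℝ}

theorem noisePath_rows (δ : ℝ) (hF : IsSubgaussianModel u v F) (κ : Option (Fin M)) (i : Fin N) :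
    (pairElim N M δ).NoisePath F (fun ξ L => (after δ ξ L).rowView.epoch)
      (fun ξ L => (after δ ξ L).rows.num κ i)
      (fun ξ L => (after δ ξ L).rows.dev (fun a k => u a * v k) κ i) where
  start ξ := by simp [after, beginRound, init]
  step ξ L p hp := by
    refine Or.inr ?_
    obtain ⟨hr, ⟨l, hl⟩ | ⟨hl, -⟩⟩ := next_eq_inl hp
    · by_cases hT : Elim.Tracks κ i p
      · refine Or.inr ⟨u p.1 * v p.2, fun t => hF p.1 p.2 t, fun y => ?_⟩
        have hs := after_step δ ξ y L
        generalize after δ ξ (y :: L) = st' at *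
        generalize newRound δ ξ y L = r at *
        cases hs with
        | row p' l' h hr =>
          obtain ⟨rfl, rfl⟩ := List.cons.inj (hl.symm.trans h)
          exact ⟨rfl, by simp [Elim.num_record, hT], by simp [Elim.dev_record, hT]⟩
        | stopped h => exact absurd hr h
        | _ => simp_all
      · refine Or.inl fun y => ?_
        have hs := after_step δ ξ y L
        generalize after δ ξ (y :: L) = st' at *
        generalize newRound δ ξ y L = r at *
        cases hs with
        | row p' l' h hr =>
          obtain ⟨rfl, rfl⟩ := List.cons.inj (hl.symm.trans h)
          exact ⟨rfl, by simp [Elim.num_record, hT], by simp [Elim.dev_record, hT]⟩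
        | stopped h => exact absurd hr h
        | _ => simp_all
    · refine Or.inl fun y => ?_
      have hs := after_step δ ξ y L
      generalize after δ ξ (y :: L) = st' at *
      generalize newRound δ ξ y L = r at *
      cases hs with
      | stopped h => exact absurd hr h
      | row p' l' h hr => simp [hl] at h
      | _ => simp [rowView, beginRound, lastCol]
  measurable_ep := fun n => measurable_const
  measurable_cnt := (listMeasurable_after δ).comp ((Elim.measurable_num κ i).comp measurable_rows)
  measurable_dv := (listMeasurable_after δ).comp ((Elim.measurable_dev _ κ i).comp measurable_rows)

theorem noisePath_cols (δ : ℝ) (hF : IsSubgaussianModel u v F) (κ : Option (Fin N)) (i : Fin M) :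
    (pairElim N M δ).NoisePath F (fun ξ L => (after δ ξ L).colView.epoch)
      (fun ξ L => (after δ ξ L).cols.num κ i)
      (fun ξ L => (after δ ξ L).cols.dev (fun b a => u a * v b) κ i) where
  start ξ := by simp [after, beginRound, init]
  step ξ L p hp := by
    obtain ⟨hr, ⟨l, hl⟩ | ⟨hl, l, hC⟩⟩ := next_eq_inl hp
    · refine Or.inr (Or.inl fun y => ?_)
      have hs := after_step δ ξ y L
      generalize after δ ξ (y :: L) = st' at *
      generalize newRound δ ξ y L = r at *
      cases hs with
      | stopped h => exact absurd hr h
      | row p' l' h hr => simp [colView, colEpoch]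
      | _ => simp_all
    · by_cases hreset : l = [] ∧ (after δ ξ L).rowPhase = true ∧
          ((after δ ξ L).rows.active.card = 1 ∨
            2 ^ (2 ^ (after δ ξ L).window) < (after δ ξ L).spent + 1)
      · left
        obtain ⟨rfl, hph, hres⟩ := hreset
        by_cases hc : (after δ ξ L).rows.active.card = 1
        · refine ⟨⊤, by simp [colView, colEpoch, hph], fun y => ?_⟩
          have hs := after_step δ ξ y L
          generalize after δ ξ (y :: L) = st' at *
          generalize newRound δ ξ y L = r at *
          cases hs with
          | stopped h => exact absurd hr h
          | detect p' _ _ _ _ _ => simp [beginRound, colView, colEpoch]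
          | _ => simp_all
        · refine ⟨((after δ ξ L).window + 1 : ℕ), by
            simp only [colView, colEpoch, hph, if_true]
            exact_mod_cast Nat.lt_succ_self _, fun y => ?_⟩
          have hs := after_step δ ξ y L
          generalize after δ ξ (y :: L) = st' at *
          generalize newRound δ ξ y L = r at *
          cases hs with
          | stopped h => exact absurd hr h
          | window p' _ _ _ _ _ => simp [beginRound, colView, colEpoch, lastCol, hph]
          | _ => simp_all
      · right
        have key : ∀ y, (after δ ξ (y :: L)).colView.epoch = (after δ ξ L).colView.epoch ∧
            (after δ ξ (y :: L)).cols.num κ i = ((after δ ξ L).cols.record p.2 p.1 y).num κ i ∧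
            (after δ ξ (y :: L)).cols.dev (fun b a => u a * v b) κ i =
              ((after δ ξ L).cols.record p.2 p.1 y).dev (fun b a => u a * v b) κ i := by
          intro y
          have hs := after_step δ ξ y L
          generalize after δ ξ (y :: L) = st' at *
          generalize newRound δ ξ y L = r at *
          cases hs with
          | stopped h => exact absurd hr h
          | row p' l' h hr => simp [hl] at h
          | col p' q l' _ h' _ =>
            obtain ⟨rfl, -⟩ := List.cons.inj (hC.symm.trans h')
            exact ⟨rfl, rfl, rfl⟩
          | detect p' _ h' _ h1 h2 =>
            obtain ⟨rfl, h3⟩ := List.cons.inj (hC.symm.trans h')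
            exact absurd ⟨h3, h1, Or.inl h2⟩ hreset
          | window p' _ h' _ h1 h2 h4 =>
            obtain ⟨rfl, h3⟩ := List.cons.inj (hC.symm.trans h')
            exact absurd ⟨h3, h1, Or.inr h4⟩ hreset
          | round p' _ h' _ _ _ =>
            obtain ⟨rfl, -⟩ := List.cons.inj (hC.symm.trans h')
            exact ⟨rfl, by simp [beginRound, lastCol], by simp [beginRound, lastCol]⟩
          | final p' _ h' _ _ _ =>
            obtain ⟨rfl, -⟩ := List.cons.inj (hC.symm.trans h')
            exact ⟨rfl, rfl, rfl⟩
          | late p' _ h' _ _ _ =>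
            obtain ⟨rfl, -⟩ := List.cons.inj (hC.symm.trans h')
            exact ⟨rfl, by simp [beginRound, lastCol], by simp [beginRound, lastCol]⟩
        by_cases hT : Elim.Tracks κ i p.swap
        · refine Or.inr ⟨u p.1 * v p.2, fun t => hF p.1 p.2 t, fun y => ?_⟩
          obtain ⟨h1, h2, h3⟩ := key y
          have n1 := Elim.num_record (after δ ξ L).cols p.swap y κ i
          have n2 := Elim.dev_record (after δ ξ L).cols (fun b a => u a * v b) p.swap y κ i
          rw [if_pos hT] at n1 n2
          exact ⟨h1, h2.trans n1, h3.trans n2⟩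
        · refine Or.inl fun y => ?_
          obtain ⟨h1, h2, h3⟩ := key y
          have n1 := Elim.num_record (after δ ξ L).cols p.swap y κ i
          have n2 := Elim.dev_record (after δ ξ L).cols (fun b a => u a * v b) p.swap y κ i
          rw [if_neg hT, add_zero] at n1 n2
          exact ⟨h1, h2.trans n1, h3.trans n2⟩
  measurable_ep := (listMeasurable_after δ).comp (measurable_colEpoch N M)
  measurable_cnt := (listMeasurable_after δ).comp ((Elim.measurable_num κ i).comp measurable_cols)
  measurable_dv := (listMeasurable_after δ).comp ((Elim.measurable_dev _ κ i).comp measurable_cols)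

end State

/-! ### Failures of the confidence intervals of one side -/

namespace Algorithm

variable {N M n m : ℕ} {A : Algorithm N M} {F : Fin N × Fin M × ℕ → Measure ℝ}

/-- One side of an algorithm, together with the means of its samples. -/
structure NoisySide (A : Algorithm N M) (F : Fin N × Fin M × ℕ → Measure ℝ) (β : ℕ∞ → ℕ → ℝ)
    (V : A.Seed → List ℝ → SideState n m) (r : A.Seed → ℝ → List ℝ → Bool)
    (μ : Fin n → Fin m → ℝ) : Prop where
  path : ∀ s, SidePath β (V s) (r s)
  noise : ∀ κ i, A.NoisePath F (fun s L => (V s L).epoch) (fun s L => (V s L).elim.num κ i)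
    (fun s L => (V s L).elim.dev μ κ i)

/-- The sum of the noises of a parameter is at least `c` after `k` samples in the epoch `w`. -/
def devUp (A : Algorithm N M) (V : A.Seed → List ℝ → SideState n m) (μ : Fin n → Fin m → ℝ)
    (w : ℕ∞) (κ : Option (Fin m)) (i : Fin n) (k : ℕ) (c : ℝ) :
    Set (RewardTable N M × A.Seed) :=
  {q | ∃ t, (V q.2 (A.history q.1 q.2 t)).epoch = w ∧
    (V q.2 (A.history q.1 q.2 t)).elim.num κ i = k ∧
    c ≤ (V q.2 (A.history q.1 q.2 t)).elim.dev μ κ i}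

/-- The sum of the noises of a parameter is at most `-c` after `k` samples in the epoch `w`. -/
def devDown (A : Algorithm N M) (V : A.Seed → List ℝ → SideState n m) (μ : Fin n → Fin m → ℝ)
    (w : ℕ∞) (κ : Option (Fin m)) (i : Fin n) (k : ℕ) (c : ℝ) :
    Set (RewardTable N M × A.Seed) :=
  {q | ∃ t, (V q.2 (A.history q.1 q.2 t)).epoch = w ∧
    (V q.2 (A.history q.1 q.2 t)).elim.num κ i = k ∧
    (V q.2 (A.history q.1 q.2 t)).elim.dev μ κ i ≤ -c}

/-- At the level `l` of the epoch `w`, a confidence interval fails in the direction that could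
eliminate the item `b`. -/
def confFail (A : Algorithm N M) (V : A.Seed → List ℝ → SideState n m) (μ : Fin n → Fin m → ℝ)
    (β : ℕ → ℝ) (w : ℕ∞) (b : Fin n) (l : ℕ) : Set (RewardTable N M × A.Seed) :=
  ⋃ κ : Option (Fin m), ⋃ i : Fin n,
    if i = b then A.devDown V μ w κ i (Elim.level β l) (Elim.level β l * Elim.radius β l)
    else A.devUp V μ w κ i (Elim.level β l) (Elim.level β l * Elim.radius β l)

/-- At the level `l` of the epoch `w`, the deviations for the items `a` and `b` are too large to
separate means at distance `g`. -/
def sepFail (A : Algorithm N M) (V : A.Seed → List ℝ → SideState n m) (μ : Fin n → Fin m → ℝ)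
    (β : ℕ → ℝ) (w : ℕ∞) (κ : Option (Fin m)) (a b : Fin n) (g : ℝ) (l : ℕ) :
    Set (RewardTable N M × A.Seed) :=
  A.devUp V μ w κ a (Elim.level β l) (Elim.level β l * (g / 4)) ∪
    A.devDown V μ w κ b (Elim.level β l) (Elim.level β l * (g / 4))

namespace NoisySide

variable {β : ℕ∞ → ℕ → ℝ} {V : A.Seed → List ℝ → SideState n m}
  {r : A.Seed → ℝ → List ℝ → Bool} {μ : Fin n → Fin m → ℝ}

theorem measurableSet_devUp (h : A.NoisySide F β V r μ) (hA : A.IsMeasurable) (w : ℕ∞)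
    (κ : Option (Fin m)) (i : Fin n) (k : ℕ) (c : ℝ) :
    MeasurableSet (A.devUp V μ w κ i k c) := by
  have hn := h.noise κ i
  rw [devUp, Set.ofPred_exists]
  refine MeasurableSet.iUnion fun t => ?_
  exact (measurable_seed_history hA t hn.measurable_ep (measurableSet_singleton w)).inter
    ((measurable_seed_history hA t hn.measurable_cnt (measurableSet_singleton k)).inter
      (measurable_seed_history hA t hn.measurable_dv (measurableSet_Ici (a := c))))

theorem measurableSet_devDown (h : A.NoisySide F β V r μ) (hA : A.IsMeasurable) (w : ℕ∞)
    (κ : Option (Fin m)) (i : Fin n) (k : ℕ) (c : ℝ) :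
    MeasurableSet (A.devDown V μ w κ i k c) := by
  have hn := h.noise κ i
  rw [devDown, Set.ofPred_exists]
  refine MeasurableSet.iUnion fun t => ?_
  exact (measurable_seed_history hA t hn.measurable_ep (measurableSet_singleton w)).inter
    ((measurable_seed_history hA t hn.measurable_cnt (measurableSet_singleton k)).inter
      (measurable_seed_history hA t hn.measurable_dv (measurableSet_Iic (a := -c))))

theorem measurableSet_confFail (h : A.NoisySide F β V r μ) (hA : A.IsMeasurable) (w : ℕ∞)
    (β' : ℕ → ℝ) (b : Fin n) (l : ℕ) : MeasurableSet (A.confFail V μ β' w b l) := by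
  refine MeasurableSet.iUnion fun κ => MeasurableSet.iUnion fun i => ?_
  split_ifs
  · exact h.measurableSet_devDown hA _ _ _ _ _
  · exact h.measurableSet_devUp hA _ _ _ _ _

theorem measurableSet_sepFail (h : A.NoisySide F β V r μ) (hA : A.IsMeasurable) (w : ℕ∞)
    (β' : ℕ → ℝ) (κ : Option (Fin m)) (a b : Fin n) (g : ℝ) (l : ℕ) :
    MeasurableSet (A.sepFail V μ β' w κ a b g l) :=
  (h.measurableSet_devUp hA _ _ _ _ _).union (h.measurableSet_devDown hA _ _ _ _ _)

theorem measure_confFail_le [∀ q, IsProbabilityMeasure (F q)] (h : A.NoisySide F β V r μ)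
    (hA : A.IsMeasurable) {w : ℕ∞} (hβ : Admissible (β w)) (b : Fin n) {l : ℕ} (hl : 0 < l) :
    A.runLaw (Measure.infinitePi F) (A.confFail V μ (β w) w b l) ≤
      ENNReal.ofReal (n * (m + 1) * (1 / β w l ^ 2)) := by
  have hk := hβ.level_pos hl
  have hk' : (0 : ℝ) < Elim.level (β w) l := by exact_mod_cast hk
  have hc : 0 ≤ Elim.level (β w) l * Elim.radius (β w) l :=
    mul_nonneg hk'.le (Elim.radius_nonneg _ _)
  have hβ0 : 0 < β w l := by linarith [hβ.two_le l hl]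
  have hexp : Real.exp (-(2 * (Elim.level (β w) l * Elim.radius (β w) l) ^ 2 /
      Elim.level (β w) l)) = 1 / β w l ^ 2 := by
    have h1 := hβ.level_mul_radius_sq hl
    have : 2 * (Elim.level (β w) l * Elim.radius (β w) l) ^ 2 / Elim.level (β w) l =
        2 * Real.log (β w l) := by
      rw [← h1]; field_simp
    rw [this, Real.exp_neg, mul_comm, Real.exp_mul, Real.exp_log hβ0, one_div]
    norm_cast
  have h1 : ∀ κ i, A.runLaw (Measure.infinitePi F) (if i = b then
      A.devDown V μ w κ i (Elim.level (β w) l) (Elim.level (β w) l * Elim.radius (β w) l)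
      else A.devUp V μ w κ i (Elim.level (β w) l) (Elim.level (β w) l * Elim.radius (β w) l)) ≤
      ENNReal.ofReal (1 / β w l ^ 2) := by
    intro κ i
    rw [← hexp]
    split_ifs
    · exact (h.noise κ i).measure_exists_dev_le hA w hk hc
    · exact (h.noise κ i).measure_exists_dev_ge hA w hk hc
  refine (measure_iUnion_fintype_le _ _).trans ?_
  refine (Finset.sum_le_sum fun κ _ => (measure_iUnion_fintype_le _ _).trans
    (Finset.sum_le_sum fun i _ => h1 κ i)).trans (le_of_eq ?_)
  simp only [Finset.sum_const, Finset.card_univ, Fintype.card_fin, Fintype.card_option,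
    nsmul_eq_mul]
  rw [ENNReal.ofReal_mul (by positivity), ENNReal.ofReal_mul (by positivity),
    ENNReal.ofReal_natCast, show ((m : ℝ) + 1) = ((m + 1 : ℕ) : ℝ) by push_cast; ring,
    ENNReal.ofReal_natCast]
  ring

theorem measure_sepFail_le [∀ q, IsProbabilityMeasure (F q)] (h : A.NoisySide F β V r μ)
    (hA : A.IsMeasurable) {w : ℕ∞} (hβ : Admissible (β w)) (κ : Option (Fin m)) (a b : Fin n)
    {g : ℝ} (hg : 0 ≤ g) {l : ℕ} (hl : 0 < l) :
    A.runLaw (Measure.infinitePi F) (A.sepFail V μ (β w) w κ a b g l) ≤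
      ENNReal.ofReal (2 * Real.exp (-(Elim.level (β w) l * (g ^ 2 / 8)))) := by
  have hk := hβ.level_pos hl
  have hk' : (0 : ℝ) < Elim.level (β w) l := by exact_mod_cast hk
  have hc : 0 ≤ Elim.level (β w) l * (g / 4) := by positivity
  have he : 2 * (Elim.level (β w) l * (g / 4)) ^ 2 / (Elim.level (β w) l : ℝ) =
      Elim.level (β w) l * (g ^ 2 / 8) := by field_simp; ring
  refine (measure_union_le _ _).trans ?_
  rw [two_mul, ENNReal.ofReal_add (Real.exp_pos _).le (Real.exp_pos _).le, ← he]
  exact add_le_add ((h.noise κ a).measure_exists_dev_ge hA w hk hc)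
    ((h.noise κ b).measure_exists_dev_le hA w hk hc)

/-- The best item stays active in an epoch if no confidence interval fails at the levels that are
reached. -/
theorem sound (h : A.NoisySide F β V r μ) {b : Fin n} (hμ : ∀ a k, μ a k ≤ μ b k) {w : ℕ∞}
    {q : RewardTable N M × A.Seed} (hq : ∀ l, 0 < l →
      (∃ t κ i, (V q.2 (A.history q.1 q.2 t)).epoch = w ∧
        (V q.2 (A.history q.1 q.2 t)).elim.num κ i = Elim.level (β w) l) →
      q ∉ A.confFail V μ (β w) w b l)
    {t : ℕ} (ht : (V q.2 (A.history q.1 q.2 t)).epoch = w) :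
    (V q.2 (A.history q.1 q.2 t)).elim.Sound b := by
  refine (h.path q.2).sound hμ ht (fun L' hL' hw κ a l ha hl hk => ?_)
    (fun L' hL' hw κ l hl hk => ?_)
  · obtain ⟨t', -, rfl⟩ := A.exists_history_eq_of_suffix q.1 q.2 t L' hL'
    by_contra hlt
    refine hq l hl ⟨t', κ, a, hw, hk⟩ (Set.mem_iUnion₂.2 ⟨κ, a, ?_⟩)
    rw [if_neg ha]
    exact ⟨t', hw, hk, by rw [← hk]; exact (not_le.1 hlt).le⟩
  · obtain ⟨t', -, rfl⟩ := A.exists_history_eq_of_suffix q.1 q.2 t L' hL'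
    by_contra hlt
    refine hq l hl ⟨t', κ, b, hw, hk⟩ (Set.mem_iUnion₂.2 ⟨κ, b, ?_⟩)
    rw [if_pos rfl]
    exact ⟨t', hw, hk, by rw [← hk]; exact (not_le.1 hlt).le⟩

/-- The number of rounds needed to separate two items, if there is no failure at a level. -/
theorem roundSum_le_level (h : A.NoisySide F β V r μ) {a b : Fin n} {w : ℕ∞}
    {κ : Option (Fin m)} {g : ℝ} (hμ : ∀ k, κ = none ∨ κ = some k → μ a k + g ≤ μ b k)
    (hβ : Admissible (β w)) {l : ℕ} (hl : 0 < l) (hr : Elim.radius (β w) l < g / 4)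
    {q : RewardTable N M × A.Seed} {f : List ℝ → ℕ} (hf1 : ∀ L, f L ≤ 1)
    (hf : ∀ L, IsStart (r q.2) L → f L ≠ 0 → (V q.2 L).epoch = w ∧
      a ∈ (V q.2 L).elim.active ∧ b ∈ (V q.2 L).elim.active ∧
      ((V q.2 L).todo.countP fun p => Elim.Tracks κ a p) = 1)
    (hq : q ∉ A.sepFail V μ (β w) w κ a b g l) (t : ℕ) :
    roundSum (r q.2) f (A.history q.1 q.2 t) ≤ Elim.level (β w) l := by
  refine (h.path q.2).roundSum_le_level hμ hβ hl hr hf1 hf (fun L' hL' hw hk => ?_)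
    (fun L' hL' hw hk => ?_)
  · obtain ⟨t', -, rfl⟩ := A.exists_history_eq_of_suffix q.1 q.2 t L' hL'
    by_contra hlt
    exact hq (Or.inl ⟨t', hw, hk, not_lt.1 hlt⟩)
  · obtain ⟨t', -, rfl⟩ := A.exists_history_eq_of_suffix q.1 q.2 t L' hL'
    by_contra hlt
    exact hq (Or.inr ⟨t', hw, hk, not_lt.1 hlt⟩)

/-- A bound for the number of rounds needed to separate two items: the sample size of the first
level at which they can be separated, plus the sample sizes that follow the levels of failure. -/
noncomputable def sepBound (A : Algorithm N M) (V : A.Seed → List ℝ → SideState n m)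
    (μ : Fin n → Fin m → ℝ) (β : ℕ → ℝ) (w : ℕ∞) (κ : Option (Fin m)) (a b : Fin n) (g : ℝ)
    (l₀ : ℕ) (q : RewardTable N M × A.Seed) : ℝ≥0∞ :=
  Elim.level β l₀ + ∑' l, (A.sepFail V μ β w κ a b g (l₀ + l)).indicator
    (fun _ => (Elim.level β (l₀ + l + 1) : ℝ≥0∞)) q

theorem roundSum_le_sepBound (h : A.NoisySide F β V r μ) {a b : Fin n} {w : ℕ∞}
    {κ : Option (Fin m)} {g : ℝ} (hμ : ∀ k, κ = none ∨ κ = some k → μ a k + g ≤ μ b k)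
    (hβ : Admissible (β w)) {l₀ : ℕ} (hl : 0 < l₀) (hr : (1 / 2 : ℝ) ^ (l₀ + 1) < g / 4)
    {q : RewardTable N M × A.Seed} {f : List ℝ → ℕ} (hf1 : ∀ L, f L ≤ 1)
    (hf : ∀ L, IsStart (r q.2) L → f L ≠ 0 → (V q.2 L).epoch = w ∧
      a ∈ (V q.2 L).elim.active ∧ b ∈ (V q.2 L).elim.active ∧
      ((V q.2 L).todo.countP fun p => Elim.Tracks κ a p) = 1) (t : ℕ) :
    (roundSum (r q.2) f (A.history q.1 q.2 t) : ℝ≥0∞) ≤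
      sepBound A V μ (β w) w κ a b g l₀ q := by
  by_contra hlt
  rw [not_le] at hlt
  have hstep : ∀ l, q ∉ A.sepFail V μ (β w) w κ a b g (l₀ + l) →
      roundSum (r q.2) f (A.history q.1 q.2 t) ≤ Elim.level (β w) (l₀ + l) := fun l hq => by
    refine h.roundSum_le_level hμ hβ (by omega) (lt_of_le_of_lt (hβ.radius_le (by omega))
      (lt_of_le_of_lt ?_ hr)) hf1 hf hq t
    exact pow_le_pow_of_le_one (by norm_num) (by norm_num) (by omega)
  -- Every level fails, and the number of rounds exceeds all sample sizes.
  have hall : ∀ l, Elim.level (β w) (l₀ + l) < roundSum (r q.2) f (A.history q.1 q.2 t) := by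
    intro l
    induction l with
    | zero =>
      have : (Elim.level (β w) l₀ : ℝ≥0∞) < roundSum (r q.2) f (A.history q.1 q.2 t) :=
        lt_of_le_of_lt le_self_add hlt
      exact_mod_cast this
    | succ l ih =>
      have hfail : q ∈ A.sepFail V μ (β w) w κ a b g (l₀ + l) := by
        by_contra hn
        exact absurd (hstep l hn) (by omega)
      have h1 : (Elim.level (β w) (l₀ + l + 1) : ℝ≥0∞) ≤
          sepBound A V μ (β w) w κ a b g l₀ q := by
        refine le_trans ?_ le_add_self
        refine le_trans (le_of_eq ?_) (ENNReal.le_tsum l)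
        rw [Set.indicator_of_mem hfail]
      have h2 := h1.trans_lt hlt
      exact_mod_cast h2
  obtain ⟨j, hj⟩ := exists_nat_gt ((roundSum (r q.2) f (A.history q.1 q.2 t) : ℕ) : ℝ)
  have h1 : ((Elim.level (β w) (l₀ + j) : ℕ) : ℝ) <
      (roundSum (r q.2) f (A.history q.1 q.2 t) : ℕ) := by exact_mod_cast hall j
  have h2 := hβ.four_pow_le_level (l := l₀ + j) (by omega)
  have h3 : ((l₀ + j : ℕ) : ℝ) < (4 : ℝ) ^ (l₀ + j) := by
    exact_mod_cast Nat.lt_pow_self (a := 4) (by norm_num) (n := l₀ + j)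
  push_cast at h3
  have h4 : (0 : ℝ) ≤ l₀ := by positivity
  linarith

theorem lintegral_sepBound_le [∀ q, IsProbabilityMeasure (F q)] (h : A.NoisySide F β V r μ)
    (hA : A.IsMeasurable) {w : ℕ∞} (hβ : Admissible (β w)) (κ : Option (Fin m)) (a b : Fin n)
    {g : ℝ} (hg : 0 ≤ g) {l₀ : ℕ} (hl : 0 < l₀) (D : Set (RewardTable N M × A.Seed)) :
    ∫⁻ q in D, sepBound A V μ (β w) w κ a b g l₀ q ∂A.runLaw (Measure.infinitePi F) ≤
      Elim.level (β w) l₀ * A.runLaw (Measure.infinitePi F) D +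
        ∑' l, ENNReal.ofReal (2 * Real.exp (-(Elim.level (β w) (l₀ + l) * (g ^ 2 / 8)))) *
          Elim.level (β w) (l₀ + l + 1) := by
  unfold sepBound
  rw [lintegral_add_left measurable_const, setLIntegral_const]
  refine add_le_add le_rfl ?_
  refine (setLIntegral_le_lintegral D _).trans ?_
  rw [lintegral_tsum fun l => (measurable_const.indicator
    (h.measurableSet_sepFail hA _ _ _ _ _ _ _)).aemeasurable]
  refine ENNReal.tsum_le_tsum fun l => ?_
  rw [lintegral_indicator_const (h.measurableSet_sepFail hA _ _ _ _ _ _ _), mul_comm]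
  gcongr
  exact h.measure_sepFail_le hA hβ κ a b hg (by omega)

end NoisySide
end Algorithm

/-! ### The confidence parameters of Pair-Elim -/

namespace State

open Elim

variable {N M : ℕ} {δ : ℝ}

theorem sureBeta_eq (hδ : 0 < δ) (l : ℕ) : sureBeta N M δ l =
    √(1 / δ) * (Real.pi * √(((N : ℝ) + 1) * ((M : ℝ) + 1) / 3) * l) := by
  rw [sureBeta, show ((N : ℝ) + 1) * ((M : ℝ) + 1) * (1 / δ) / 3 =
    (1 / δ) * (((N : ℝ) + 1) * ((M : ℝ) + 1) / 3) by ring, Real.sqrt_mul (by positivity)]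
  ring

theorem two_le_sureBeta (hδ : 0 < δ) (hδ1 : δ < 1) [NeZero N] [NeZero M] {l : ℕ} (hl : 0 < l) :
    2 ≤ sureBeta N M δ l := by
  have hN : (1 : ℝ) ≤ N := by exact_mod_cast NeZero.one_le
  have hM : (1 : ℝ) ≤ M := by exact_mod_cast NeZero.one_le
  have h1 : (1 : ℝ) ≤ 1 / δ := by rw [le_div_iff₀ hδ]; linarith
  have h4 : (4 : ℝ) ≤ ((N : ℝ) + 1) * ((M : ℝ) + 1) := by nlinarith
  have h2 : (1 : ℝ) ≤ √(((N : ℝ) + 1) * ((M : ℝ) + 1) * (1 / δ) / 3) := by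
    rw [Real.one_le_sqrt]
    nlinarith
  have h3 : (1 : ℝ) ≤ l := by exact_mod_cast hl
  have h5 := Real.pi_gt_three
  rw [sureBeta]
  nlinarith [mul_le_mul h2 h3 (by norm_num) (by linarith)]

theorem admissible_sureBeta (hδ : 0 < δ) (hδ1 : δ < 1) [NeZero N] [NeZero M] :
    Admissible (sureBeta N M δ) where
  two_le l hl := two_le_sureBeta hδ hδ1 hl
  le_succ l _ := by
    unfold sureBeta
    gcongr
    exact Nat.le_succ l

theorem admissible_windowBeta (w : ℕ) : Admissible (windowBeta w) where
  two_le l _ := by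
    rw [windowBeta]
    calc (2 : ℝ) = 2 ^ 1 := by norm_num
      _ ≤ _ := pow_le_pow_right₀ (by norm_num) Nat.one_le_two_pow
  le_succ _ _ := le_rfl

theorem colEpochBeta_top : colEpochBeta N M δ ⊤ = sureBeta N M δ := by
  funext l; simp [colEpochBeta]

theorem colEpochBeta_coe (w : ℕ) : colEpochBeta N M δ w = windowBeta w := by
  funext l; simp [colEpochBeta]

theorem level_sureBeta_succ_le (hδ : 0 < δ) (hδ1 : δ < 1) [NeZero N] [NeZero M] {l : ℕ}
    (hl : 0 < l) : (level (sureBeta N M δ) (l + 1) : ℝ) ≤ 9 * level (sureBeta N M δ) l := by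
  have hβ := admissible_sureBeta (N := N) (M := M) hδ hδ1
  have h1 := hβ.level_le (Nat.succ_pos l)
  have h2 := Admissible.le_level (sureBeta N M δ) l
  have h3 : (1 : ℝ) ≤ level (sureBeta N M δ) l := by exact_mod_cast hβ.level_pos hl
  have h4 := hβ.two_le l hl
  have h5 : sureBeta N M δ (l + 1) ≤ sureBeta N M δ l * sureBeta N M δ l := by
    have : sureBeta N M δ (l + 1) ≤ 2 * sureBeta N M δ l := by
      have hl' : (1 : ℝ) ≤ l := by exact_mod_cast hl
      unfold sureBeta
      push_cast
      have : 0 ≤ Real.pi * √(((N : ℝ) + 1) * ((M : ℝ) + 1) * (1 / δ) / 3) := by positivity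
      nlinarith
    nlinarith
  have h6 : Real.log (sureBeta N M δ (l + 1)) ≤ 2 * Real.log (sureBeta N M δ l) := by
    rw [two_mul, ← Real.log_mul (by positivity) (by positivity)]
    exact Real.log_le_log (by linarith [hβ.two_le (l + 1) (Nat.succ_pos l)]) h5
  have h7 : (4 : ℝ) ^ (l + 1 + 1) = 4 * 4 ^ (l + 1) := by ring
  have h8 : (0 : ℝ) < 4 ^ (l + 1) := by positivity
  rw [Nat.succ_eq_add_one, h7] at h1
  nlinarith

/-- A level at which means at distance `g` can be separated; up to the factor `log (1 / δ)`, its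
sample size is of order `1 / g ^ 2`. The expected contribution of the levels of failure is bounded
uniformly in `δ`. -/
theorem exists_level (N M : ℕ) [NeZero N] [NeZero M] {g : ℝ} (hg : 0 < g) (hg1 : g < 1) :
    ∃ l₀, 0 < l₀ ∧ (1 / 2 : ℝ) ^ (l₀ + 1) < g / 4 ∧ ∃ C : ℝ, 0 ≤ C ∧ ∀ δ : ℝ, 0 < δ → δ < 1 →
      (level (sureBeta N M δ) l₀ : ℝ) ≤ 32 / g ^ 2 * Real.log (1 / δ) + C ∧
      ∑' l, ENNReal.ofReal (2 * Real.exp (-(level (sureBeta N M δ) (l₀ + l) * (g ^ 2 / 8)))) *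
        level (sureBeta N M δ) (l₀ + l + 1) ≤ ENNReal.ofReal C := by
  obtain ⟨l₀, h1, h2⟩ := exists_nat_pow_near (x := 4 / g) (y := (2 : ℝ))
    (by rw [le_div_iff₀ hg]; linarith) (by norm_num)
  have hl₀ : 0 < l₀ := by
    rcases Nat.eq_zero_or_pos l₀ with rfl | h
    · rw [div_lt_iff₀ hg] at h2
      norm_num at h2
      linarith
    · exact h
  have h4 : (4 : ℝ) ^ l₀ ≤ 16 / g ^ 2 := by
    rw [show (4 : ℝ) = 2 ^ 2 by norm_num, ← pow_mul, mul_comm, pow_mul]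
    calc ((2 : ℝ) ^ l₀) ^ 2 ≤ (4 / g) ^ 2 := by gcongr
      _ = _ := by rw [div_pow]; norm_num
  set c0 := Real.log (Real.pi * √(((N : ℝ) + 1) * ((M : ℝ) + 1) / 3) * l₀) with hc0
  set C1 := 4 ^ (l₀ + 1) * |c0| + 1 with hC1
  set C2 := 48 / (g ^ 2 / 8) ^ 2 with hC2
  have hC1' : 0 ≤ C1 := by positivity
  have hC2' : 0 ≤ C2 := by positivity
  refine ⟨l₀, hl₀, ?_, C1 + C2, by positivity, fun δ hδ hδ1 => ⟨?_, ?_⟩⟩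
  · rw [one_div_pow, div_lt_div_iff₀ (by positivity) (by norm_num)]
    rw [div_lt_iff₀ hg] at h2
    linarith
  · have hβ := admissible_sureBeta (N := N) (M := M) hδ hδ1
    have hL : 0 ≤ Real.log (1 / δ) := Real.log_nonneg (by rw [le_div_iff₀ hδ]; linarith)
    have hpos : (0 : ℝ) < Real.pi * √(((N : ℝ) + 1) * ((M : ℝ) + 1) / 3) * l₀ := by
      have : (0 : ℝ) < l₀ := by exact_mod_cast hl₀
      have := Real.pi_pos
      positivity
    have hlog : Real.log (sureBeta N M δ l₀) = Real.log (1 / δ) / 2 + c0 := by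
      rw [sureBeta_eq hδ, Real.log_mul (by positivity) hpos.ne', Real.log_sqrt (by positivity)]
    have h5 := hβ.level_le hl₀
    rw [hlog] at h5
    have h6 : (4 : ℝ) ^ (l₀ + 1) * (Real.log (1 / δ) / 2) ≤ 32 / g ^ 2 * Real.log (1 / δ) := by
      rw [pow_succ]
      calc (4 : ℝ) ^ l₀ * 4 * (Real.log (1 / δ) / 2) = 4 ^ l₀ * (2 * Real.log (1 / δ)) := by ring
        _ ≤ 16 / g ^ 2 * (2 * Real.log (1 / δ)) := by gcongr
        _ = _ := by ring
    have h7 : (4 : ℝ) ^ (l₀ + 1) * c0 ≤ 4 ^ (l₀ + 1) * |c0| := by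
      gcongr; exact le_abs_self _
    linarith
  · have hβ := admissible_sureBeta (N := N) (M := M) hδ hδ1
    have key : ∀ l, ENNReal.ofReal (2 * Real.exp (-(level (sureBeta N M δ) (l₀ + l) *
        (g ^ 2 / 8)))) * level (sureBeta N M δ) (l₀ + l + 1) ≤
        ENNReal.ofReal (36 / (g ^ 2 / 8) ^ 2 * (1 / 4) ^ l) := by
      intro l
      have hk1 := hβ.four_pow_le_level (l := l₀ + l) (by omega)
      have hk2 := level_sureBeta_succ_le (N := N) (M := M) hδ hδ1 (l := l₀ + l) (by omega)
      set k : ℝ := ((level (sureBeta N M δ) (l₀ + l) : ℕ) : ℝ) with hk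
      rw [← ENNReal.ofReal_natCast, ← ENNReal.ofReal_mul (by positivity)]
      refine ENNReal.ofReal_le_ofReal ?_
      set c := g ^ 2 / 8 with hc
      have hc' : 0 < c := by positivity
      have h40 : (4 : ℝ) ^ l ≤ 4 ^ (l₀ + l) := pow_le_pow_right₀ (by norm_num) (by omega)
      have hk0 : 0 < k := lt_of_lt_of_le (by positivity) hk1
      have he : Real.exp (-(k * c)) ≤ 2 / (k * c) ^ 2 := by
        rw [Real.exp_neg, ← one_div, div_le_div_iff₀ (Real.exp_pos _) (by positivity)]
        have := Real.quadratic_le_exp_of_nonneg (x := k * c) (by positivity)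
        nlinarith [mul_pos hk0 hc']
      calc 2 * Real.exp (-(k * c)) * (level (sureBeta N M δ) (l₀ + l + 1) : ℝ)
          ≤ 2 * (2 / (k * c) ^ 2) * (9 * k) := by gcongr
        _ = 36 / c ^ 2 * (1 / k) := by field_simp; ring
        _ ≤ 36 / c ^ 2 * (1 / 4) ^ l := by
            rw [one_div_pow]
            gcongr
            exact h40.trans hk1
    refine (ENNReal.tsum_le_tsum key).trans ?_
    have hs : Summable fun l : ℕ => 36 / (g ^ 2 / 8) ^ 2 * (1 / 4 : ℝ) ^ l :=
      (summable_geometric_of_lt_one (by norm_num) (by norm_num)).mul_left _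
    rw [← ENNReal.ofReal_tsum_of_nonneg (fun l => by positivity) hs, tsum_mul_left,
      tsum_geometric_of_lt_one (by norm_num) (by norm_num)]
    refine ENNReal.ofReal_le_ofReal ?_
    have : 36 / (g ^ 2 / 8) ^ 2 * (1 - 1 / 4)⁻¹ = C2 := by rw [hC2]; ring
    rw [this]
    linarith

/-- The failure probabilities of all the confidence intervals, rows and columns, add up to at most
`δ`. -/
theorem tsum_sureBeta_le (N M : ℕ) [NeZero N] [NeZero M] (hδ : 0 < δ) :
    ∑' l : ℕ, (ENNReal.ofReal (N * (M + 1) * (1 / sureBeta N M δ (l + 1) ^ 2)) +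
      ENNReal.ofReal (M * (N + 1) * (1 / sureBeta N M δ (l + 1) ^ 2))) ≤ ENNReal.ofReal δ := by
  have hpi := Real.pi_pos
  have hz : HasSum (fun l : ℕ => 1 / ((l + 1 : ℕ) : ℝ) ^ 2) (Real.pi ^ 2 / 6) := by
    have := (hasSum_nat_add_iff' 1).2 hasSum_zeta_two
    simpa using this
  have hsq : ∀ l : ℕ, 1 / sureBeta N M δ (l + 1) ^ 2 =
      3 * δ / (Real.pi ^ 2 * ((N + 1) * (M + 1))) * (1 / ((l + 1 : ℕ) : ℝ) ^ 2) := by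
    intro l
    rw [sureBeta, mul_pow, mul_pow, Real.sq_sqrt (by positivity)]
    have : ((l + 1 : ℕ) : ℝ) ≠ 0 := by positivity
    field_simp
  have hterm : ∀ l : ℕ, ENNReal.ofReal (N * (M + 1) * (1 / sureBeta N M δ (l + 1) ^ 2)) +
      ENNReal.ofReal (M * (N + 1) * (1 / sureBeta N M δ (l + 1) ^ 2)) ≤
      ENNReal.ofReal (6 * δ / Real.pi ^ 2 * (1 / ((l + 1 : ℕ) : ℝ) ^ 2)) := by
    intro l
    rw [← ENNReal.ofReal_add (by positivity) (by positivity), hsq]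
    refine ENNReal.ofReal_le_ofReal ?_
    have h1 : (N * (M + 1) + M * (N + 1) : ℝ) ≤ 2 * ((N + 1) * (M + 1)) := by
      have : (0 : ℝ) ≤ N := by positivity
      have : (0 : ℝ) ≤ M := by positivity
      nlinarith
    set z := 1 / ((l + 1 : ℕ) : ℝ) ^ 2
    have hz0 : 0 ≤ z := by positivity
    calc _ = (N * (M + 1) + M * (N + 1) : ℝ) *
          (3 * δ / (Real.pi ^ 2 * ((N + 1) * (M + 1))) * z) := by ring
      _ ≤ 2 * ((N + 1) * (M + 1)) * (3 * δ / (Real.pi ^ 2 * ((N + 1) * (M + 1))) * z) := by gcongr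
      _ = _ := by field_simp; ring
  refine (ENNReal.tsum_le_tsum hterm).trans ?_
  rw [← ENNReal.ofReal_tsum_of_nonneg (fun l => by positivity) (hz.summable.mul_left _),
    tsum_mul_left, hz.tsum_eq]
  refine ENNReal.ofReal_le_ofReal (le_of_eq ?_)
  field_simp

end State

namespace Algorithm

variable {N M n m : ℕ} {A : Algorithm N M} {F : Fin N × Fin M × ℕ → Measure ℝ}

theorem sepFail_subset_confFail (V : A.Seed → List ℝ → SideState n m) (μ : Fin n → Fin m → ℝ)
    (β : ℕ → ℝ) (w : ℕ∞) (κ : Option (Fin m)) {a b : Fin n} (hab : a ≠ b) {g : ℝ} {l : ℕ}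
    (hr : Elim.radius β l ≤ g / 4) :
    A.sepFail V μ β w κ a b g l ⊆ A.confFail V μ β w b l := by
  have h1 : (Elim.level β l : ℝ) * Elim.radius β l ≤ Elim.level β l * (g / 4) := by gcongr
  rintro q (⟨t, h2, h3, h4⟩ | ⟨t, h2, h3, h4⟩)
  · refine Set.mem_iUnion₂.2 ⟨κ, a, ?_⟩
    rw [if_neg hab]
    exact ⟨t, h2, h3, h1.trans h4⟩
  · refine Set.mem_iUnion₂.2 ⟨κ, b, ?_⟩
    rw [if_pos rfl]
    exact ⟨t, h2, h3, h4.trans (neg_le_neg h1)⟩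

theorem NoisySide.measurable_sepBound {β : ℕ∞ → ℕ → ℝ} {V : A.Seed → List ℝ → SideState n m}
    {r : A.Seed → ℝ → List ℝ → Bool} {μ : Fin n → Fin m → ℝ} (h : A.NoisySide F β V r μ)
    (hA : A.IsMeasurable) (β' : ℕ → ℝ) (w : ℕ∞) (κ : Option (Fin m)) (a b : Fin n) (g : ℝ)
    (l₀ : ℕ) : Measurable (NoisySide.sepBound A V μ β' w κ a b g l₀) :=
  (Measurable.tsum fun _ =>
    measurable_const.indicator (h.measurableSet_sepFail hA _ _ _ _ _ _ _)).const_add _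

end Algorithm

namespace State

variable {N M : ℕ} [NeZero N] [NeZero M] {u : Fin N → ℝ} {v : Fin M → ℝ}
  {F : Fin N × Fin M × ℕ → Measure ℝ}

/-- The rows of Pair-Elim, as a function of the seed and of the rewards. -/
noncomputable def rowPath (N M : ℕ) [NeZero N] [NeZero M] (δ : ℝ) (ξ : (pairElim N M δ).Seed)
    (L : List ℝ) : SideState N M := (after δ ξ L).rowView

/-- The columns of Pair-Elim, as a function of the seed and of the rewards. -/
noncomputable def colPath (N M : ℕ) [NeZero N] [NeZero M] (δ : ℝ) (ξ : (pairElim N M δ).Seed)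
    (L : List ℝ) : SideState M N := (after δ ξ L).colView

theorem noisySide_rows (δ : ℝ) (hF : IsSubgaussianModel u v F) :
    (pairElim N M δ).NoisySide F (fun _ => sureBeta N M δ) (rowPath N M δ) (newRound δ)
      fun i j => u i * v j where
  path ξ := row_path δ ξ
  noise κ i := noisePath_rows δ hF κ i

theorem noisySide_cols (δ : ℝ) (hF : IsSubgaussianModel u v F) :
    (pairElim N M δ).NoisySide F (colEpochBeta N M δ) (colPath N M δ) (newRound δ)
      fun j i => u i * v j where
  path ξ := col_path δ ξ
  noise κ j := noisePath_cols δ hF κ j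

end State

/-! ### Counting rounds -/

section RoundSum

variable {r : ℝ → List ℝ → Bool}

theorem roundSum_le {f g : List ℝ → ℕ} {L : List ℝ}
    (h : ∀ L', L' <:+ L → IsStart r L' → f L' ≤ g L') : roundSum r f L ≤ roundSum r g L := by
  induction L with
  | nil => exact h [] (List.suffix_refl _) trivial
  | cons y L ih =>
    simp only [roundSum]
    refine add_le_add (ih fun L' hL' => h L' (hL'.trans (List.suffix_cons y L))) ?_
    split_ifs with hr
    · exact h _ (List.suffix_refl _) hr
    · exact le_rfl

theorem roundSum_add (f g : List ℝ → ℕ) (L : List ℝ) :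
    roundSum r (fun L => f L + g L) L = roundSum r f L + roundSum r g L := by
  induction L with
  | nil => rfl
  | cons y L ih =>
    simp only [roundSum, ih]
    split_ifs <;> ring

theorem roundSum_const_mul (c : ℕ) (f : List ℝ → ℕ) (L : List ℝ) :
    roundSum r (fun L => c * f L) L = c * roundSum r f L := by
  induction L with
  | nil => rfl
  | cons y L ih =>
    simp only [roundSum, ih]
    split_ifs <;> ring

theorem roundSum_finset_sum {ι : Type*} (s : Finset ι) (f : ι → List ℝ → ℕ) (L : List ℝ) :
    roundSum r (fun L => ∑ i ∈ s, f i L) L = ∑ i ∈ s, roundSum r (f i) L := by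
  induction L with
  | nil => rfl
  | cons y L ih =>
    simp only [roundSum, ih]
    split_ifs <;> simp [Finset.sum_add_distrib]

end RoundSum

theorem SidePath.active_subset {n m : ℕ} {β : ℕ∞ → ℕ → ℝ} {V : List ℝ → SideState n m}
    {r : ℝ → List ℝ → Bool} (hV : SidePath β V r) {L L' : List ℝ} (h : L' <:+ L)
    (he : (V L').epoch = (V L).epoch) : (V L).elim.active ⊆ (V L').elim.active := by
  induction L with
  | nil => rw [List.suffix_nil.1 h]
  | cons y L ih =>
    rcases List.suffix_cons_iff.1 h with rfl | h
    · exact subset_rfl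
    · have h1 : (V L').epoch = (V L).epoch :=
        le_antisymm (hV.epoch_mono h) ((hV.step y L).epoch_le.trans he.ge)
      exact ((hV.step y L).active_subset (by rw [← h1, he])).trans (ih h h1)

theorem Elim.length_plan {n m : ℕ} (e : Elim n m) (k : Fin m) :
    (e.plan k).length = e.active.card := by
  rw [Elim.plan, List.length_map, ← List.toFinset_card_of_nodup ((List.nodup_finRange n).filter _)]
  congr 1
  ext a
  simp

namespace State

theorem card_active_le {n m : ℕ} (e : Elim n m) : e.active.card ≤ n :=
  (Finset.card_le_univ _).trans_eq (Fintype.card_fin n)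

theorem length_todo_beginRound {N M : ℕ} (δ : ℝ) (ξ : ℕ → Fin N × Fin M) (st : State N M) :
    (beginRound δ ξ st).todoRows.length + (beginRound δ ξ st).todoCols.length ≤ N + M := by
  obtain ⟨k, -, h1⟩ := rowView_beginRound δ ξ st
  obtain ⟨k', -, h2⟩ := colView_beginRound δ ξ st
  have h1' := congrArg (fun V => V.todo.length) h1
  have h2' := congrArg (fun V => V.todo.length) h2
  simp only [rowView, colView, Elim.length_plan, List.length_map] at h1' h2'
  rw [h1', h2']
  exact add_le_add (card_active_le _) (card_active_le _)

variable {N M : ℕ} [NeZero N] [NeZero M] {δ : ℝ} {ξ : ℕ → Fin N × Fin M}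

/-- No reward of the list was received after the algorithm stopped. -/
def Live (δ : ℝ) (ξ : ℕ → Fin N × Fin M) : List ℝ → Prop
  | [] => True
  | _ :: L => (after δ ξ L).result = none ∧ Live δ ξ L

theorem live_history (x : RewardTable N M) (ξ : (pairElim N M δ).Seed) (t : ℕ) :
    Live δ ξ ((pairElim N M δ).history x ξ t) := by
  induction t with
  | zero => trivial
  | succ t ih =>
    rcases ha : (pairElim N M δ).action ξ ((pairElim N M δ).history x ξ t) with p | p
    · rw [Algorithm.history_succ_of_sample _ ha]
      exact ⟨(next_eq_inl ha).1, ih⟩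
    · rw [Algorithm.history_succ_of_inr _ ha]
      exact ih

/-- Every sample belongs to a round, and a round takes one sample of each active row and of each
active column. -/
theorem length_eq_roundSum {L : List ℝ} (hL : Live δ ξ L) :
    L.length + (after δ ξ L).todoRows.length + (after δ ξ L).todoCols.length =
      roundSum (newRound δ ξ)
        (fun L => (after δ ξ L).rows.active.card + (after δ ξ L).cols.active.card) L := by
  have hstart : ∀ {L}, IsStart (newRound δ ξ) L →
      (after δ ξ L).todoRows.length = (after δ ξ L).rows.active.card ∧
      (after δ ξ L).todoCols.length = (after δ ξ L).cols.active.card := by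
    intro L h
    obtain ⟨-, ⟨k, -, h1⟩, k', -, h2⟩ := todo_of_isStart h
    refine ⟨by rw [h1, Elim.length_plan], ?_⟩
    rw [← Elim.length_plan _ k', ← h2, List.length_map]
  induction L with
  | nil =>
    obtain ⟨h1, h2⟩ := hstart (L := []) trivial
    simp only [roundSum, h1, h2, List.length_nil]
    ring
  | cons y L ih =>
    obtain ⟨hr, hL⟩ := hL
    have ih := ih hL
    simp only [roundSum, ← ih, List.length_cons]
    have hs := after_step δ ξ y L
    have hst := @hstart (y :: L)
    rw [IsStart] at hst
    generalize after δ ξ (y :: L) = st' at *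
    generalize newRound δ ξ y L = ρ at *
    cases hs with
    | stopped h => exact absurd hr h
    | row p l h => simp [h]; ring
    | col p q l h h' => simp [h, h']; ring
    | final p h h' => simp [h, h', lastCol]
    | _ =>
      obtain ⟨h1, h2⟩ := hst rfl
      simp_all
      ring

open Classical in
/-- The number of rounds begun in a state with the property `P`. -/
noncomputable def rounds (δ : ℝ) (ξ : ℕ → Fin N × Fin M) (P : State N M → Prop) (L : List ℝ) : ℕ :=
  roundSum (newRound δ ξ) (fun L => if P (after δ ξ L) then 1 else 0) L

theorem rounds_eq (P : State N M → Prop) [DecidablePred P] (L : List ℝ) : rounds δ ξ P L =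
    roundSum (newRound δ ξ) (fun L => if P (after δ ξ L) then 1 else 0) L := by
  unfold rounds
  congr 1
  funext L
  congr

theorem rounds_nil (P : State N M → Prop) [DecidablePred P] :
    rounds δ ξ P [] = if P (after δ ξ []) then 1 else 0 := by
  rw [rounds_eq, roundSum]

theorem rounds_cons (P : State N M → Prop) [DecidablePred P] (y : ℝ) (L : List ℝ) :
    rounds δ ξ P (y :: L) = rounds δ ξ P L +
      if newRound δ ξ y L = true then (if P (after δ ξ (y :: L)) then 1 else 0) else 0 := by
  simp only [rounds_eq, roundSum]

theorem rounds_le_sum {ι : Type*} (s : Finset ι) {P : State N M → Prop} {Q : ι → State N M → Prop}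
    {L : List ℝ} (h : ∀ L', L' <:+ L → IsStart (newRound δ ξ) L' → P (after δ ξ L') →
      ∃ i ∈ s, Q i (after δ ξ L')) :
    rounds δ ξ P L ≤ ∑ i ∈ s, rounds δ ξ (Q i) L := by
  classical
  unfold rounds
  rw [← roundSum_finset_sum]
  refine roundSum_le fun L' hL' hs => ?_
  split_ifs with hP
  · obtain ⟨i, hi, hQ⟩ := h L' hL' hs hP
    refine le_trans ?_ (Finset.single_le_sum
      (f := fun i => if Q i (after δ ξ L') then 1 else 0) (fun _ _ => Nat.zero_le _) hi)
    simp [hQ]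
  · exact Nat.zero_le _

/-! ### Bookkeeping of the windows -/

theorem spent_le_length (δ : ℝ) (ξ : ℕ → Fin N × Fin M) (L : List ℝ) :
    (after δ ξ L).spent ≤ L.length := by
  induction L with
  | nil => exact le_rfl
  | cons y L ih =>
    have hs := after_step δ ξ y L
    generalize after δ ξ (y :: L) = st' at *
    generalize newRound δ ξ y L = ρ at *
    cases hs <;> simp [beginRound, lastCol] <;> omega

/-- Each past window has a certain length. -/
theorem pow_lt_length (δ : ℝ) (ξ : ℕ → Fin N × Fin M) (L : List ℝ) :
    ∀ w < (after δ ξ L).window, 2 ^ (2 ^ w) < L.length := by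
  induction L with
  | nil => exact fun w hw => absurd hw (Nat.not_lt_zero w)
  | cons y L ih =>
    intro w hw
    have hs := after_step δ ξ y L
    have hsp := spent_le_length δ ξ L
    rw [List.length_cons]
    generalize after δ ξ (y :: L) = st' at *
    generalize newRound δ ξ y L = ρ at *
    cases hs with
    | window p h h' hr hp hc hs =>
      rcases Nat.lt_succ_iff_lt_or_eq.1 (show w < (after δ ξ L).window + 1 from hw) with hw | rfl
      · exact (ih w hw).trans (Nat.lt_succ_self _)
      · omega
    | _ => exact (ih w hw).trans (Nat.lt_succ_self _)

theorem spent_add_le (δ : ℝ) (ξ : ℕ → Fin N × Fin M) (L : List ℝ)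
    (hp : (after δ ξ L).rowPhase = true) :
    (after δ ξ L).spent + ((after δ ξ L).todoRows.length + (after δ ξ L).todoCols.length) ≤
      2 ^ (2 ^ (after δ ξ L).window) + (N + M) := by
  induction L with
  | nil =>
    have := length_todo_beginRound δ ξ (init N M)
    have h0 : (after δ ξ []).spent = 0 := rfl
    rw [h0]
    exact (Nat.zero_add _).trans_le (this.trans (Nat.le_add_left _ _))
  | cons y L ih =>
    have hs := after_step δ ξ y L
    generalize after δ ξ (y :: L) = st' at *
    generalize newRound δ ξ y L = ρ at *
    cases hs with
    | stopped h => exact ih hp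
    | row p l h hr =>
      have := ih hp
      simp only [h, List.length_cons] at this ⊢
      omega
    | col p q l h h' hr =>
      have := ih hp
      simp only [h, h', List.length_cons, List.length_nil] at this ⊢
      omega
    | detect p h h' hr hp' hc => simp [beginRound] at hp
    | window p h h' hr hp' hc hs =>
      have := length_todo_beginRound δ ξ { (after δ ξ L).lastCol p y with
        window := (after δ ξ L).window + 1, spent := 0, cols := Elim.fresh M N }
      exact (Nat.zero_add _).trans_le (this.trans (Nat.le_add_left _ _))
    | round p h h' hr hp' hc hs =>
      exact add_le_add (not_lt.1 hs) (length_todo_beginRound δ ξ _)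
    | final p h h' hr hp' hc => simp [lastCol, hp'] at hp
    | late p h h' hr hp' hc => simp [beginRound, lastCol, hp'] at hp

theorem num_le_spent (δ : ℝ) (ξ : ℕ → Fin N × Fin M) (L : List ℝ)
    (hp : (after δ ξ L).rowPhase = true) (κ : Option (Fin N)) (i : Fin M) :
    (after δ ξ L).cols.num κ i ≤ (after δ ξ L).spent := by
  induction L with
  | nil => simp [after, beginRound, init]
  | cons y L ih =>
    have hrec : ∀ p : Fin N × Fin M, ((after δ ξ L).cols.record p.2 p.1 y).num κ i ≤
        (after δ ξ L).cols.num κ i + 1 := by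
      intro p
      have := Elim.num_record (after δ ξ L).cols p.swap y κ i
      simp only [Prod.fst_swap, Prod.snd_swap] at this
      rw [this]
      split_ifs <;> omega
    have hs := after_step δ ξ y L
    generalize after δ ξ (y :: L) = st' at *
    generalize newRound δ ξ y L = ρ at *
    cases hs with
    | stopped h => exact ih hp
    | row p l h hr => exact (ih hp).trans (Nat.le_succ _)
    | col p q l h h' hr => exact (hrec p).trans (Nat.succ_le_succ (ih hp))
    | detect p h h' hr hp' hc => simp [beginRound] at hp
    | window p h h' hr hp' hc hs => simp [beginRound]
    | round p h h' hr hp' hc hs =>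
      simp only [beginRound, lastCol, Elim.num_update]
      exact (hrec p).trans (Nat.succ_le_succ (ih hp'))
    | final p h h' hr hp' hc => simp [lastCol, hp'] at hp
    | late p h h' hr hp' hc => simp [beginRound, lastCol, hp'] at hp

/-- The number of rounds of a window. -/
theorem rounds_window_le (δ : ℝ) (ξ : ℕ → Fin N × Fin M) (w : ℕ) (L : List ℝ) :
    rounds δ ξ (fun st => st.rowPhase = true ∧ st.window = w) L ≤ 2 ^ (2 ^ w) + 1 := by
  suffices h : rounds δ ξ (fun st => st.rowPhase = true ∧ st.window = w) L ≤ 2 ^ (2 ^ w) + 1 ∧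
      ((after δ ξ L).window < w →
        rounds δ ξ (fun st => st.rowPhase = true ∧ st.window = w) L = 0) ∧
      ((after δ ξ L).rowPhase = true → (after δ ξ L).window = w →
        rounds δ ξ (fun st => st.rowPhase = true ∧ st.window = w) L ≤ (after δ ξ L).spent + 1) from
    h.1
  induction L with
  | nil =>
    rw [rounds_nil]
    have h2 : 0 < 2 ^ (2 ^ w) := by positivity
    refine ⟨?_, fun hw => if_neg fun h => hw.ne h.2, fun _ _ => ?_⟩
    · split_ifs <;> omega
    · split_ifs <;> omega
  | cons y L ih =>
    obtain ⟨i1, i2, i3⟩ := ih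
    rw [rounds_cons]
    have hs := after_step δ ξ y L
    generalize after δ ξ (y :: L) = st' at *
    generalize newRound δ ξ y L = ρ at *
    generalize rounds δ ξ (fun st => st.rowPhase = true ∧ st.window = w) L = c at *
    cases hs with
    | stopped h => simpa using ⟨i1, i2, i3⟩
    | row p l h hr =>
      refine ⟨by simpa using i1, by simpa using i2, fun h1 h2 => ?_⟩
      have := i3 h1 h2
      simp only [Bool.false_eq_true, if_false]
      omega
    | col p q l h h' hr =>
      refine ⟨by simpa using i1, by simpa using i2, fun h1 h2 => ?_⟩
      have := i3 h1 h2
      simp only [Bool.false_eq_true, if_false]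
      omega
    | detect p h h' hr hp' hc =>
      refine ⟨by simpa [beginRound] using i1, fun h1 => ?_, fun h1 => ?_⟩
      · simpa [beginRound] using i2 h1
      · simp [beginRound] at h1
    | window p h h' hr hp' hc hs =>
      simp only [beginRound, lastCol, hp', if_true, true_and]
      by_cases hw : (after δ ξ L).window + 1 = w
      · have := i2 (by omega)
        have h2 : 0 < 2 ^ (2 ^ w) := by positivity
        simp only [hw, if_true, this]
        omega
      · simp only [hw, if_false, add_zero]
        exact ⟨i1, fun h => i2 (by omega), fun _ h => absurd h (by simp)⟩
    | round p h h' hr hp' hc hs =>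
      simp only [beginRound, lastCol, hp', if_true, true_and]
      by_cases hw : (after δ ξ L).window = w
      · have := i3 hp' hw
        rw [hw] at hs
        simp only [hw, if_true]
        omega
      · simp only [hw, if_false, add_zero]
        exact ⟨i1, i2, fun _ h => absurd h (by simp)⟩
    | final p h h' hr hp' hc =>
      refine ⟨by simpa using i1, fun h1 => by simpa using i2 h1, fun h1 => ?_⟩
      simp [lastCol, hp'] at h1
    | late p h h' hr hp' hc =>
      refine ⟨by simpa [beginRound, lastCol, hp'] using i1, fun h1 => ?_, fun h1 => ?_⟩
      · simpa [beginRound, lastCol, hp'] using i2 h1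
      · simp [beginRound, lastCol, hp'] at h1

/-- In the first phase, at most one round has a single active row. -/
theorem rounds_single_row_le (δ : ℝ) (ξ : ℕ → Fin N × Fin M) (L : List ℝ) :
    rounds δ ξ (fun st => st.rowPhase = true ∧ st.rows.active.card = 1) L ≤ 1 := by
  suffices h : rounds δ ξ (fun st => st.rowPhase = true ∧ st.rows.active.card = 1) L ≤ 1 ∧
      ((after δ ξ L).rowPhase = true → (after δ ξ L).rows.active.card ≠ 1 →
        rounds δ ξ (fun st => st.rowPhase = true ∧ st.rows.active.card = 1) L = 0) from h.1
  induction L with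
  | nil =>
    rw [rounds_nil]
    refine ⟨?_, fun h1 h2 => if_neg fun h => h2 h.2⟩
    split_ifs <;> omega
  | cons y L ih =>
    obtain ⟨i1, i2⟩ := ih
    rw [rounds_cons]
    have hs := after_step δ ξ y L
    generalize after δ ξ (y :: L) = st' at *
    generalize newRound δ ξ y L = ρ at *
    generalize rounds δ ξ (fun st => st.rowPhase = true ∧ st.rows.active.card = 1) L = c at *
    have hnew : ∀ st1 : State N M, c = 0 →
        (c + if (true : Bool) = true then
          (if st1.rowPhase = true ∧ st1.rows.active.card = 1 then 1 else 0) else 0) ≤ 1 ∧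
        (st1.rowPhase = true → st1.rows.active.card ≠ 1 →
        (c + if (true : Bool) = true then
          (if st1.rowPhase = true ∧ st1.rows.active.card = 1 then 1 else 0) else 0) = 0) := by
      intro st1 hc
      refine ⟨?_, fun h1 h2 => ?_⟩
      · split_ifs <;> omega
      · simp [h2, hc]
    cases hs with
    | stopped h => simpa using ⟨i1, i2⟩
    | row p l h hr => exact ⟨by simpa using i1, fun h1 h2 => by simpa using i2 h1 h2⟩
    | col p q l h h' hr => exact ⟨by simpa using i1, fun h1 h2 => by simpa using i2 h1 h2⟩
    | detect p h h' hr hp' hc =>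
      refine ⟨by simpa [beginRound] using i1, fun h1 => ?_⟩
      simp [beginRound] at h1
    | window p h h' hr hp' hc hs => exact hnew _ (i2 hp' hc)
    | round p h h' hr hp' hc hs => exact hnew _ (i2 hp' hc)
    | final p h h' hr hp' hc =>
      refine ⟨by simpa using i1, fun h1 => ?_⟩
      simp [lastCol, hp'] at h1
    | late p h h' hr hp' hc =>
      refine ⟨by simpa [beginRound, lastCol, hp'] using i1, fun h1 => ?_⟩
      simp [beginRound, lastCol, hp'] at h1

/-- In the second phase, at most one round has a single active column. -/
theorem rounds_single_col_le (δ : ℝ) (ξ : ℕ → Fin N × Fin M) (L : List ℝ) :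
    rounds δ ξ (fun st => st.rowPhase = false ∧ st.cols.active.card = 1) L ≤ 1 := by
  suffices h : rounds δ ξ (fun st => st.rowPhase = false ∧ st.cols.active.card = 1) L ≤ 1 ∧
      (((after δ ξ L).rowPhase = true ∨ (after δ ξ L).cols.active.card ≠ 1) →
        rounds δ ξ (fun st => st.rowPhase = false ∧ st.cols.active.card = 1) L = 0) from h.1
  induction L with
  | nil =>
    have h0 : rounds δ ξ (fun st => st.rowPhase = false ∧ st.cols.active.card = 1) [] = 0 := by
      rw [rounds_nil, if_neg fun h => by simp [after, beginRound, init] at h]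
    rw [h0]
    exact ⟨Nat.zero_le _, fun _ => rfl⟩
  | cons y L ih =>
    obtain ⟨i1, i2⟩ := ih
    rw [rounds_cons]
    have hs := after_step δ ξ y L
    generalize after δ ξ (y :: L) = st' at *
    generalize newRound δ ξ y L = ρ at *
    generalize rounds δ ξ (fun st => st.rowPhase = false ∧ st.cols.active.card = 1) L = c at *
    have hnew : ∀ st1 : State N M, c = 0 →
        (c + if (true : Bool) = true then
          (if st1.rowPhase = false ∧ st1.cols.active.card = 1 then 1 else 0) else 0) ≤ 1 ∧
        ((st1.rowPhase = true ∨ st1.cols.active.card ≠ 1) →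
        (c + if (true : Bool) = true then
          (if st1.rowPhase = false ∧ st1.cols.active.card = 1 then 1 else 0) else 0) = 0) := by
      intro st1 hc
      refine ⟨?_, fun h1 => ?_⟩
      · split_ifs <;> omega
      · rw [if_pos rfl, if_neg, hc]
        rintro ⟨h2, h3⟩
        rcases h1 with h1 | h1
        · simp [h1] at h2
        · exact h1 h3
    cases hs with
    | stopped h => simpa using ⟨i1, i2⟩
    | row p l h hr => exact ⟨by simpa using i1, fun h1 => by simpa using i2 h1⟩
    | col p q l h h' hr => exact ⟨by simpa using i1, fun h1 => by simpa using i2 h1⟩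
    | detect p h h' hr hp' hc => exact hnew _ (i2 (Or.inl hp'))
    | window p h h' hr hp' hc hs => exact hnew _ (i2 (Or.inl hp'))
    | round p h h' hr hp' hc hs => exact hnew _ (i2 (Or.inl hp'))
    | final p h h' hr hp' hc =>
      refine ⟨by simpa using i1, fun h1 => ?_⟩
      simpa using i2 h1
    | late p h h' hr hp' hc => exact hnew _ (i2 (Or.inr hc))

end State

theorem IsInstance.mul_le_mul_best_row {N M : ℕ} {u : Fin N → ℝ} {v : Fin M → ℝ} {i₀ : Fin N}
    {j₀ : Fin M} (h : IsInstance u v i₀ j₀) (a : Fin N) (k : Fin M) :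
    u a * v k ≤ u i₀ * v k := by
  rcases eq_or_ne a i₀ with rfl | ha
  · exact le_rfl
  · exact mul_le_mul_of_nonneg_right (h.row_best a ha).le (h.col_mem k).1.le

theorem IsInstance.mul_le_mul_best_col {N M : ℕ} {u : Fin N → ℝ} {v : Fin M → ℝ} {i₀ : Fin N}
    {j₀ : Fin M} (h : IsInstance u v i₀ j₀) (b : Fin M) (k : Fin N) :
    u k * v b ≤ u k * v j₀ := by
  rcases eq_or_ne b j₀ with rfl | hb
  · exact le_rfl
  · exact mul_le_mul_of_nonneg_left (h.col_best b hb).le (h.row_mem k).1.le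

namespace State

variable {N M : ℕ} [NeZero N] [NeZero M] {δ : ℝ} {u : Fin N → ℝ} {v : Fin M → ℝ}
  {F : Fin N × Fin M × ℕ → Measure ℝ} {i₀ : Fin N} {j₀ : Fin M}

/-! ### The event that the best pair survives -/

/-- The best row is never eliminated, and the best column is not eliminated in the second phase. -/
def bestSurvives (δ : ℝ) (i₀ : Fin N) (j₀ : Fin M) :
    Set (RewardTable N M × (pairElim N M δ).Seed) :=
  {q | ∀ t, i₀ ∈ (after δ q.2 ((pairElim N M δ).history q.1 q.2 t)).rows.active ∧
    ((after δ q.2 ((pairElim N M δ).history q.1 q.2 t)).rowPhase = false →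
      j₀ ∈ (after δ q.2 ((pairElim N M δ).history q.1 q.2 t)).cols.active)}

theorem measurableSet_mem_active {n m : ℕ} (a : Fin n) :
    MeasurableSet {e : Elim n m | a ∈ e.active} :=
  Elim.measurable_rep (MeasurableSet.of_discrete
    (s := {r : Disc (Fin n → Fin n) | a ∈ Finset.univ.image r.val}))

theorem measurableSet_bestSurvives (δ : ℝ) (i₀ : Fin N) (j₀ : Fin M) :
    MeasurableSet (bestSurvives δ i₀ j₀) := by
  rw [bestSurvives, Set.ofPred_forall]
  refine MeasurableSet.iInter fun t => ?_
  have h1 : MeasurableSet {st : State N M | i₀ ∈ st.rows.active} :=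
    measurable_rows (measurableSet_mem_active i₀)
  have h2 : MeasurableSet {st : State N M | j₀ ∈ st.cols.active} :=
    measurable_cols (measurableSet_mem_active j₀)
  have h3 : Measurable fun st : State N M => st.rowPhase :=
    measurable_of_disc (fun d => d.val.1) fun _ => rfl
  have h4 : MeasurableSet {st : State N M | st.rowPhase = false} :=
    h3 (measurableSet_singleton false)
  have h5 : MeasurableSet {st : State N M |
      i₀ ∈ st.rows.active ∧ (st.rowPhase = false → j₀ ∈ st.cols.active)} :=
    h1.inter (h4.imp h2)
  exact Algorithm.measurable_seed_history (pairElim_isMeasurable N M δ) t (listMeasurable_after δ) h5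

theorem next_eq_inr {st : State N M} (hst : st.Coherent) {p : Fin N × Fin M}
    (h : st.next = Sum.inr p) : st.result = some p := by
  unfold next at h
  rcases hr : st.result with _ | q
  · simp only [hr] at h
    have hc := hst.todo_of_none hr
    rcases hR : st.todoRows with _ | ⟨p', l⟩
    · rcases hC : st.todoCols with _ | ⟨p', l⟩
      · exact absurd hC hc
      · simp [hR, hC] at h
    · simp [hR] at h
  · simp only [hr, Sum.inr.injEq] at h
    rw [h]

theorem outputEvent_subset_bestSurvives (δ : ℝ) (i₀ : Fin N) (j₀ : Fin M) :
    (pairElim N M δ).outputEvent (i₀, j₀) ⊆ bestSurvives δ i₀ j₀ := by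
  rintro ⟨x, ξ⟩ ⟨T, hT⟩ t
  simp only
  have hco := coherent_after δ ξ ((pairElim N M δ).history x ξ T)
  have hres := next_eq_inr hco hT
  obtain ⟨hph, hcard, hp⟩ := hco.of_some _ hres
  obtain ⟨hp1, hp2⟩ := Prod.ext_iff.1 hp
  have hsuf : (pairElim N M δ).history x ξ t <:+ (pairElim N M δ).history x ξ T := by
    rcases le_total t T with h | h
    · exact (pairElim N M δ).history_suffix x ξ h
    · rw [(pairElim N M δ).history_of_inr hT h]
  generalize (pairElim N M δ).history x ξ t = L' at *
  generalize (pairElim N M δ).history x ξ T = L at *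
  have hi : i₀ ∈ (after δ ξ L).rows.active := by
    rw [show i₀ = _ from hp1]
    exact Elim.rep_mem_active _ _
  have hj : j₀ ∈ (after δ ξ L).cols.active := by
    rw [show j₀ = _ from hp2]
    exact Elim.rep_mem_active _ _
  refine ⟨(row_path δ ξ).active_subset hsuf rfl hi, fun hf => ?_⟩
  refine (col_path δ ξ).active_subset hsuf ?_ hj
  simp [colView, colEpoch, hf, hph]

theorem mem_outputEvent_of_bestSurvives {q : RewardTable N M × (pairElim N M δ).Seed}
    (hq : q ∈ bestSurvives δ i₀ j₀) (hτ : (pairElim N M δ).stoppingTime q.1 q.2 ≠ ⊤) :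
    q ∈ (pairElim N M δ).outputEvent (i₀, j₀) := by
  obtain ⟨x, ξ⟩ := q
  have : ∃ t p, (pairElim N M δ).action ξ ((pairElim N M δ).history x ξ t) = Sum.inr p := by
    by_contra hno
    push Not at hno
    refine hτ ?_
    unfold Algorithm.stoppingTime
    simp [hno]
  obtain ⟨t, p, ht⟩ := this
  refine ⟨t, ?_⟩
  have hco := coherent_after δ ξ ((pairElim N M δ).history x ξ t)
  have hres := next_eq_inr hco ht
  obtain ⟨hph, hcard, hp⟩ := hco.of_some _ hres
  obtain ⟨hi, hj⟩ := hq t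
  have h1 : (after δ ξ ((pairElim N M δ).history x ξ t)).rows.rep 0 = i₀ :=
    Finset.card_le_one.1 (hco.card_rows hph).le _ (Elim.rep_mem_active _ _) _ hi
  have h2 : (after δ ξ ((pairElim N M δ).history x ξ t)).cols.rep 0 = j₀ :=
    Finset.card_le_one.1 hcard.le _ (Elim.rep_mem_active _ _) _ (hj hph)
  rw [h1, h2] at hp
  rw [← hp]
  exact ht

theorem measure_compl_bestSurvives_le (hδ : 0 < δ) (hδ1 : δ < 1) (h : IsInstance u v i₀ j₀)
    [∀ q, IsProbabilityMeasure (F q)] (hF : IsSubgaussianModel u v F) :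
    (pairElim N M δ).runLaw (Measure.infinitePi F) (bestSurvives δ i₀ j₀)ᶜ ≤ ENNReal.ofReal δ := by
  have hA := pairElim_isMeasurable N M δ
  have hβ := admissible_sureBeta (N := N) (M := M) hδ hδ1
  have hR := noisySide_rows δ hF
  have hC := noisySide_cols δ hF
  have hβ' : Admissible (colEpochBeta N M δ ⊤) := by rwa [colEpochBeta_top]
  have hsub : (bestSurvives δ i₀ j₀)ᶜ ⊆ ⋃ l : ℕ,
      ((pairElim N M δ).confFail (rowPath N M δ) (fun i j => u i * v j) (sureBeta N M δ) 0 i₀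
        (l + 1) ∪ (pairElim N M δ).confFail (colPath N M δ) (fun j i => u i * v j)
        (colEpochBeta N M δ ⊤) ⊤ j₀ (l + 1)) := by
    intro q hq
    by_contra hno
    simp only [Set.mem_iUnion, Set.mem_union, not_exists, not_or] at hno
    refine hq fun t => ⟨?_, fun hph => ?_⟩
    · refine (hR.sound (b := i₀) (w := 0) h.mul_le_mul_best_row (q := q) (fun l hl _ => ?_)
        (t := t) rfl).1
      obtain ⟨l, rfl⟩ := Nat.exists_eq_succ_of_ne_zero hl.ne'
      exact (hno l).1
    · refine (hC.sound (b := j₀) (w := ⊤) h.mul_le_mul_best_col (q := q) (fun l hl _ => ?_)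
        (t := t) ?_).1
      · obtain ⟨l, rfl⟩ := Nat.exists_eq_succ_of_ne_zero hl.ne'
        exact (hno l).2
      · simp [colPath, colView, colEpoch, hph]
  refine (measure_mono hsub).trans ((measure_iUnion_le _).trans ?_)
  refine le_trans (ENNReal.tsum_le_tsum fun l => (measure_union_le _ _).trans
    (add_le_add (hR.measure_confFail_le hA (w := 0) hβ i₀ (Nat.succ_pos l))
      (hC.measure_confFail_le hA hβ' j₀ (Nat.succ_pos l)))) ?_
  rw [colEpochBeta_top]
  exact tsum_sureBeta_le N M hδ

/-! ### Rounds that separate two items -/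

/-- In the first phase, the best column is the only active one and the rows `a` and `b` are
active. -/
def RowPair (j₀ : Fin M) (a b : Fin N) (st : State N M) : Prop :=
  st.rowPhase = true ∧ st.cols.active = {j₀} ∧ a ∈ st.rows.active ∧ b ∈ st.rows.active

/-- In the second phase, the row `i` is the only active one and the columns `a` and `b` are
active. -/
def ColPair (i : Fin N) (a b : Fin M) (st : State N M) : Prop :=
  st.rowPhase = false ∧ st.rows.active = {i} ∧ a ∈ st.cols.active ∧ b ∈ st.cols.active

/-- In the window `w`, the columns `a` and `b` are active. -/
def WindowPair (w : ℕ) (a b : Fin M) (st : State N M) : Prop :=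
  st.rowPhase = true ∧ st.window = w ∧ a ∈ st.cols.active ∧ b ∈ st.cols.active

/-- In the first phase, some column other than `j₀` is active. -/
def Unsettled (j₀ : Fin M) (st : State N M) : Prop :=
  st.rowPhase = true ∧ st.cols.active ≠ {j₀}

theorem rounds_rowPair_le (hδ : 0 < δ) (hδ1 : δ < 1) (hF : IsSubgaussianModel u v F)
    {a b : Fin N} {j : Fin M} {g : ℝ} (hg : u a * v j + g ≤ u b * v j) {l₀ : ℕ} (hl : 0 < l₀)
    (hr : (1 / 2 : ℝ) ^ (l₀ + 1) < g / 4) (q : RewardTable N M × (pairElim N M δ).Seed) (t : ℕ) :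
    (rounds δ q.2 (RowPair j a b) ((pairElim N M δ).history q.1 q.2 t) : ℝ≥0∞) ≤
      Algorithm.NoisySide.sepBound (pairElim N M δ) (rowPath N M δ) (fun i j => u i * v j)
        (sureBeta N M δ) 0 (some j) a b g l₀ q := by
  classical
  refine (noisySide_rows δ hF).roundSum_le_sepBound (w := 0) (fun k hk => ?_)
    (admissible_sureBeta hδ hδ1) hl hr (fun L => by split_ifs <;> omega) (fun L hL hne => ?_) t
  · obtain rfl : j = k := by simpa using hk
    exact hg
  · have hP : RowPair j a b (after δ q.2 L) := by
      by_contra hn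
      exact hne (if_neg hn)
    obtain ⟨-, ⟨k, hk, hR⟩, -⟩ := todo_of_isStart hL
    obtain ⟨-, hc, ha, hb⟩ := hP
    refine ⟨rfl, ha, hb, ?_⟩
    rw [hc, Finset.mem_singleton] at hk
    subst hk
    simp only [rowPath, rowView, hR]
    rw [SideState.countP_plan, if_pos ⟨ha, Or.inr rfl⟩]

theorem rounds_colPair_le (hδ : 0 < δ) (hδ1 : δ < 1) (hF : IsSubgaussianModel u v F)
    {a b : Fin M} {i : Fin N} {g : ℝ} (hg : u i * v a + g ≤ u i * v b) {l₀ : ℕ} (hl : 0 < l₀)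
    (hr : (1 / 2 : ℝ) ^ (l₀ + 1) < g / 4) (q : RewardTable N M × (pairElim N M δ).Seed) (t : ℕ) :
    (rounds δ q.2 (ColPair i a b) ((pairElim N M δ).history q.1 q.2 t) : ℝ≥0∞) ≤
      Algorithm.NoisySide.sepBound (pairElim N M δ) (colPath N M δ) (fun j i => u i * v j)
        (sureBeta N M δ) ⊤ (some i) a b g l₀ q := by
  classical
  rw [← colEpochBeta_top]
  refine (noisySide_cols δ hF).roundSum_le_sepBound (w := ⊤) (fun k hk => ?_)
    (by rw [colEpochBeta_top]; exact admissible_sureBeta hδ hδ1) hl hr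
    (fun L => by split_ifs <;> omega) (fun L hL hne => ?_) t
  · obtain rfl : i = k := by simpa using hk
    exact hg
  · have hP : ColPair i a b (after δ q.2 L) := by
      by_contra hn
      exact hne (if_neg hn)
    obtain ⟨-, -, k, hk, hC⟩ := todo_of_isStart hL
    obtain ⟨hph, hc, ha, hb⟩ := hP
    refine ⟨by simp [colPath, colView, colEpoch, hph], ha, hb, ?_⟩
    rw [hc, Finset.mem_singleton] at hk
    subst hk
    simp only [colPath, colView, hC]
    rw [SideState.countP_plan, if_pos ⟨ha, Or.inr rfl⟩]

/-! ### Windows -/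

/-- In the window `w`, a confidence interval of the columns fails at a level that can be reached in
the window, or at a level below `B`. -/
def windowFail (δ : ℝ) (u : Fin N → ℝ) (v : Fin M → ℝ) (j₀ : Fin M) (B w : ℕ) :
    Set (RewardTable N M × (pairElim N M δ).Seed) :=
  ⋃ l ∈ Finset.Icc 1 (2 ^ w + (N + M) + B),
    (pairElim N M δ).confFail (colPath N M δ) (fun j i => u i * v j) (windowBeta w) w j₀ l

theorem measurableSet_windowFail (hF : IsSubgaussianModel u v F) (j₀ : Fin M) (B w : ℕ) :
    MeasurableSet (windowFail δ u v j₀ B w) :=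
  Finset.measurableSet_biUnion _ fun _ _ =>
    (noisySide_cols δ hF).measurableSet_confFail (pairElim_isMeasurable N M δ) _ _ _ _

theorem measure_windowFail_le [∀ q, IsProbabilityMeasure (F q)] (hF : IsSubgaussianModel u v F)
    (j₀ : Fin M) (B w : ℕ) :
    (pairElim N M δ).runLaw (Measure.infinitePi F) (windowFail δ u v j₀ B w) ≤
      ENNReal.ofReal ((2 ^ w + (N + M) + B : ℕ) * (M * (N + 1) * (1 / ((2 : ℝ) ^ 2 ^ w) ^ 2))) := by
  refine (measure_biUnion_finset_le _ _).trans ?_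
  have hβ : Admissible (colEpochBeta N M δ w) := by
    rw [colEpochBeta_coe]; exact admissible_windowBeta w
  have h1 : ∀ l ∈ Finset.Icc 1 (2 ^ w + (N + M) + B),
      (pairElim N M δ).runLaw (Measure.infinitePi F) ((pairElim N M δ).confFail (colPath N M δ)
        (fun j i => u i * v j) (windowBeta w) w j₀ l) ≤
      ENNReal.ofReal (M * (N + 1) * (1 / ((2 : ℝ) ^ 2 ^ w) ^ 2)) := by
    intro l hl
    have := (noisySide_cols δ hF).measure_confFail_le (pairElim_isMeasurable N M δ) hβ j₀
      (Finset.mem_Icc.1 hl).1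
    rwa [colEpochBeta_coe, windowBeta] at this
  refine (Finset.sum_le_sum h1).trans (le_of_eq ?_)
  rw [Finset.sum_const, Nat.card_Icc, nsmul_eq_mul, Nat.add_sub_cancel,
    ENNReal.ofReal_mul (p := ((2 ^ w + (N + M) + B : ℕ) : ℝ)) (by positivity),
    ENNReal.ofReal_natCast]

/-- In a window without failure, the best column is never eliminated. -/
theorem mem_active_of_not_windowFail (hF : IsSubgaussianModel u v F) (h : IsInstance u v i₀ j₀)
    {B w : ℕ} {q : RewardTable N M × (pairElim N M δ).Seed} (hq : q ∉ windowFail δ u v j₀ B w)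
    {t : ℕ} (hp : (after δ q.2 ((pairElim N M δ).history q.1 q.2 t)).rowPhase = true)
    (hw : (after δ q.2 ((pairElim N M δ).history q.1 q.2 t)).window = w) :
    j₀ ∈ (after δ q.2 ((pairElim N M δ).history q.1 q.2 t)).cols.active := by
  refine ((noisySide_cols δ hF).sound (b := j₀) (w := (w : ℕ∞)) h.mul_le_mul_best_col (q := q)
    (fun l hl hreach => ?_) (t := t) (by simp [colPath, colView, colEpoch, hp, hw])).1
  obtain ⟨t', κ, i, he, hn⟩ := hreach
  intro hfail
  rw [colEpochBeta_coe] at hfail hn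
  refine hq (Set.mem_biUnion (Finset.mem_coe.2 (Finset.mem_Icc.2 ⟨hl, ?_⟩)) hfail)
  simp only [colPath, colView, colEpoch] at he hn
  have hp' : (after δ q.2 ((pairElim N M δ).history q.1 q.2 t')).rowPhase = true := by
    by_contra hno
    rw [if_neg hno] at he
    exact ENat.natCast_ne_top w he.symm
  rw [if_pos hp'] at he
  have hw' : (after δ q.2 ((pairElim N M δ).history q.1 q.2 t')).window = w := by exact_mod_cast he
  have h1 := num_le_spent δ q.2 _ hp' κ i
  have h2 := spent_add_le δ q.2 _ hp'
  rw [hn] at h1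
  rw [hw'] at h2
  have h3 : (4 : ℝ) ^ l ≤ Elim.level (windowBeta w) l :=
    (admissible_windowBeta w).four_pow_le_level hl
  have h4 : 4 ^ l ≤ Elim.level (windowBeta w) l := by exact_mod_cast h3
  have h5 : 2 ^ (2 ^ w) + (N + M) ≤ 2 ^ (2 ^ w + (N + M)) := by
    rw [pow_add]
    have h6 : N + M < 2 ^ (N + M) := Nat.lt_two_pow_self
    have h7 : 0 < 2 ^ (2 ^ w) := by positivity
    nlinarith
  have h8 : 2 ^ l ≤ 2 ^ (2 ^ w + (N + M)) :=
    (Nat.pow_le_pow_left (by norm_num) l).trans (h4.trans (h1.trans (by omega)))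
  have h9 := (Nat.pow_le_pow_iff_right (by norm_num)).1 h8
  omega

/-- In a window without failure, the number of rounds with several active columns is of the order
of the logarithm of the length of the window. -/
theorem rounds_unsettled_window_le (hF : IsSubgaussianModel u v F) (h : IsInstance u v i₀ j₀)
    {B w l : ℕ} {g : ℝ} (hg : ∀ b, b ≠ j₀ → ∀ k, u k * v b + g ≤ u k * v j₀) (hl : 0 < l)
    (hlB : l ≤ B) (hr : (1 / 2 : ℝ) ^ (l + 1) < g / 4)
    {q : RewardTable N M × (pairElim N M δ).Seed} (hq : q ∉ windowFail δ u v j₀ B w) (t : ℕ) :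
    rounds δ q.2 (fun st => Unsettled j₀ st ∧ st.window = w)
      ((pairElim N M δ).history q.1 q.2 t) ≤ M * (4 ^ (l + 2) * 2 ^ w) := by
  classical
  have hβ := admissible_windowBeta w
  have hβ' : Admissible (colEpochBeta N M δ w) := by rwa [colEpochBeta_coe]
  have hlevel : Elim.level (windowBeta w) l ≤ 4 ^ (l + 2) * 2 ^ w := by
    have h1 := hβ.level_le hl
    have h2 : Real.log (windowBeta w l) ≤ 2 ^ w := by
      rw [windowBeta, Real.log_pow]
      push_cast
      have := Real.log_two_lt_d9
      have h3 : (0 : ℝ) < 2 ^ w := by positivity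
      nlinarith
    have h3 : (Elim.level (windowBeta w) l : ℝ) ≤ 4 ^ (l + 2) * 2 ^ w := by
      have h4 : (1 : ℝ) ≤ 4 ^ (l + 1) := one_le_pow₀ (by norm_num)
      have h5 : (1 : ℝ) ≤ 2 ^ w := one_le_pow₀ (by norm_num)
      calc (Elim.level (windowBeta w) l : ℝ) ≤ 4 ^ (l + 1) * 2 ^ w + 1 := by
            refine h1.trans ?_; gcongr
        _ ≤ 4 ^ (l + 1) * 2 ^ w + 4 ^ (l + 1) * 2 ^ w := by nlinarith
        _ ≤ 4 ^ (l + 2) * 2 ^ w := by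
            rw [pow_succ (4 : ℝ) (l + 1)]; nlinarith [mul_pos (zero_lt_one.trans_le h4)
              (zero_lt_one.trans_le h5)]
    exact_mod_cast h3
  have hpair : ∀ b ∈ Finset.univ.filter (fun b => b ≠ j₀), rounds δ q.2 (WindowPair w b j₀)
      ((pairElim N M δ).history q.1 q.2 t) ≤ 4 ^ (l + 2) * 2 ^ w := by
    intro b hb
    have hb : b ≠ j₀ := (Finset.mem_filter.1 hb).2
    have hr' : Elim.radius (windowBeta w) l < g / 4 := lt_of_le_of_lt (hβ.radius_le hl) hr
    refine le_trans ?_ hlevel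
    rw [← colEpochBeta_coe (N := N) (M := M) (δ := δ)] at hr' ⊢
    refine (noisySide_cols δ hF).roundSum_le_level (w := (w : ℕ∞)) (κ := none) (b := j₀)
      (fun k _ => hg b hb k) hβ' hl hr' (fun L => by split_ifs <;> omega) (fun L hL hne => ?_)
      (fun hfail => ?_) t
    · have hP : WindowPair w b j₀ (after δ q.2 L) := by
        by_contra hn
        exact hne (if_neg hn)
      obtain ⟨-, -, k, hk, hC⟩ := todo_of_isStart hL
      obtain ⟨hph, hw, ha, hb⟩ := hP
      refine ⟨by simp [colPath, colView, colEpoch, hph, hw], ha, hb, ?_⟩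
      simp only [colPath, colView, hC]
      rw [SideState.countP_plan, if_pos ⟨ha, Or.inl rfl⟩]
    · have := Algorithm.sepFail_subset_confFail _ _ _ _ _ hb hr'.le hfail
      rw [colEpochBeta_coe] at this
      exact hq (Set.mem_biUnion (Finset.mem_coe.2 (Finset.mem_Icc.2
        ⟨hl, hlB.trans (Nat.le_add_left _ _)⟩)) this)
  refine (rounds_le_sum (Finset.univ.filter fun b => b ≠ j₀) (Q := fun b => WindowPair w b j₀)
    fun L' hL' _ hP => ?_).trans ((Finset.sum_le_card_nsmul _ _ _ hpair).trans ?_)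
  · obtain ⟨⟨hph, hne⟩, hw⟩ := hP
    obtain ⟨t', -, rfl⟩ := (pairElim N M δ).exists_history_eq_of_suffix q.1 q.2 t L' hL'
    have hj := mem_active_of_not_windowFail hF h hq hph hw
    obtain ⟨b, hb, hbj⟩ : ∃ b ∈ (after δ q.2 ((pairElim N M δ).history q.1 q.2 t')).cols.active,
        b ≠ j₀ := by
      by_contra hno
      push Not at hno
      exact hne (Finset.eq_singleton_iff_unique_mem.2 ⟨hj, hno⟩)
    exact ⟨b, by simp [hbj], hph, hw, hb, hj⟩
  · rw [smul_eq_mul]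
    exact Nat.mul_le_mul_right _ ((Finset.card_le_univ _).trans_eq (Fintype.card_fin M))

end State

/-! ### The length of a run -/

/-- If a number is at most `G` plus a multiple of its logarithm, it is at most `2 G` plus a
constant. -/
theorem le_of_le_add_pow {len G K W : ℕ} (h : len ≤ G + K * 2 ^ (W + 1))
    (hW : ∀ w < W, 2 ^ (2 ^ w) < len) :
    (len : ℝ) ≤ 2 * G + (8 * K + 1 + 16 * K * |Real.log (16 * K)|) := by
  -- The last full window `W - 1` has more than `2 ^ 2 ^ (W - 1)` samples.
  have hpow : (2 : ℝ) ^ (W + 1) ≤ 4 + 8 * Real.log (1 + len) := by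
    rcases Nat.eq_zero_or_pos W with rfl | hW0
    · have : 0 ≤ Real.log (1 + (len : ℝ)) := Real.log_nonneg (by simp)
      norm_num
      linarith
    · obtain ⟨W, rfl⟩ := Nat.exists_eq_succ_of_ne_zero hW0.ne'
      have h1 := hW W (Nat.lt_succ_self W)
      have h2 : (2 : ℝ) ^ (2 ^ W) ≤ 1 + len := by
        have : ((2 ^ (2 ^ W) : ℕ) : ℝ) < len := by exact_mod_cast h1
        push_cast at this
        linarith
      have h3 := Real.log_le_log (by positivity) h2
      rw [Real.log_pow] at h3
      push_cast at h3
      have h4 := Real.log_two_gt_d9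
      have h5 : (0 : ℝ) < 2 ^ W := by positivity
      have h6 : (2 : ℝ) ^ (W.succ + 1) = 4 * 2 ^ W := by
        rw [Nat.succ_eq_add_one, pow_succ, pow_succ]; ring
      rw [h6]
      nlinarith
  have hlen : (len : ℝ) ≤ G + K * (4 + 8 * Real.log (1 + len)) := by
    have : (len : ℝ) ≤ G + K * 2 ^ (W + 1) := by exact_mod_cast h
    refine this.trans ?_
    gcongr
  have hlog : 8 * K * Real.log (1 + len) ≤ (1 + len) / 2 + 8 * K * |Real.log (16 * K)| := by
    rcases Nat.eq_zero_or_pos K with rfl | hK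
    · simp only [Nat.cast_zero, mul_zero, zero_mul, add_zero]
      positivity
    · have hK' : (0 : ℝ) < 16 * K := by positivity
      have h1 : (0 : ℝ) < (1 + len) / (16 * K) := by positivity
      have h2 := Real.log_le_sub_one_of_pos h1
      rw [Real.log_div (by positivity) hK'.ne'] at h2
      have h3 := le_abs_self (Real.log (16 * K))
      have h4 : Real.log (1 + len) ≤ (1 + len) / (16 * K) + |Real.log (16 * K)| := by linarith
      calc 8 * K * Real.log (1 + len) ≤
          8 * K * ((1 + len) / (16 * K) + |Real.log (16 * K)|) := by gcongr
        _ = _ := by field_simp; ring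
  nlinarith

theorem sum_range_two_pow_le (n : ℕ) : ∑ w ∈ Finset.range n, 2 ^ w ≤ 2 ^ n := by
  induction n with
  | zero => simp
  | succ n ih =>
    rw [Finset.sum_range_succ, pow_succ]
    omega

theorem card_le_sum_ne_add_one {ι : Type*} [Fintype ι] [DecidableEq ι] (s : Finset ι) (x : ι) :
    s.card ≤ ∑ a with a ≠ x, (if a ∈ s then 1 else 0) + 1 := by
  have h : s.erase x ⊆ Finset.univ.filter (fun a => a ≠ x ∧ a ∈ s) := fun a ha => by
    simpa using Finset.mem_erase.1 ha
  have h1 := Finset.card_le_card h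
  have h2 := Finset.pred_card_le_card_erase (s := s) (a := x)
  rw [Finset.sum_boole, Finset.filter_filter, Nat.cast_id]
  omega

namespace State

variable {N M : ℕ} [NeZero N] [NeZero M] {δ : ℝ} {u : Fin N → ℝ} {v : Fin M → ℝ}
  {F : Fin N × Fin M × ℕ → Measure ℝ} {i₀ : Fin N} {j₀ : Fin M}

theorem window_le_of_suffix (δ : ℝ) (ξ : ℕ → Fin N × Fin M) {L L' : List ℝ} (h : L' <:+ L) :
    (after δ ξ L').window ≤ (after δ ξ L).window := by
  induction L with
  | nil => rw [List.suffix_nil.1 h]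
  | cons y L ih =>
    rcases List.suffix_cons_iff.1 h with rfl | h
    · exact le_rfl
    · refine (ih h).trans ?_
      have hs := after_step δ ξ y L
      generalize after δ ξ (y :: L) = st' at *
      generalize newRound δ ξ y L = ρ at *
      cases hs with
      | window => exact Nat.le_succ _
      | _ => exact le_rfl

open Classical in
/-- The number of rounds in which the columns are unsettled, in terms of the index of the last
window. -/
theorem rounds_unsettled_le (hF : IsSubgaussianModel u v F) (h : IsInstance u v i₀ j₀)
    {l : ℕ} {g : ℝ} (hg : ∀ b, b ≠ j₀ → ∀ k, u k * v b + g ≤ u k * v j₀) (hl : 0 < l)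
    (hr : (1 / 2 : ℝ) ^ (l + 1) < g / 4)
    (q : RewardTable N M × (pairElim N M δ).Seed) (t : ℕ) :
    rounds δ q.2 (Unsettled j₀) ((pairElim N M δ).history q.1 q.2 t) ≤
      ∑ w ∈ Finset.range ((after δ q.2 ((pairElim N M δ).history q.1 q.2 t)).window + 1),
        (if q ∈ windowFail δ u v j₀ l w then 2 ^ (2 ^ w) + 1 else 0) +
      M * 4 ^ (l + 2) *
        2 ^ ((after δ q.2 ((pairElim N M δ).history q.1 q.2 t)).window + 1) := by
  set L := (pairElim N M δ).history q.1 q.2 t with hL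
  set W := (after δ q.2 L).window + 1 with hW
  have h1 : rounds δ q.2 (Unsettled j₀) L ≤ ∑ w ∈ Finset.range W,
      rounds δ q.2 (fun st => Unsettled j₀ st ∧ st.window = w) L := by
    refine rounds_le_sum _ fun L' hL' _ hP => ⟨_, Finset.mem_range.2 ?_, hP, rfl⟩
    exact Nat.lt_succ_of_le (window_le_of_suffix δ q.2 hL')
  refine h1.trans ?_
  have h2 : ∀ w ∈ Finset.range W, rounds δ q.2 (fun st => Unsettled j₀ st ∧ st.window = w) L ≤
      (if q ∈ windowFail δ u v j₀ l w then 2 ^ (2 ^ w) + 1 else 0) +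
        M * 4 ^ (l + 2) * 2 ^ w := by
    intro w _
    split_ifs with hq
    · refine le_trans (le_trans ?_ (rounds_window_le δ q.2 w L)) (Nat.le_add_right _ _)
      refine roundSum_le fun L' _ _ => ?_
      split_ifs with h3 h4
      · exact le_rfl
      · exact absurd ⟨h3.1.1, h3.2⟩ h4
      · exact Nat.zero_le _
      · exact le_rfl
    · rw [zero_add, mul_assoc]
      exact rounds_unsettled_window_le hF h hg hl le_rfl hr hq t
  refine (Finset.sum_le_sum h2).trans ?_
  rw [Finset.sum_add_distrib, ← Finset.mul_sum]
  gcongr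
  exact sum_range_two_pow_le W

/-- On the event that the best pair survives, every sample is paid by the separation of an item from
the best one, up to the unsettled rounds. -/
theorem length_le_of_bestSurvives {q : RewardTable N M × (pairElim N M δ).Seed}
    (hq : q ∈ bestSurvives δ i₀ j₀) (t : ℕ) :
    ((pairElim N M δ).history q.1 q.2 t).length ≤
      3 * ∑ a with a ≠ i₀,
          rounds δ q.2 (RowPair j₀ a i₀) ((pairElim N M δ).history q.1 q.2 t) +
        3 * ∑ b with b ≠ j₀,
          rounds δ q.2 (ColPair i₀ b j₀) ((pairElim N M δ).history q.1 q.2 t) + 4 +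
        (N + M) * rounds δ q.2 (Unsettled j₀) ((pairElim N M δ).history q.1 q.2 t) := by
  classical
  have h1 := length_eq_roundSum (live_history q.1 q.2 t)
  have h2 := rounds_single_row_le δ q.2 ((pairElim N M δ).history q.1 q.2 t)
  have h3 := rounds_single_col_le δ q.2 ((pairElim N M δ).history q.1 q.2 t)
  have hS : ∀ L', L' <:+ (pairElim N M δ).history q.1 q.2 t → i₀ ∈ (after δ q.2 L').rows.active ∧
      ((after δ q.2 L').rowPhase = false → j₀ ∈ (after δ q.2 L').cols.active) := by
    intro L' hL'
    obtain ⟨t', -, rfl⟩ := (pairElim N M δ).exists_history_eq_of_suffix q.1 q.2 t L' hL'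
    exact hq t'
  generalize (pairElim N M δ).history q.1 q.2 t = L at *
  have key : roundSum (newRound δ q.2)
      (fun L => (after δ q.2 L).rows.active.card + (after δ q.2 L).cols.active.card) L ≤
      roundSum (newRound δ q.2) (fun L =>
        3 * ∑ a with a ≠ i₀, (if RowPair j₀ a i₀ (after δ q.2 L) then 1 else 0) +
        3 * ∑ b with b ≠ j₀, (if ColPair i₀ b j₀ (after δ q.2 L) then 1 else 0) +
        2 * (if (after δ q.2 L).rowPhase = true ∧ (after δ q.2 L).rows.active.card = 1
          then 1 else 0) +
        2 * (if (after δ q.2 L).rowPhase = false ∧ (after δ q.2 L).cols.active.card = 1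
          then 1 else 0) +
        (N + M) * (if Unsettled j₀ (after δ q.2 L) then 1 else 0)) L := by
    refine roundSum_le fun L' hL' _ => ?_
    obtain ⟨hi, hj⟩ := hS L' hL'
    have hco := coherent_after δ q.2 L'
    generalize after δ q.2 L' = st at *
    cases hp : st.rowPhase with
    | true =>
      by_cases hc : st.cols.active = {j₀}
      · -- A round with `k + 1` active rows and one active column takes `k + 2` samples, which is
        -- at most `3 k` unless `k = 0`.
        have h4 : ∀ a, RowPair j₀ a i₀ st ↔ a ∈ st.rows.active := fun a =>
          ⟨fun h => h.2.2.1, fun h => ⟨hp, hc, h, hi⟩⟩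
        have h5 := card_le_sum_ne_add_one st.rows.active i₀
        have h6 : st.cols.active.card = 1 := by rw [hc, Finset.card_singleton]
        have h7 : 0 < st.rows.active.card := Finset.card_pos.2 ⟨_, hi⟩
        simp only [h4, h6, true_and]
        split_ifs <;> omega
      · have h4 : Unsettled j₀ st := ⟨hp, hc⟩
        have h5 := card_active_le st.rows
        have h6 := card_active_le st.cols
        rw [if_pos h4]
        omega
    | false =>
      have h6 := hco.card_rows hp
      have hrow : st.rows.active = {i₀} := by
        obtain ⟨x, hx⟩ := Finset.card_eq_one.1 h6
        rw [hx, Finset.mem_singleton] at hi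
        rw [hx, hi]
      have h4 : ∀ b, ColPair i₀ b j₀ st ↔ b ∈ st.cols.active := fun b =>
        ⟨fun h => h.2.2.1, fun h => ⟨hp, hrow, h, hj hp⟩⟩
      have h5 := card_le_sum_ne_add_one st.cols.active j₀
      have h7 : 0 < st.cols.active.card := Finset.card_pos.2 ⟨_, hj hp⟩
      simp only [h4, h6, true_and]
      split_ifs <;> omega
  rw [← h1, roundSum_add, roundSum_add, roundSum_add, roundSum_add, roundSum_const_mul,
    roundSum_const_mul, roundSum_const_mul, roundSum_const_mul, roundSum_const_mul,
    roundSum_finset_sum, roundSum_finset_sum] at key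
  have h2' : roundSum (newRound δ q.2) (fun L => if (after δ q.2 L).rowPhase = true ∧
      (after δ q.2 L).rows.active.card = 1 then 1 else 0) L ≤ 1 :=
    (rounds_eq (δ := δ) (ξ := q.2) _ L).symm.trans_le h2
  have h3' : roundSum (newRound δ q.2) (fun L => if (after δ q.2 L).rowPhase = false ∧
      (after δ q.2 L).cols.active.card = 1 then 1 else 0) L ≤ 1 :=
    (rounds_eq (δ := δ) (ξ := q.2) _ L).symm.trans_le h3
  unfold rounds
  omega

/-- If the entries of `u` are pairwise distinct and those of `v` as well, every sample is paid by
the separation of two items, up to the unsettled rounds. -/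
theorem length_le_of_injective (hu : Function.Injective u) (hv : Function.Injective v)
    (j₀ : Fin M) (q : RewardTable N M × (pairElim N M δ).Seed) (t : ℕ) :
    ((pairElim N M δ).history q.1 q.2 t).length ≤
      (N + M) * (∑ p : Fin N × Fin N with u p.1 < u p.2,
          rounds δ q.2 (RowPair j₀ p.1 p.2) ((pairElim N M δ).history q.1 q.2 t) +
        ∑ p : Fin N × Fin M × Fin M with v p.2.1 < v p.2.2,
          rounds δ q.2 (ColPair p.1 p.2.1 p.2.2) ((pairElim N M δ).history q.1 q.2 t) + 2) +
        (N + M) * rounds δ q.2 (Unsettled j₀) ((pairElim N M δ).history q.1 q.2 t) := by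
  classical
  have h1 := length_eq_roundSum (live_history q.1 q.2 t)
  have h2 := rounds_single_row_le δ q.2 ((pairElim N M δ).history q.1 q.2 t)
  have h3 := rounds_single_col_le δ q.2 ((pairElim N M δ).history q.1 q.2 t)
  generalize (pairElim N M δ).history q.1 q.2 t = L at *
  have ordered : ∀ {n : ℕ} {f : Fin n → ℝ}, Function.Injective f → ∀ {s : Finset (Fin n)},
      s.Nonempty → s.card ≠ 1 → ∃ a ∈ s, ∃ b ∈ s, f a < f b := by
    intro n f hf s hs hc
    have h2 : 1 < s.card := by
      have := Finset.card_pos.2 hs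
      omega
    obtain ⟨a, ha, b, hb, hab⟩ := Finset.one_lt_card.1 h2
    rcases lt_or_gt_of_ne (fun h => hab (hf h)) with h | h
    · exact ⟨a, ha, b, hb, h⟩
    · exact ⟨b, hb, a, ha, h⟩
  have key : roundSum (newRound δ q.2)
      (fun L => (after δ q.2 L).rows.active.card + (after δ q.2 L).cols.active.card) L ≤
      roundSum (newRound δ q.2) (fun L => (N + M) * (
        ∑ p : Fin N × Fin N with u p.1 < u p.2,
          (if RowPair j₀ p.1 p.2 (after δ q.2 L) then 1 else 0) +
        ∑ p : Fin N × Fin M × Fin M with v p.2.1 < v p.2.2,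
          (if ColPair p.1 p.2.1 p.2.2 (after δ q.2 L) then 1 else 0) +
        (if (after δ q.2 L).rowPhase = true ∧ (after δ q.2 L).rows.active.card = 1
          then 1 else 0) +
        (if (after δ q.2 L).rowPhase = false ∧ (after δ q.2 L).cols.active.card = 1
          then 1 else 0) +
        (if Unsettled j₀ (after δ q.2 L) then 1 else 0))) L := by
    refine roundSum_le fun L' hL' _ => ?_
    have hco := coherent_after δ q.2 L'
    generalize after δ q.2 L' = st at *
    refine (add_le_add (card_active_le st.rows) (card_active_le st.cols)).trans ?_
    -- A round takes at most `N + M` samples, so it suffices that one of the indicators is `1`.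
    refine Nat.le_mul_of_pos_right _ ?_
    cases hp : st.rowPhase with
    | true =>
      by_cases hc : st.cols.active = {j₀}
      · by_cases h1 : st.rows.active.card = 1
        · rw [if_pos (c := true = true ∧ st.rows.active.card = 1) ⟨rfl, h1⟩]
          omega
        · obtain ⟨a, ha, b, hb, hab⟩ := ordered hu st.rows.active_nonempty h1
          have h4 := Finset.single_le_sum (s := Finset.univ.filter
            fun p : Fin N × Fin N => u p.1 < u p.2)
            (f := fun p => if RowPair j₀ p.1 p.2 st then 1 else 0) (fun _ _ => Nat.zero_le _)
            (a := (a, b)) (by simpa using hab)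
          simp only [if_pos (show RowPair j₀ a b st from ⟨hp, hc, ha, hb⟩)] at h4
          omega
      · rw [if_pos (show Unsettled j₀ st from ⟨hp, hc⟩)]
        omega
    | false =>
      obtain ⟨i, hi⟩ := Finset.card_eq_one.1 (hco.card_rows hp)
      by_cases h1 : st.cols.active.card = 1
      · rw [if_pos (c := false = false ∧ st.cols.active.card = 1) ⟨rfl, h1⟩]
        omega
      · obtain ⟨a, ha, b, hb, hab⟩ := ordered hv st.cols.active_nonempty h1
        have h4 := Finset.single_le_sum (s := Finset.univ.filter
          fun p : Fin N × Fin M × Fin M => v p.2.1 < v p.2.2)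
          (f := fun p => if ColPair p.1 p.2.1 p.2.2 st then 1 else 0) (fun _ _ => Nat.zero_le _)
          (a := (i, a, b)) (by simpa using hab)
        simp only [if_pos (show ColPair i a b st from ⟨hp, hi, ha, hb⟩)] at h4
        omega
  rw [← h1, roundSum_const_mul, roundSum_add, roundSum_add, roundSum_add, roundSum_add,
    roundSum_finset_sum, roundSum_finset_sum] at key
  have h2' : roundSum (newRound δ q.2) (fun L => if (after δ q.2 L).rowPhase = true ∧
      (after δ q.2 L).rows.active.card = 1 then 1 else 0) L ≤ 1 :=
    (rounds_eq (δ := δ) (ξ := q.2) _ L).symm.trans_le h2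
  have h3' : roundSum (newRound δ q.2) (fun L => if (after δ q.2 L).rowPhase = false ∧
      (after δ q.2 L).cols.active.card = 1 then 1 else 0) L ≤ 1 :=
    (rounds_eq (δ := δ) (ξ := q.2) _ L).symm.trans_le h3
  rw [← mul_add]
  refine le_trans (by omega) (key.trans (Nat.mul_le_mul_left _ ?_))
  unfold rounds
  omega

end State

/-! ### Expectations -/

theorem IsInstance.exists_col_gap {N M : ℕ} [NeZero N] [NeZero M] {u : Fin N → ℝ} {v : Fin M → ℝ}
    {i₀ : Fin N} {j₀ : Fin M} (h : IsInstance u v i₀ j₀) : ∃ g : ℝ, 0 < g ∧ g < 1 ∧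
      ∀ b, b ≠ j₀ → ∀ k, u k * v b + g ≤ u k * v j₀ := by
  let f : Fin M × Fin N → ℝ := fun x => if x.1 = j₀ then 1 / 2 else u x.2 * (v j₀ - v x.1)
  have hf : ∀ x, 0 < f x := fun x => by
    simp only [f]
    split_ifs with hx
    · norm_num
    · exact mul_pos (h.row_mem _).1 (sub_pos.2 (h.col_best _ hx))
  obtain ⟨x, hx⟩ := Finite.exists_min f
  refine ⟨min (f x) (1 / 2), lt_min (hf x) (by norm_num),
    lt_of_le_of_lt (min_le_right _ _) (by norm_num), fun b hb k => ?_⟩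
  have h1 := (min_le_left (f x) (1 / 2)).trans (hx (b, k))
  have h2 : f (b, k) = u k * (v j₀ - v b) := if_neg hb
  rw [h2] at h1
  linarith

namespace State

variable {N M : ℕ} [NeZero N] [NeZero M] {u : Fin N → ℝ} {v : Fin M → ℝ} {i₀ : Fin N} {j₀ : Fin M}

theorem two_mul_le_two_pow_add_one (w : ℕ) : 2 * w ≤ 2 ^ w + 1 := by
  induction w with
  | zero => norm_num
  | succ w ih =>
    rcases Nat.eq_zero_or_pos w with rfl | hw
    · norm_num
    · have : 2 ≤ 2 ^ w := by
        calc 2 = 2 ^ 1 := rfl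
          _ ≤ 2 ^ w := Nat.pow_le_pow_right (by norm_num) hw
      rw [pow_succ]
      omega

/-- The expected number of rounds in windows with a failure is bounded. -/
theorem tsum_windowFail_le (N M B : ℕ) :
    ∑' w : ℕ, ENNReal.ofReal ((2 ^ w + (N + M) + B : ℕ) *
      (M * (N + 1) * (1 / ((2 : ℝ) ^ 2 ^ w) ^ 2))) * ((2 ^ (2 ^ w) + 1 : ℕ) : ℝ≥0∞) ≤
      ENNReal.ofReal (8 * ((1 + (N + M) + B) * (M * (N + 1)))) := by
  have key : ∀ w : ℕ, ENNReal.ofReal ((2 ^ w + (N + M) + B : ℕ) *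
      (M * (N + 1) * (1 / ((2 : ℝ) ^ 2 ^ w) ^ 2))) * ((2 ^ (2 ^ w) + 1 : ℕ) : ℝ≥0∞) ≤
      ENNReal.ofReal (4 * ((1 + (N + M) + B) * (M * (N + 1))) * (1 / 2) ^ w) := by
    intro w
    rw [← ENNReal.ofReal_natCast, ← ENNReal.ofReal_mul (by positivity)]
    refine ENNReal.ofReal_le_ofReal ?_
    push_cast
    have hT : (1 : ℝ) ≤ 2 ^ 2 ^ w := one_le_pow₀ (by norm_num)
    have hT2 : (4 : ℝ) ^ w ≤ 2 * 2 ^ 2 ^ w := by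
      rw [show (4 : ℝ) = 2 ^ 2 by norm_num, ← pow_mul, ← pow_succ']
      exact pow_le_pow_right₀ (by norm_num) (two_mul_le_two_pow_add_one w)
    set T : ℝ := 2 ^ 2 ^ w with hTdef
    have hT0 : 0 < T := by linarith
    have hw1 : (1 : ℝ) ≤ 2 ^ w := one_le_pow₀ (by norm_num)
    have h4 : (4 : ℝ) ^ w = 2 ^ w * 2 ^ w := by rw [← mul_pow]; norm_num
    have hB : (0 : ℝ) ≤ (N : ℝ) + M + B := by positivity
    have hMN : (0 : ℝ) ≤ (M : ℝ) * (N + 1) := by positivity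
    have h1 : (2 : ℝ) ^ w + (N + M) + B ≤ (1 + (N + M) + B) * 2 ^ w := by nlinarith
    have h2 : 1 / T ^ 2 * (T + 1) ≤ 2 / T := by
      rw [one_div_mul_eq_div, div_le_div_iff₀ (by positivity) hT0]
      nlinarith
    have h3 : 2 / T * 2 ^ w ≤ 4 * (1 / 2) ^ w := by
      rw [one_div_pow, mul_one_div, div_mul_eq_mul_div,
        div_le_div_iff₀ hT0 (by positivity)]
      nlinarith
    calc (2 ^ w + (N + M) + B) * (M * (N + 1) * (1 / T ^ 2)) * (T + 1)
        = (2 ^ w + (N + M) + B) * ((M * (N + 1)) * (1 / T ^ 2 * (T + 1))) := by ring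
      _ ≤ (1 + (N + M) + B) * 2 ^ w * ((M * (N + 1)) * (2 / T)) := by gcongr
      _ = ((1 + (N + M) + B) * (M * (N + 1))) * (2 / T * 2 ^ w) := by ring
      _ ≤ ((1 + (N + M) + B) * (M * (N + 1))) * (4 * (1 / 2) ^ w) := by gcongr
      _ = _ := by ring
  refine (ENNReal.tsum_le_tsum key).trans ?_
  have hs : Summable fun w : ℕ => 4 * ((1 + (N + M) + B) * (M * (N + 1))) * (1 / 2 : ℝ) ^ w :=
    summable_geometric_two.mul_left _
  rw [← ENNReal.ofReal_tsum_of_nonneg (fun w => by positivity) hs, tsum_mul_left,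
    tsum_geometric_two]
  exact ENNReal.ofReal_le_ofReal (le_of_eq (by ring))

/-- The cost of the unsettled rounds: it is absorbed by the other samples, up to a factor `2` and
up to a variable of bounded expectation. -/
theorem exists_unsettled_bound (h : IsInstance u v i₀ j₀) : ∃ C : ℝ, 0 ≤ C ∧ ∀ δ : ℝ,
    ∀ (F : Fin N × Fin M × ℕ → Measure ℝ) [∀ q, IsProbabilityMeasure (F q)],
    IsSubgaussianModel u v F → ∃ X : RewardTable N M × (pairElim N M δ).Seed → ℝ≥0∞,
      Measurable X ∧
      ∫⁻ q, X q ∂(pairElim N M δ).runLaw (Measure.infinitePi F) ≤ ENNReal.ofReal C ∧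
      ∀ q t (G : ℕ), ((pairElim N M δ).history q.1 q.2 t).length ≤
          G + (N + M) * rounds δ q.2 (Unsettled j₀) ((pairElim N M δ).history q.1 q.2 t) →
        (((pairElim N M δ).history q.1 q.2 t).length : ℝ≥0∞) ≤ 2 * G + X q := by
  classical
  obtain ⟨g, hg, hg1, hgap⟩ := h.exists_col_gap
  obtain ⟨l, hl, hr, -⟩ := exists_level N M hg hg1
  set K := (N + M) * (M * 4 ^ (l + 2)) with hK
  set C0 : ℝ := 8 * K + 1 + 16 * K * |Real.log (16 * K)| with hC0
  set C1 : ℝ := 8 * ((1 + (N + M) + l) * (M * (N + 1))) with hC1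
  have hC0' : 0 ≤ C0 := by positivity
  have hC1' : 0 ≤ C1 := by positivity
  refine ⟨2 * (N + M : ℕ) * C1 + C0, by positivity, fun δ F _ hF => ?_⟩
  set Y : RewardTable N M × (pairElim N M δ).Seed → ℝ≥0∞ := fun q =>
    ∑' w, (windowFail δ u v j₀ l w).indicator (fun _ => ((2 ^ (2 ^ w) + 1 : ℕ) : ℝ≥0∞)) q with hY
  have hmeas : ∀ w, Measurable ((windowFail δ u v j₀ l w).indicator
      (fun _ => ((2 ^ (2 ^ w) + 1 : ℕ) : ℝ≥0∞))) := fun w =>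
    measurable_const.indicator (measurableSet_windowFail hF j₀ l w)
  have hYm : Measurable Y := Measurable.tsum hmeas
  refine ⟨fun q => 2 * (N + M : ℕ) * Y q + ENNReal.ofReal C0,
    (hYm.const_mul _).add_const _, ?_, fun q t G hlen => ?_⟩
  · have hp : IsProbabilityMeasure ((pairElim N M δ).runLaw (Measure.infinitePi F)) := by
      unfold Algorithm.runLaw; infer_instance
    have hint : ∫⁻ q, Y q ∂(pairElim N M δ).runLaw (Measure.infinitePi F) ≤ ENNReal.ofReal C1 := by
      rw [hY, lintegral_tsum fun w => (hmeas w).aemeasurable]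
      refine le_trans (ENNReal.tsum_le_tsum fun w => ?_) (tsum_windowFail_le N M l)
      rw [lintegral_indicator_const (measurableSet_windowFail hF j₀ l w), mul_comm]
      gcongr
      exact measure_windowFail_le hF j₀ l w
    rw [lintegral_add_right _ measurable_const, lintegral_const_mul _ hYm, lintegral_const,
      measure_univ, mul_one, ENNReal.ofReal_add (by positivity) hC0',
      ENNReal.ofReal_mul (by positivity), ENNReal.ofReal_mul (by norm_num),
      ENNReal.ofReal_natCast, ENNReal.ofReal_ofNat]
    gcongr
  · have h1 := rounds_unsettled_le hF h hgap hl hr q t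
    have hpast := pow_lt_length δ q.2 ((pairElim N M δ).history q.1 q.2 t)
    set L := (pairElim N M δ).history q.1 q.2 t with hL
    set W := (after δ q.2 L).window with hW
    set S := ∑ w ∈ Finset.range (W + 1),
      (if q ∈ windowFail δ u v j₀ l w then 2 ^ (2 ^ w) + 1 else 0) with hS
    have h2 : L.length ≤ (G + (N + M) * S) + K * 2 ^ (W + 1) := by
      refine hlen.trans ((Nat.add_le_add_left (Nat.mul_le_mul_left _ h1) _).trans (le_of_eq ?_))
      rw [hK]
      ring
    have h3 := le_of_le_add_pow h2 hpast
    have h4 : (L.length : ℝ≥0∞) ≤ 2 * (G + (N + M : ℕ) * S) + ENNReal.ofReal C0 := by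
      rw [← ENNReal.ofReal_natCast]
      refine (ENNReal.ofReal_le_ofReal h3).trans ?_
      rw [ENNReal.ofReal_add (by positivity) hC0', ENNReal.ofReal_mul (by norm_num),
        ENNReal.ofReal_natCast, ENNReal.ofReal_ofNat]
      push_cast
      rfl
    have h5 : (S : ℝ≥0∞) ≤ Y q := by
      rw [hS, hY, Nat.cast_sum]
      refine le_trans (le_of_eq (Finset.sum_congr rfl fun w _ => ?_))
        (ENNReal.sum_le_tsum (Finset.range (W + 1)))
      by_cases hq : q ∈ windowFail δ u v j₀ l w <;> simp [hq]
    calc (L.length : ℝ≥0∞) ≤ 2 * (G + (N + M : ℕ) * S) + ENNReal.ofReal C0 := h4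
      _ ≤ 2 * (G + (N + M : ℕ) * Y q) + ENNReal.ofReal C0 := by gcongr
      _ = _ := by ring

/-- The expected number of rounds needed to separate two rows. -/
theorem exists_rowPair_bound (u : Fin N → ℝ) (v : Fin M → ℝ) (a b : Fin N) (j : Fin M) {g : ℝ}
    (hg : 0 < g) (hg1 : g < 1) (hgap : u a * v j + g ≤ u b * v j) : ∃ C : ℝ, 0 ≤ C ∧
    ∀ δ : ℝ, 0 < δ → δ < 1 →
    ∀ (F : Fin N × Fin M × ℕ → Measure ℝ) [∀ q, IsProbabilityMeasure (F q)],
    IsSubgaussianModel u v F → ∃ Z : RewardTable N M × (pairElim N M δ).Seed → ℝ≥0∞,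
      Measurable Z ∧
      (∀ q t, (rounds δ q.2 (RowPair j a b) ((pairElim N M δ).history q.1 q.2 t) : ℝ≥0∞) ≤ Z q) ∧
      ∀ D, ∫⁻ q in D, Z q ∂(pairElim N M δ).runLaw (Measure.infinitePi F) ≤
        ENNReal.ofReal (32 / g ^ 2 * Real.log (1 / δ) + C) *
          (pairElim N M δ).runLaw (Measure.infinitePi F) D + ENNReal.ofReal C := by
  obtain ⟨l, hl, hr, C, hC, hlev⟩ := exists_level N M hg hg1
  refine ⟨C, hC, fun δ hδ hδ1 F _ hF => ?_⟩
  obtain ⟨h1, h2⟩ := hlev δ hδ hδ1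
  have hA := pairElim_isMeasurable N M δ
  have hR := noisySide_rows δ hF
  refine ⟨_, hR.measurable_sepBound hA (sureBeta N M δ) 0 (some j) a b g l,
    fun q t => rounds_rowPair_le hδ hδ1 hF hgap hl hr q t, fun D => ?_⟩
  refine (hR.lintegral_sepBound_le hA (w := 0) (admissible_sureBeta hδ hδ1) _ a b hg.le hl
    D).trans (add_le_add ?_ h2)
  gcongr
  rw [← ENNReal.ofReal_natCast]
  exact ENNReal.ofReal_le_ofReal h1

/-- The expected number of rounds needed to separate two columns in the second phase. -/
theorem exists_colPair_bound (u : Fin N → ℝ) (v : Fin M → ℝ) (i : Fin N) (a b : Fin M) {g : ℝ}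
    (hg : 0 < g) (hg1 : g < 1) (hgap : u i * v a + g ≤ u i * v b) : ∃ C : ℝ, 0 ≤ C ∧
    ∀ δ : ℝ, 0 < δ → δ < 1 →
    ∀ (F : Fin N × Fin M × ℕ → Measure ℝ) [∀ q, IsProbabilityMeasure (F q)],
    IsSubgaussianModel u v F → ∃ Z : RewardTable N M × (pairElim N M δ).Seed → ℝ≥0∞,
      Measurable Z ∧
      (∀ q t, (rounds δ q.2 (ColPair i a b) ((pairElim N M δ).history q.1 q.2 t) : ℝ≥0∞) ≤ Z q) ∧
      ∀ D, ∫⁻ q in D, Z q ∂(pairElim N M δ).runLaw (Measure.infinitePi F) ≤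
        ENNReal.ofReal (32 / g ^ 2 * Real.log (1 / δ) + C) *
          (pairElim N M δ).runLaw (Measure.infinitePi F) D + ENNReal.ofReal C := by
  obtain ⟨l, hl, hr, C, hC, hlev⟩ := exists_level N M hg hg1
  refine ⟨C, hC, fun δ hδ hδ1 F _ hF => ?_⟩
  obtain ⟨h1, h2⟩ := hlev δ hδ hδ1
  have hA := pairElim_isMeasurable N M δ
  have hR := noisySide_cols δ hF
  refine ⟨_, hR.measurable_sepBound hA (sureBeta N M δ) ⊤ (some i) a b g l,
    fun q t => rounds_colPair_le hδ hδ1 hF hgap hl hr q t, fun D => ?_⟩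
  rw [← colEpochBeta_top (N := N) (M := M) (δ := δ)] at h1 h2 ⊢
  refine (hR.lintegral_sepBound_le hA (w := ⊤) (by
    rw [colEpochBeta_top]; exact admissible_sureBeta hδ hδ1) _ a b hg.le hl
    D).trans (add_le_add ?_ h2)
  gcongr
  rw [← ENNReal.ofReal_natCast]
  exact ENNReal.ofReal_le_ofReal h1


variable {N M : ℕ} [NeZero N] [NeZero M] {u : Fin N → ℝ} {v : Fin M → ℝ} {i₀ : Fin N} {j₀ : Fin M}
  {δ : ℝ} {F : Fin N × Fin M × ℕ → Measure ℝ}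

/-- From pathwise bounds of the number of samples to a bound of the expected stopping time. -/
theorem setLIntegral_stoppingTime_le [∀ q, IsProbabilityMeasure (F q)] {ι κ : Type*}
    {D : Set (RewardTable N M × (pairElim N M δ).Seed)} (hD : MeasurableSet D) {s₁ : Finset ι}
    {s₂ : Finset κ} {P₁ : ι → State N M → Prop} {P₂ : κ → State N M → Prop} {k m : ℕ}
    (hlen : ∀ q ∈ D, ∀ t, ((pairElim N M δ).history q.1 q.2 t).length ≤
      k * ∑ i ∈ s₁, rounds δ q.2 (P₁ i) ((pairElim N M δ).history q.1 q.2 t) +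
      k * ∑ i ∈ s₂, rounds δ q.2 (P₂ i) ((pairElim N M δ).history q.1 q.2 t) + m +
      (N + M) * rounds δ q.2 (Unsettled j₀) ((pairElim N M δ).history q.1 q.2 t))
    {c₁ : ι → ℝ} {c₂ : κ → ℝ} {C : ℝ} (hc₁ : ∀ i ∈ s₁, 0 ≤ c₁ i) (hc₂ : ∀ i ∈ s₂, 0 ≤ c₂ i)
    (hC : 0 ≤ C)
    (h₁ : ∀ i ∈ s₁, ∃ Z : RewardTable N M × (pairElim N M δ).Seed → ℝ≥0∞, Measurable Z ∧
      (∀ q t, (rounds δ q.2 (P₁ i) ((pairElim N M δ).history q.1 q.2 t) : ℝ≥0∞) ≤ Z q) ∧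
      ∫⁻ q in D, Z q ∂(pairElim N M δ).runLaw (Measure.infinitePi F) ≤ ENNReal.ofReal (c₁ i))
    (h₂ : ∀ i ∈ s₂, ∃ Z : RewardTable N M × (pairElim N M δ).Seed → ℝ≥0∞, Measurable Z ∧
      (∀ q t, (rounds δ q.2 (P₂ i) ((pairElim N M δ).history q.1 q.2 t) : ℝ≥0∞) ≤ Z q) ∧
      ∫⁻ q in D, Z q ∂(pairElim N M δ).runLaw (Measure.infinitePi F) ≤ ENNReal.ofReal (c₂ i))
    (hX : ∃ X : RewardTable N M × (pairElim N M δ).Seed → ℝ≥0∞, Measurable X ∧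
      ∫⁻ q, X q ∂(pairElim N M δ).runLaw (Measure.infinitePi F) ≤ ENNReal.ofReal C ∧
      ∀ q t (G : ℕ), ((pairElim N M δ).history q.1 q.2 t).length ≤
          G + (N + M) * rounds δ q.2 (Unsettled j₀) ((pairElim N M δ).history q.1 q.2 t) →
        (((pairElim N M δ).history q.1 q.2 t).length : ℝ≥0∞) ≤ 2 * G + X q) :
    ∫⁻ q in D, ((pairElim N M δ).stoppingTime q.1 q.2 : ℝ≥0∞)
      ∂(pairElim N M δ).runLaw (Measure.infinitePi F) ≤
      ENNReal.ofReal (2 * (k * ∑ i ∈ s₁, c₁ i + k * ∑ i ∈ s₂, c₂ i + m) + C) := by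
  have hp : IsProbabilityMeasure ((pairElim N M δ).runLaw (Measure.infinitePi F)) := by
    unfold Algorithm.runLaw; infer_instance
  choose! Z₁ hm₁ hb₁ hi₁ using h₁
  choose! Z₂ hm₂ hb₂ hi₂ using h₂
  obtain ⟨X, hXm, hXi, hXb⟩ := hX
  have hs₁ : Measurable fun q => ∑ i ∈ s₁, Z₁ i q := Finset.measurable_fun_sum _ hm₁
  have hs₂ : Measurable fun q => ∑ i ∈ s₂, Z₂ i q := Finset.measurable_fun_sum _ hm₂
  have hpath : ∀ q ∈ D, ((pairElim N M δ).stoppingTime q.1 q.2 : ℝ≥0∞) ≤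
      2 * (k * ∑ i ∈ s₁, Z₁ i q + k * ∑ i ∈ s₂, Z₂ i q + m) + X q := by
    intro q hq
    rw [← Algorithm.iSup_length_history]
    refine iSup_le fun t => (hXb q t _ (hlen q hq t)).trans ?_
    push_cast
    gcongr with i hi i hi
    · exact hb₁ i hi q t
    · exact hb₂ i hi q t
  have hmeas : Measurable fun q => k * ∑ i ∈ s₁, Z₁ i q + k * ∑ i ∈ s₂, Z₂ i q + (m : ℝ≥0∞) :=
    ((hs₁.const_mul _).add (hs₂.const_mul _)).add_const _
  refine (setLIntegral_mono' hD hpath).trans ?_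
  rw [lintegral_add_right _ hXm, lintegral_const_mul _ hmeas,
    lintegral_add_right _ measurable_const, lintegral_add_right _ (hs₂.const_mul _),
    lintegral_const_mul _ hs₁, lintegral_const_mul _ hs₂, setLIntegral_const,
    lintegral_finsetSum' _ fun i hi => (hm₁ i hi).aemeasurable,
    lintegral_finsetSum' _ fun i hi => (hm₂ i hi).aemeasurable]
  have hsum₁ : 0 ≤ ∑ i ∈ s₁, c₁ i := Finset.sum_nonneg hc₁
  have hsum₂ : 0 ≤ ∑ i ∈ s₂, c₂ i := Finset.sum_nonneg hc₂
  rw [ENNReal.ofReal_add (by positivity) hC, ENNReal.ofReal_mul (by norm_num),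
    ENNReal.ofReal_add (by positivity) (by positivity),
    ENNReal.ofReal_add (by positivity) (by positivity), ENNReal.ofReal_mul (by positivity),
    ENNReal.ofReal_mul (by positivity), ENNReal.ofReal_sum_of_nonneg hc₁,
    ENNReal.ofReal_sum_of_nonneg hc₂, ENNReal.ofReal_natCast, ENNReal.ofReal_natCast,
    ENNReal.ofReal_ofNat]
  gcongr with i hi i hi
  · exact hi₁ i hi
  · exact hi₂ i hi
  · exact (mul_le_mul_right prob_le_one _).trans_eq (mul_one _)
  · exact (setLIntegral_le_lintegral _ _).trans hXi

theorem mul_gap_lt_one {x y z : ℝ} (hx : x ∈ Set.Ioo (0 : ℝ) 1) (hy : y ∈ Set.Ioo (0 : ℝ) 1)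
    (hz : z ∈ Set.Ioo (0 : ℝ) 1) : x * (y - z) < 1 := by
  obtain ⟨hx0, hx1⟩ := hx
  obtain ⟨hy0, hy1⟩ := hy
  obtain ⟨hz0, hz1⟩ := hz
  nlinarith

/-- The expected number of samples on the event that the best pair survives. The constant is
`192 = 2 * 3 * 32`: `32 / g ^ 2 * log (1 / δ)` rounds separate an item at distance `g` from the best
one, every such round is charged `3` samples, and the unsettled rounds cost a factor `2`. -/
theorem exists_setLIntegral_bestSurvives_le (h : IsInstance u v i₀ j₀) : ∃ C : ℝ, 0 ≤ C ∧
    ∀ δ : ℝ, 0 < δ → δ < 1 →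
    ∀ (F : Fin N × Fin M × ℕ → Measure ℝ) [∀ q, IsProbabilityMeasure (F q)],
    IsSubgaussianModel u v F →
    ∫⁻ q in bestSurvives δ i₀ j₀, ((pairElim N M δ).stoppingTime q.1 q.2 : ℝ≥0∞)
      ∂(pairElim N M δ).runLaw (Measure.infinitePi F) ≤
      ENNReal.ofReal (192 * complexity u v * Real.log (1 / δ) + C) := by
  have hrow : ∀ a, a ≠ i₀ → 0 < v j₀ * (u i₀ - u a) := fun a ha =>
    mul_pos (h.col_mem _).1 (sub_pos.2 (h.row_best a ha))
  have hcol : ∀ b, b ≠ j₀ → 0 < u i₀ * (v j₀ - v b) := fun b hb =>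
    mul_pos (h.row_mem _).1 (sub_pos.2 (h.col_best b hb))
  have hR := fun a ha => exists_rowPair_bound u v a i₀ j₀ (hrow a ha)
    (mul_gap_lt_one (h.col_mem _) (h.row_mem _) (h.row_mem _)) (by linarith)
  have hC := fun b hb => exists_colPair_bound u v i₀ b j₀ (hcol b hb)
    (mul_gap_lt_one (h.row_mem _) (h.col_mem _) (h.col_mem _)) (by linarith)
  choose! CR hCR0 hCR using hR
  choose! CC hCC0 hCC using hC
  obtain ⟨CX, hCX0, hCX⟩ := exists_unsettled_bound h
  have hsumR : 0 ≤ ∑ a with a ≠ i₀, CR a :=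
    Finset.sum_nonneg fun a ha => hCR0 a (Finset.mem_filter.1 ha).2
  have hsumC : 0 ≤ ∑ b with b ≠ j₀, CC b :=
    Finset.sum_nonneg fun b hb => hCC0 b (Finset.mem_filter.1 hb).2
  refine ⟨12 * ∑ a with a ≠ i₀, CR a + 12 * ∑ b with b ≠ j₀, CC b + 8 + CX, by positivity,
    fun δ hδ hδ1 F _ hF => ?_⟩
  have hp : IsProbabilityMeasure ((pairElim N M δ).runLaw (Measure.infinitePi F)) := by
    unfold Algorithm.runLaw; infer_instance
  have hL : 0 ≤ Real.log (1 / δ) := Real.log_nonneg (by rw [le_div_iff₀ hδ]; linarith)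
  have hprob : ∀ x c : ℝ, 0 ≤ x → 0 ≤ c → ENNReal.ofReal (x + c) *
      (pairElim N M δ).runLaw (Measure.infinitePi F) (bestSurvives δ i₀ j₀) + ENNReal.ofReal c ≤
      ENNReal.ofReal (x + 2 * c) := fun x c hx hc => by
    calc _ ≤ ENNReal.ofReal (x + c) * 1 + ENNReal.ofReal c := by gcongr; exact prob_le_one
      _ = _ := by rw [mul_one, ← ENNReal.ofReal_add (by positivity) hc]; congr 1; ring
  have hmain := setLIntegral_stoppingTime_le (F := F) (measurableSet_bestSurvives δ i₀ j₀)
    (s₁ := Finset.univ.filter (fun a => a ≠ i₀)) (s₂ := Finset.univ.filter (fun b => b ≠ j₀))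
    (P₁ := fun a => RowPair j₀ a i₀) (P₂ := fun b => ColPair i₀ b j₀) (k := 3) (m := 4)
    (fun q hq t => length_le_of_bestSurvives hq t)
    (c₁ := fun a => 32 / (v j₀ * (u i₀ - u a)) ^ 2 * Real.log (1 / δ) + 2 * CR a)
    (c₂ := fun b => 32 / (u i₀ * (v j₀ - v b)) ^ 2 * Real.log (1 / δ) + 2 * CC b)
    (fun a ha => add_nonneg (by positivity)
      (mul_nonneg (by norm_num) (hCR0 a (Finset.mem_filter.1 ha).2)))
    (fun b hb => add_nonneg (by positivity)
      (mul_nonneg (by norm_num) (hCC0 b (Finset.mem_filter.1 hb).2))) hCX0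
    (fun a ha => ?_) (fun b hb => ?_) (hCX δ F hF)
  · refine hmain.trans (ENNReal.ofReal_le_ofReal (le_of_eq ?_))
    rw [complexity_eq h]
    simp only [Finset.sum_add_distrib, ← Finset.mul_sum, ← Finset.sum_mul]
    have hdiv : ∀ x : ℝ, 32 / x = 32 * (1 / x) := fun x => by ring
    simp only [hdiv, ← Finset.mul_sum]
    push_cast
    ring
  · have ha' := (Finset.mem_filter.1 ha).2
    obtain ⟨Z, hZ, hb, hi⟩ := hCR a ha' δ hδ hδ1 F hF
    exact ⟨Z, hZ, hb, (hi _).trans (hprob _ _ (by positivity) (hCR0 a ha'))⟩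
  · have hb' := (Finset.mem_filter.1 hb).2
    obtain ⟨Z, hZ, hb, hi⟩ := hCC b hb' δ hδ hδ1 F hF
    exact ⟨Z, hZ, hb, (hi _).trans (hprob _ _ (by positivity) (hCC0 b hb'))⟩

/-- If the entries of `u` are pairwise distinct and those of `v` as well, the expected number of
samples on the event that the best pair is eliminated is bounded: this event has probability at most
`δ`, and the number of samples is of order `log (1 / δ)`. -/
theorem exists_setLIntegral_compl_le (h : IsInstance u v i₀ j₀) (hu : Function.Injective u)
    (hv : Function.Injective v) : ∃ C : ℝ, 0 ≤ C ∧ ∀ δ : ℝ, 0 < δ → δ < 1 →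
    ∀ (F : Fin N × Fin M × ℕ → Measure ℝ) [∀ q, IsProbabilityMeasure (F q)],
    IsSubgaussianModel u v F →
    ∫⁻ q in (bestSurvives δ i₀ j₀)ᶜ, ((pairElim N M δ).stoppingTime q.1 q.2 : ℝ≥0∞)
      ∂(pairElim N M δ).runLaw (Measure.infinitePi F) ≤ ENNReal.ofReal C := by
  have hrow : ∀ p : Fin N × Fin N, u p.1 < u p.2 → 0 < v j₀ * (u p.2 - u p.1) := fun p hp =>
    mul_pos (h.col_mem _).1 (sub_pos.2 hp)
  have hcol : ∀ p : Fin N × Fin M × Fin M, v p.2.1 < v p.2.2 →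
      0 < u p.1 * (v p.2.2 - v p.2.1) := fun p hp =>
    mul_pos (h.row_mem _).1 (sub_pos.2 hp)
  have hR := fun p hp => exists_rowPair_bound u v p.1 p.2 j₀ (hrow p hp)
    (mul_gap_lt_one (h.col_mem _) (h.row_mem _) (h.row_mem _)) (by linarith)
  have hC := fun p hp => exists_colPair_bound u v p.1 p.2.1 p.2.2 (hcol p hp)
    (mul_gap_lt_one (h.row_mem _) (h.col_mem _) (h.col_mem _)) (by linarith)
  choose! CR hCR0 hCR using hR
  choose! CC hCC0 hCC using hC
  obtain ⟨CX, hCX0, hCX⟩ := exists_unsettled_bound h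
  set c₁ : Fin N × Fin N → ℝ := fun p =>
    32 / (v j₀ * (u p.2 - u p.1)) ^ 2 + 2 * CR p with hc₁
  set c₂ : Fin N × Fin M × Fin M → ℝ := fun p =>
    32 / (u p.1 * (v p.2.2 - v p.2.1)) ^ 2 + 2 * CC p with hc₂
  have hc₁0 : ∀ p ∈ Finset.univ.filter (fun p : Fin N × Fin N => u p.1 < u p.2), 0 ≤ c₁ p :=
    fun p hp => add_nonneg (by positivity)
      (mul_nonneg (by norm_num) (hCR0 p (Finset.mem_filter.1 hp).2))
  have hc₂0 : ∀ p ∈ Finset.univ.filter (fun p : Fin N × Fin M × Fin M => v p.2.1 < v p.2.2),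
      0 ≤ c₂ p := fun p hp => add_nonneg (by positivity)
      (mul_nonneg (by norm_num) (hCC0 p (Finset.mem_filter.1 hp).2))
  have hsum₁ := Finset.sum_nonneg hc₁0
  have hsum₂ := Finset.sum_nonneg hc₂0
  refine ⟨_, ?_, fun δ hδ hδ1 F _ hF => setLIntegral_stoppingTime_le (F := F)
    (measurableSet_bestSurvives δ i₀ j₀).compl
    (s₁ := Finset.univ.filter (fun p : Fin N × Fin N => u p.1 < u p.2))
    (s₂ := Finset.univ.filter (fun p : Fin N × Fin M × Fin M => v p.2.1 < v p.2.2))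
    (P₁ := fun p => RowPair j₀ p.1 p.2) (P₂ := fun p => ColPair p.1 p.2.1 p.2.2)
    (k := N + M) (m := (N + M) * 2)
    (fun q _ t => (length_le_of_injective hu hv j₀ q t).trans (le_of_eq (by ring)))
    (c₁ := c₁) (c₂ := c₂) hc₁0 hc₂0 hCX0 (fun p hp => ?_) (fun p hp => ?_) (hCX δ F hF)⟩
  · positivity
  all_goals
    have hprob : ∀ x c : ℝ, 0 ≤ x → 0 ≤ c → ENNReal.ofReal (x * Real.log (1 / δ) + c) *
        (pairElim N M δ).runLaw (Measure.infinitePi F) (bestSurvives δ i₀ j₀)ᶜ +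
        ENNReal.ofReal c ≤ ENNReal.ofReal (x + 2 * c) := fun x c hx hc => by
      have hL : 0 ≤ Real.log (1 / δ) := Real.log_nonneg (by rw [le_div_iff₀ hδ]; linarith)
      -- The event has probability at most `δ`, which compensates `log (1 / δ)`.
      have hL1 : Real.log (1 / δ) * δ ≤ 1 := by
        have := Real.log_le_sub_one_of_pos (one_div_pos.2 hδ)
        calc Real.log (1 / δ) * δ ≤ (1 / δ - 1) * δ := by gcongr
          _ = 1 - δ := by field_simp
          _ ≤ 1 := by linarith
      calc _ ≤ ENNReal.ofReal (x * Real.log (1 / δ) + c) * ENNReal.ofReal δ +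
            ENNReal.ofReal c := by
            gcongr
            exact measure_compl_bestSurvives_le hδ hδ1 h hF
        _ = ENNReal.ofReal (x * (Real.log (1 / δ) * δ) + c * δ + c) := by
            rw [← ENNReal.ofReal_mul (by positivity), ← ENNReal.ofReal_add (by positivity) hc]
            congr 1
            ring
        _ ≤ _ := by
            refine ENNReal.ofReal_le_ofReal ?_
            nlinarith
    have hp' := (Finset.mem_filter.1 hp).2
  · obtain ⟨Z, hZ, hb, hi⟩ := hCR p hp' δ hδ hδ1 F hF
    exact ⟨Z, hZ, hb, (hi _).trans (hprob _ _ (by positivity) (hCR0 p hp'))⟩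
  · obtain ⟨Z, hZ, hb, hi⟩ := hCC p hp' δ hδ hδ1 F hF
    exact ⟨Z, hZ, hb, (hi _).trans (hprob _ _ (by positivity) (hCC0 p hp'))⟩

/-- The best pair is output with probability at least `1 - δ`: on the event that it survives, the
algorithm stops almost surely. -/
theorem le_measure_outputEvent (hδ : 0 < δ) (hδ1 : δ < 1) (h : IsInstance u v i₀ j₀)
    [∀ q, IsProbabilityMeasure (F q)] (hF : IsSubgaussianModel u v F) :
    ENNReal.ofReal (1 - δ) ≤ (pairElim N M δ).runLaw (Measure.infinitePi F)
      ((pairElim N M δ).outputEvent (i₀, j₀)) := by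
  have hp : IsProbabilityMeasure ((pairElim N M δ).runLaw (Measure.infinitePi F)) := by
    unfold Algorithm.runLaw; infer_instance
  obtain ⟨C, -, hC⟩ := exists_setLIntegral_bestSurvives_le h
  have hint := hC δ hδ hδ1 F hF
  set P := (pairElim N M δ).runLaw (Measure.infinitePi F) with hP
  have hS := measurableSet_bestSurvives (N := N) (M := M) δ i₀ j₀
  have hmeas : Measurable fun q : RewardTable N M × (pairElim N M δ).Seed =>
      ((pairElim N M δ).stoppingTime q.1 q.2 : ℝ≥0∞) := by
    simp only [← Algorithm.iSup_length_history]
    exact Measurable.iSup fun t => Algorithm.measurable_seed_history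
      (pairElim_isMeasurable N M δ) t
      (ListMeasurable.of_length (fun n _ => (n : ℝ≥0∞)) fun _ => measurable_const)
  have htop : ∀ᵐ q ∂P.restrict (bestSurvives δ i₀ j₀),
      ((pairElim N M δ).stoppingTime q.1 q.2 : ℝ≥0∞) < ⊤ :=
    ae_lt_top hmeas (ne_top_of_le_ne_top ENNReal.ofReal_ne_top hint)
  have hle : P (bestSurvives δ i₀ j₀) ≤ P ((pairElim N M δ).outputEvent (i₀, j₀)) := by
    rw [ae_restrict_iff' hS] at htop
    refine measure_mono_ae ?_
    filter_upwards [htop] with q hq hqS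
    refine mem_outputEvent_of_bestSurvives hqS fun hτ => ?_
    have := hq hqS
    rw [hτ] at this
    simp at this
  refine le_trans ?_ hle
  have h1 := measure_compl_bestSurvives_le hδ hδ1 h hF
  rw [prob_compl_eq_one_sub hS] at h1
  rw [ENNReal.ofReal_sub _ hδ.le, ENNReal.ofReal_one]
  exact tsub_le_iff_tsub_le.1 h1

end State

end PairSelection

open PairSelection in
theorem theorem2 :
    -- Pair-Elim: correctness and sample complexity, with a universal constant `cu`
    (∃ cu : ℝ, 0 < cu ∧
      ∀ (N M : ℕ) [NeZero N] [NeZero M] (u : Fin N → ℝ) (v : Fin M → ℝ) (i₀ : Fin N) (j₀ : Fin M),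
        IsInstance u v i₀ j₀ →
        ∃ cp : ℝ, 0 < cp ∧ ∀ δ : ℝ, 0 < δ → δ < 1 →
          (pairElim N M δ).IsMeasurable ∧
          ∀ (F : Fin N × Fin M × ℕ → Measure ℝ) [∀ q, IsProbabilityMeasure (F q)],
            IsSubgaussianModel u v F →
            -- the best pair is output with probability at least `1 - δ`
            ENNReal.ofReal (1 - δ) ≤ (pairElim N M δ).runLaw (Measure.infinitePi F)
                ((pairElim N M δ).outputEvent (i₀, j₀)) ∧
            -- expected stopping time, restricted to the event that the best pair is output
            ∫⁻ q in (pairElim N M δ).outputEvent (i₀, j₀),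
                ((pairElim N M δ).stoppingTime q.1 q.2 : ℝ≥0∞)
                  ∂((pairElim N M δ).runLaw (Measure.infinitePi F)) ≤
              ENNReal.ofReal (cu * complexity u v * Real.log (1 / δ) +
                cp * max 1 (Real.log (Real.log (1 / δ)))) ∧
            -- expected stopping time
            (Function.Injective u → Function.Injective v →
              ∫⁻ q, ((pairElim N M δ).stoppingTime q.1 q.2 : ℝ≥0∞)
                  ∂((pairElim N M δ).runLaw (Measure.infinitePi F)) ≤
                ENNReal.ofReal (cu * complexity u v * Real.log (1 / δ) +
                  cp * max 1 (Real.log (Real.log (1 / δ)))))) ∧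
    -- tightness: lower bound for every `δ`-PAC algorithm, on every instance, for Gaussian rewards
    (∀ (N M : ℕ) (σ2 : ℝ≥0) (δ : ℝ), 0 < δ → δ < 1 →
      ∀ A : Algorithm N M, A.IsMeasurable → A.IsPAC σ2 δ →
        ∀ (u : Fin N → ℝ) (v : Fin M → ℝ) (i₀ : Fin N) (j₀ : Fin M), IsInstance u v i₀ j₀ →
          ENNReal.ofReal (σ2 * complexity u v * (Real.log (1 / δ) - 1)) ≤
            ∫⁻ q, (A.stoppingTime q.1 q.2 : ℝ≥0∞) ∂(A.runLaw (gaussianTable u v σ2))) := by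
  refine ⟨⟨192, by norm_num, fun N M _ _ u v i₀ j₀ h => ?_⟩,
    fun N M σ2 δ h0 h1 A hA hPAC u v i₀ j₀ h => hPAC.le_lintegral_stoppingTime hA h0 h⟩
  obtain ⟨C₁, hC₁, hbest⟩ := State.exists_setLIntegral_bestSurvives_le h
  obtain ⟨C₂, hC₂, hcompl⟩ : ∃ C : ℝ, 0 ≤ C ∧ (Function.Injective u → Function.Injective v →
      ∀ δ : ℝ, 0 < δ → δ < 1 → ∀ (F : Fin N × Fin M × ℕ → Measure ℝ)
        [∀ q, IsProbabilityMeasure (F q)], IsSubgaussianModel u v F →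
        ∫⁻ q in (State.bestSurvives δ i₀ j₀)ᶜ, ((pairElim N M δ).stoppingTime q.1 q.2 : ℝ≥0∞)
          ∂((pairElim N M δ).runLaw (Measure.infinitePi F)) ≤ ENNReal.ofReal C) := by
    by_cases huv : Function.Injective u ∧ Function.Injective v
    · obtain ⟨C, hC, hle⟩ := State.exists_setLIntegral_compl_le h huv.1 huv.2
      exact ⟨C, hC, fun _ _ => hle⟩
    · exact ⟨0, le_rfl, fun hu hv => absurd ⟨hu, hv⟩ huv⟩
  refine ⟨C₁ + C₂ + 1, by positivity, fun δ hδ hδ1 =>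
    ⟨pairElim_isMeasurable N M δ, fun F _ hF => ?_⟩⟩
  have hmain : 0 ≤ 192 * complexity u v * Real.log (1 / δ) :=
    mul_nonneg (mul_nonneg (by norm_num) (complexity_nonneg u v))
      (Real.log_nonneg (by rw [le_div_iff₀ hδ]; linarith))
  have hcp : C₁ + C₂ + 1 ≤ (C₁ + C₂ + 1) * max 1 (Real.log (Real.log (1 / δ))) :=
    le_mul_of_one_le_right (by positivity) (le_max_left _ _)
  refine ⟨State.le_measure_outputEvent hδ hδ1 h hF, ?_, fun hu hv => ?_⟩
  · refine (lintegral_mono_set (State.outputEvent_subset_bestSurvives δ i₀ j₀)).trans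
      ((hbest δ hδ hδ1 F hF).trans (ENNReal.ofReal_le_ofReal ?_))
    linarith
  · rw [← lintegral_add_compl _ (State.measurableSet_bestSurvives δ i₀ j₀)]
    refine (add_le_add (hbest δ hδ hδ1 F hF) (hcompl hu hv δ hδ hδ1 F hF)).trans ?_
    rw [← ENNReal.ofReal_add (by positivity) hC₂]
    exact ENNReal.ofReal_le_ofReal (by linarith)
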